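/- **Setting.** Let $n\ge 1$ and let $\rho:\mathbb R^n\to(0,\infty)$ be a critical radius function, i.e. a continuous function for which there are $C_0,k_0\ge 1$ such that for all $x,y\in\mathbb R^n$ $$C_0^{-1}\rho(x)\Bigl(1+\tfrac{|x-y|}{\rho(x)}\Bigr)^{-k_0}\le\rho(y)\le C_0\,\rho(x)\Bigl(1+\tfrac{|x-y|}{\rho(x)}\Bigr)^{\frac{k_0}{k_0+1}}.$$ For a ball $B=B(x_0,r)$ and $\theta\ge0$ put $\Psi_\theta(B)=(1+r/\rho(x_0))^\theta$. A weight is a positive (a.e.) locally integrable function $\omega$. For $1<q<\infty$, $\omega\in A_q^{\rho,\theta}$ means that $$\Bigl(\tfrac1{\Psi_\theta(B)|B|}\int_B\omega\Bigr)\Bigl(\tfrac1{\Psi_\theta(B)|B|}\int_B\omega^{-\frac1{q-1}}\Bigr)^{q-1}\le C$$ for all balls $B$, with $C$ independent of $B$; $\omega\in A_1^{\rho,\theta}$ means $\sup_{B\ni x}\frac1{\Psi_\theta(B)|B|}\int_B\omega\le C\omega(x)$ for a.e. $x$. Let $A_q^{\rho,\infty}=\bigcup_{\theta\ge0}A_q^{\rho,\theta}$,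 $A_\infty^{\rho,\infty}=\bigcup_{q\ge1}A_q^{\rho,\infty}$, and for $\omega\in A_\infty^{\rho,\infty}$ let $q_\omega=\inf\{q\in[1,\infty):\omega\in A_q^{\rho,\infty}\}$. For a $[0,\infty]$-valued function $g$ put $\|g\|_{L^p_\omega}=\bigl(\int g^p\,\omega\,dx\bigr)^{1/p}\in[0,\infty]$. For $\varphi\in\mathcal D(\mathbb R^n)=C_0^\infty(\mathbb R^n)$ and $j\in\mathbb Z$ write $\varphi_j(x)=2^{jn}\varphi(2^jx)$, and let $j_x\in\mathbb Z$ be the integer with $2^{-j_x}<\rho(x)\le2^{-j_x+1}$. For $\psi_0\in\mathcal D(\mathbb R^n)$, $f\in\mathcal D'(\mathbb R^n)$, $A,B\ge0$, $N\in\{0,1,2,\dots\}$, $R>0$ define $$\psi_0^+(f)(x)=\sup_{j\ge j_x}|(\psi_0)_j*f(x)|,\qquad \psi^{**}_{0,A,B}(f)(x)=\sup_{j\ge j_x,\;y\in\mathbb R^n}\frac{|(\psi_0)_j*f(x-y)|}{(1+2^j|y|)^A\,2^{B|y|/\rho(x)}},$$ $$\widetilde{\mathcal M}_{N,R}(f)(x)=\sup\bigl\{|\varphi_l*f(z)|:\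 l\in\mathbb Z,\ |x-z|<2^{-l}<\rho(x),\ \varphi\in\mathcal D_{N,R}\bigr\},$$ where $\mathcal D_{N,R}$ is the set of $\varphi\in\mathcal D(\mathbb R^n)$ with $\operatorname{supp}\varphi\subset B(0,R)$ and $\sup_x|\partial^\alpha\varphi(x)|\le1$ for all $|\alpha|\le N$. **Theorem 3.1.** Let $\omega\in A_\infty^{\rho,\infty}$, $R\in(0,\infty)$, $p\in(0,1]$ and $\psi_0\in\mathcal D(\mathbb R^n)$ with $\int\psi_0\ne0$. Let $A_0,B_0>0$ be arbitrary positive numbers and set $$A_1=\max\{A_0,\;nq_\omega/p\},\qquad B_1=B_0/p,\qquad N_0=[2A_1]+1.$$ Then for all $A>A_1$, $B>B_1$ and all integers $N\ge N_0$ there is a constant $C>0$, depending only on $A,B,N,R,\psi_0,p,\rho,\omega$ and $n$, such that for every $f\in\mathcal D'(\mathbb R^n)$ $$\|\psi^{**}_{0,A,B}(f)\|_{L^p_\omega}\le C\,\|\psi_0^+(f)\|_{L^p_\omega} \qquad\text{and}\qquad \|\widetilde{\mathcal M}_{N,R}(f)\|_{L^p_\omega}\le C\,\|\psi_0^+(f)\|_{L^p_\omega}.$$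 -/

import Mathlib

open MeasureTheory TopologicalSpace Metric
open scoped ENNReal NNReal Distributions

namespace LocalHardy

/-- Euclidean space `ℝⁿ`. -/
abbrev Rn (n : ℕ) : Type := EuclideanSpace ℝ (Fin n)

/-- The space `𝒟(ℝⁿ) = C₀^∞(ℝⁿ)` of complex-valued test functions. -/
abbrev TestFn (n : ℕ) : Type := 𝓓((⊤ : Opens (Rn n)), ℂ)

/-- The space `𝒟'(ℝⁿ)` of distributions: continuous linear functionals on `𝒟(ℝⁿ)`. -/
abbrev Distr (n : ℕ) : Type := TestFn n →L[ℂ] ℂ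

variable {n : ℕ}

/-! ### Critical radius functions and weights -/

/-- `ρ` is a critical radius function: it is positive, continuous, and for some `C₀, k₀ ≥ 1`
`C₀⁻¹ ρ(x) (1 + |x-y|/ρ(x))^(-k₀) ≤ ρ(y) ≤ C₀ ρ(x) (1 + |x-y|/ρ(x))^(k₀/(k₀+1))`
for all `x, y`. -/
structure IsCriticalRadius (ρ : Rn n → ℝ) : Prop where
  pos : ∀ x, 0 < ρ x
  continuous : Continuous ρ
  comparable : ∃ C₀ k₀ : ℝ, 1 ≤ C₀ ∧ 1 ≤ k₀ ∧ ∀ x y : Rn n,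
    C₀⁻¹ * ρ x * (1 + ‖x - y‖ / ρ x) ^ (-k₀) ≤ ρ y ∧
    ρ y ≤ C₀ * ρ x * (1 + ‖x - y‖ / ρ x) ^ (k₀ / (k₀ + 1))

/-- A weight: an (almost everywhere) positive, locally integrable function. -/
structure IsWeight (ω : Rn n → ℝ) : Prop where
  pos : ∀ᵐ x, 0 < ω x
  locallyIntegrable : LocallyIntegrable ω

/-- `Ψ_θ(B) = (1 + r/ρ(c))^θ` for the ball `B = B(c, r)`. -/
noncomputable def Psi (ρ : Rn n → ℝ) (θ : ℝ) (c : Rn n) (r : ℝ) : ℝ :=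
  (1 + r / ρ c) ^ θ

/-- The mean `(Ψ_θ(B) |B|)⁻¹ ∫_B g` of a nonnegative function over the ball `B = B(c, r)`. -/
noncomputable def psiMean (ρ : Rn n → ℝ) (θ : ℝ) (g : Rn n → ℝ≥0∞) (c : Rn n) (r : ℝ) : ℝ≥0∞ :=
  (∫⁻ y in ball c r, g y) / (ENNReal.ofReal (Psi ρ θ c r) * volume (ball c r))

/-- The maximal function `M_{V,θ} g (x) = sup_{B ∋ x} (Ψ_θ(B) |B|)⁻¹ ∫_B |g|`
over all balls `B` containing `x`. -/
noncomputable def maximalFn (ρ : Rn n → ℝ) (θ : ℝ) (g : Rn n → ℝ) (x : Rn n) : ℝ≥0∞ :=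
  ⨆ (c : Rn n) (r : ℝ) (_ : 0 < r) (_ : x ∈ ball c r),
    psiMean ρ θ (fun y => ENNReal.ofReal |g y|) c r

/-- The weight class `A_1^{ρ,θ}(ℝⁿ)`. -/
def MemA1 (ρ : Rn n → ℝ) (θ : ℝ) (ω : Rn n → ℝ) : Prop :=
  ∃ C : ℝ≥0, ∀ᵐ x, maximalFn ρ θ ω x ≤ C * ENNReal.ofReal (ω x)

/-- The condition defining the weight class `A_p^{ρ,θ}(ℝⁿ)` for `1 < p < ∞`. -/
def MemApGtOne (ρ : Rn n → ℝ) (p θ : ℝ) (ω : Rn n → ℝ) : Prop :=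
  ∃ C : ℝ≥0, ∀ (c : Rn n) (r : ℝ), 0 < r →
    psiMean ρ θ (fun y => ENNReal.ofReal (ω y)) c r *
      psiMean ρ θ (fun y => ENNReal.ofReal (ω y ^ (-1 / (p - 1)))) c r ^ (p - 1) ≤ C

/-- `ω ∈ A_p^{ρ,θ}(ℝⁿ)`, `1 ≤ p < ∞`. -/
def MemAp (ρ : Rn n → ℝ) (p θ : ℝ) (ω : Rn n → ℝ) : Prop :=
  IsWeight ω ∧ ((p = 1 ∧ MemA1 ρ θ ω) ∨ (1 < p ∧ MemApGtOne ρ p θ ω))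

/-- `A_p^{ρ,∞}(ℝⁿ) = ⋃_{θ ≥ 0} A_p^{ρ,θ}(ℝⁿ)`. -/
def MemApInf (ρ : Rn n → ℝ) (p : ℝ) (ω : Rn n → ℝ) : Prop :=
  ∃ θ : ℝ, 0 ≤ θ ∧ MemAp ρ p θ ω

/-- `A_∞^{ρ,∞}(ℝⁿ) = ⋃_{p ≥ 1} A_p^{ρ,∞}(ℝⁿ)`. -/
def MemAInfInf (ρ : Rn n → ℝ) (ω : Rn n → ℝ) : Prop :=
  ∃ p : ℝ, 1 ≤ p ∧ MemApInf ρ p ω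

/-- The critical index `q_ω = inf {p ∈ [1, ∞) : ω ∈ A_p^{ρ,∞}(ℝⁿ)}`. -/
noncomputable def critIndex (ρ : Rn n → ℝ) (ω : Rn n → ℝ) : ℝ :=
  sInf {p : ℝ | 1 ≤ p ∧ MemApInf ρ p ω}

/-- The quasi-norm `‖g‖_{L^p_ω} = (∫ g^p ω)^{1/p}` of a `[0,∞]`-valued function
(with value `∞` when `g ∉ L^p_ω`). -/
noncomputable def lpNorm (p : ℝ) (ω : Rn n → ℝ) (g : Rn n → ℝ≥0∞) : ℝ≥0∞ :=
  (∫⁻ x, g x ^ p * ENNReal.ofReal (ω x)) ^ (1 / p)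

/-! ### Convolution of a distribution with a dilated test function -/

/-- The test function `y ↦ φ_j(x - y)`, where `φ_j(z) = 2^{jn} φ(2^j z)`. -/
noncomputable def dilateReflect (φ : TestFn n) (j : ℤ) (x : Rn n) : TestFn n where
  toFun y := ((2 : ℝ) ^ (j * (n : ℤ))) • φ ((2 : ℝ) ^ j • (x - y))
  contDiff' := by
    have h : ContDiff ℝ ((⊤ : ℕ∞) : WithTop ℕ∞) (fun y : Rn n => (2 : ℝ) ^ j • (x - y)) := by
      fun_prop
    exact (φ.contDiff.comp h).const_smul _
  hasCompactSupport' := by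
    have h2 : ((2 : ℝ) ^ j) ≠ 0 := zpow_ne_zero _ two_ne_zero
    have h3 : HasCompactSupport (fun y : Rn n => φ ((2 : ℝ) ^ j • (x - y))) :=
      φ.hasCompactSupport.comp_homeomorph
        ((Homeomorph.subLeft x).trans (Homeomorph.smulOfNeZero _ h2))
    exact h3.mono fun y hy hy0 => hy (by simp [hy0])
  tsupport_subset' := by simp

/-- The (smooth) function `φ_j * f (x) = ⟨f, φ_j(x - ·)⟩`, for `f ∈ 𝒟'(ℝⁿ)`. -/
noncomputable def conv (φ : TestFn n) (j : ℤ) (f : Distr n) (x : Rn n) : ℂ :=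
  f (dilateReflect φ j x)

/-! ### The local maximal functions -/

/-- The integer `j_x` with `2^{-j_x} < ρ(x) ≤ 2^{-j_x+1}`; see `critScale_spec`. -/
noncomputable def critScale (ρ : Rn n → ℝ) (x : Rn n) : ℤ :=
  1 - Int.clog 2 (ρ x)

theorem critScale_spec (ρ : Rn n → ℝ) (x : Rn n) (hx : 0 < ρ x) (j : ℤ) :
    ((2 : ℝ) ^ (-j) < ρ x ∧ ρ x ≤ (2 : ℝ) ^ (-j + 1)) ↔ j = critScale ρ x := by
  have h1 := Int.zpow_lt_iff_lt_clog (b := 2) one_lt_two (x := -j) hx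
  have h2 := Int.le_zpow_iff_clog_le (b := 2) one_lt_two (x := -j + 1) hx
  push_cast at h1 h2
  rw [h1, h2, critScale]
  omega

/-- The local vertical maximal function `ψ₀⁺(f)`. -/
noncomputable def vertMax (ρ : Rn n → ℝ) (ψ₀ : TestFn n) (f : Distr n) (x : Rn n) : ℝ≥0∞ :=
  ⨆ (j : ℤ) (_ : critScale ρ x ≤ j), ENNReal.ofReal ‖conv ψ₀ j f x‖

/-- `m_{j,A,B,x}(y) = (1 + 2^j |y|)^A 2^{B|y|/ρ(x)}`. -/
noncomputable def peetreWeight (ρ : Rn n → ℝ) (j : ℤ) (A B : ℝ) (x y : Rn n) : ℝ :=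
  (1 + (2 : ℝ) ^ j * ‖y‖) ^ A * (2 : ℝ) ^ (B * ‖y‖ / ρ x)

/-- The local tangential Peetre-type maximal function `ψ^{**}_{0,A,B}(f)`. -/
noncomputable def peetreMax (ρ : Rn n → ℝ) (ψ₀ : TestFn n) (A B : ℝ) (f : Distr n)
    (x : Rn n) : ℝ≥0∞ :=
  ⨆ (j : ℤ) (_ : critScale ρ x ≤ j) (y : Rn n),
    ENNReal.ofReal (‖conv ψ₀ j f (x - y)‖ / peetreWeight ρ j A B x y)

/-- The class `𝒟_{N,R}(ℝⁿ)`: test functions `φ` with `supp φ ⊆ B(0, R)` and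
`|∂^α φ| ≤ 1` everywhere for every multi-index `|α| ≤ N`. A partial derivative of order `m` is
written as the `m`-th derivative evaluated at coordinate vectors `e_{I 1}, …, e_{I m}`. -/
def MemDNR (N : ℕ) (R : ℝ) (φ : TestFn n) : Prop :=
  tsupport φ ⊆ ball 0 R ∧
    ∀ m : ℕ, m ≤ N → ∀ (I : Fin m → Fin n) (x : Rn n),
      ‖iteratedFDeriv ℝ m φ x (fun k => EuclideanSpace.single (I k) (1 : ℝ))‖ ≤ 1

/-- The local nontangential grand maximal function `M̃_{N,R}(f)`. -/
noncomputable def grandMax (ρ : Rn n → ℝ) (N : ℕ) (R : ℝ) (f : Distr n) (x : Rn n) : ℝ≥0∞ :=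
  ⨆ (φ : TestFn n) (_ : MemDNR N R φ) (l : ℤ) (z : Rn n)
    (_ : ‖x - z‖ < (2 : ℝ) ^ (-l)) (_ : (2 : ℝ) ^ (-l) < ρ x),
    ENNReal.ofReal ‖conv φ l f z‖

end LocalHardy

/-! The proof rests on a reproducing formula that needs no vanishing moments. Let `U_k` be
convolution with the reflected dilate of `ψ₀` at scale `2^{-k}`, normalised to integral one; then `f
(U_k g)` is an integral of `g` against `(ψ₀)_k * f`. Each factor `1 - U_k` trades one derivative for
`2^{-k}`, so `R_k = (1 - U_k)^L` gains `2^{-kL}`, and `(1 - R_k)²` tends to the identity against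
every distribution. Consecutive squares differ by `((1 - R_l) + (1 - R_k)) (R_k - R_l)`: the first
factor is a sum of multiples of `U_l` and `U_k`, the second carries the gain. Hence a distribution
tested at scale `2^{-j}` is controlled by the sum over `i` of `2^{-iL}` times local integrals of
`|(ψ₀)_{j+h+i} * f|` (`exists_decomposition_bound`).

Testing with dilates of `ψ₀` itself gives the self-estimate `AvgBound`. Writing `F = F^{1-r} F^r`
and absorbing the first factor turns it into a sub-mean value inequality for `r`-th powers
(`exists_sub_mean_value`). Since the critical scale varies with the point, `ψ₀⁺(f)` near `x - y` may
miss the first `h` scales after `j`, where `2^h` is at most a power of `1 + |y|/ρ(x)`, up to a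
constant; `exists_sub_mean_value_shift` pays `2^{hn}` for this, and the exponential in the Peetre
weight absorbs the loss for any `B > 0`. So the `r`-th power of the Peetre function is dominated by
the centred maximal function of `ψ₀⁺(f)^r` once `A r ≥ n` (`exists_peetreMax_le`).

With `r = n/A` the condition `A > n q_ω/p` reads `p/r > q_ω`, so `ω` lies in some `A_q` class with
`q < p/r`. A Vitali covering gives weak type `(q,q)`, interpolation with the trivial bounded
endpoint gives strong type `p/r`, and the first inequality follows. For the second, the
decomposition with `L = N` bounds the grand maximal function by a Peetre function with exponent `A'
< N` (`exists_grandMax_le`); `A'` is chosen between `A₁` and `N`. -/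

namespace LocalHardy

variable {n : ℕ}

/-! ### Convolution: size, support, derivatives. -/

section Convolution

open ContinuousLinearMap
open scoped Convolution

/-- Convolution of a scalar function with a vector-valued function. -/
noncomputable def smear {E : Type*} [NormedAddCommGroup E] [NormedSpace ℝ E] [NormedSpace ℂ E]
    (u : Rn n → ℂ) (g : Rn n → E) : Rn n → E :=
  fun x => ∫ y, u y • g (x - y)

theorem integrable_smear {E : Type*} [NormedAddCommGroup E] [NormedSpace ℂ E]
    {u : Rn n → ℂ} {g : Rn n → E} (hu : Continuous u)
    (hu' : HasCompactSupport u) (hg : Continuous g) (x : Rn n) :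
    Integrable (fun y => u y • g (x - y)) :=
  (by fun_prop : Continuous fun y => u y • g (x - y)).integrable_of_hasCompactSupport
    (hu'.smul_right (f' := fun y => g (x - y)))

variable {E : Type*} [NormedAddCommGroup E] [NormedSpace ℝ E] [NormedSpace ℂ E]

theorem norm_smear_le {u : Rn n → ℂ} {g : Rn n → E} (hu : Integrable u) {a : ℝ}
    (hg : ∀ x, ‖g x‖ ≤ a) (x : Rn n) : ‖smear u g x‖ ≤ (∫ y, ‖u y‖) * a := by
  rw [← integral_mul_const]
  refine norm_integral_le_of_norm_le (hu.norm.mul_const a) (.of_forall fun y => ?_)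
  rw [norm_smul]
  gcongr
  exact hg _

/-- Unit mass writes the error as an average of `g x - g (x - y)` over `‖y‖ ≤ δ`, and the mean value
inequality bounds each difference. Only this first-order cancellation is used; higher orders come
from iteration. -/
theorem norm_sub_smear_le [CompleteSpace E] {u : Rn n → ℂ} {g : Rn n → E} (hu : Continuous u)
    (hu' : HasCompactSupport u) (hu1 : ∫ y, u y = 1) {δ : ℝ}
    (hδ : ∀ y, δ < ‖y‖ → u y = 0) (hg : Differentiable ℝ g) {a : ℝ}
    (ha : ∀ x, ‖fderiv ℝ g x‖ ≤ a) (x : Rn n) :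
    ‖g x - smear u g x‖ ≤ (∫ y, ‖u y‖) * (δ * a) := by
  have hui : Integrable u := hu.integrable_of_hasCompactSupport hu'
  have h0 : g x - smear u g x = ∫ y, u y • (g x - g (x - y)) := by
    simp_rw [smul_sub]
    rw [integral_sub (hui.smul_const _) (integrable_smear hu hu' hg.continuous x),
      integral_smul_const, hu1, one_smul]
    rfl
  rw [h0, ← integral_mul_const]
  refine norm_integral_le_of_norm_le (hui.norm.mul_const _) (.of_forall fun y => ?_)
  rw [norm_smul]
  by_cases hy : δ < ‖y‖
  · simp [hδ y hy]
  have h1 : ‖g x - g (x - y)‖ ≤ a * ‖x - (x - y)‖ :=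
    Convex.norm_image_sub_le_of_norm_fderiv_le (fun z _ => hg z) (fun z _ => ha z) convex_univ
      (Set.mem_univ _) (Set.mem_univ _)
  have ha0 : 0 ≤ a := (norm_nonneg _).trans (ha x)
  gcongr
  refine h1.trans ?_
  rw [sub_sub_cancel, mul_comm]
  gcongr
  exact not_lt.1 hy

theorem smear_eq_zero {u : Rn n → ℂ} {g : Rn n → E} {δ s : ℝ} {z : Rn n}
    (hδ : ∀ y, δ < ‖y‖ → u y = 0) (hg : ∀ y, s < dist y z → g y = 0) {x : Rn n}
    (hx : s + δ < dist x z) : smear u g x = 0 := by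
  refine integral_eq_zero_of_ae (.of_forall fun y => ?_)
  by_cases hy : δ < ‖y‖
  · simp [hδ y hy]
  · have h1 : dist x z ≤ dist x (x - y) + dist (x - y) z := dist_triangle _ _ _
    have h2 : dist x (x - y) = ‖y‖ := by simp
    have : g (x - y) = 0 := hg _ (by linarith)
    simp [this]

/-- Fubini. The resulting commutation of averaging operators is what makes a difference of squares
factor later on. -/
theorem smear_comm {u v : Rn n → ℂ} {g : Rn n → E} (hu : Continuous u)
    (hu' : HasCompactSupport u) (hv : Continuous v) (hv' : HasCompactSupport v)
    (hg : Continuous g) : smear u (smear v g) = smear v (smear u g) := by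
  funext x
  have h : ∀ a b : Rn n → ℂ, smear a (smear b g) x =
      ∫ y, ∫ t, a y • b t • g (x - y - t) := by
    intro a b
    simp only [smear, integral_smul]
  rw [h u v, h v u, integral_integral_swap_of_hasCompactSupport (f := fun y t => u y • v t • g (x - y - t))
    (by fun_prop)]
  · refine integral_congr_ae (.of_forall fun t => integral_congr_ae (.of_forall fun y => ?_))
    simp only
    rw [smul_comm, sub_right_comm]
  · refine HasCompactSupport.of_support_subset_isCompact
      (hu'.isCompact.prod hv'.isCompact) ?_
    rintro ⟨y, t⟩ hyt
    simp only [Function.mem_support, Function.uncurry_apply_pair, ne_eq, smul_eq_zero,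
      not_or] at hyt
    exact ⟨subset_tsupport _ hyt.1, subset_tsupport _ hyt.2.1⟩

variable [IsScalarTower ℝ ℂ E]

theorem hasFDerivAt_smear {u : Rn n → ℂ} {g : Rn n → E} (hu : Continuous u)
    (hg : ContDiff ℝ 1 g) (hg' : HasCompactSupport g)
    (x : Rn n) : HasFDerivAt (smear u g) (smear u (fderiv ℝ g) x) x :=
  hg'.hasFDerivAt_convolution_right (lsmul ℝ ℂ) hu.locallyIntegrable hg x

theorem contDiff_smear {u : Rn n → ℂ} {g : Rn n → E} (hu : Continuous u)
    (hg : ContDiff ℝ ((⊤ : ℕ∞) : WithTop ℕ∞) g) (hg' : HasCompactSupport g) :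
    ContDiff ℝ ((⊤ : ℕ∞) : WithTop ℕ∞) (smear u g) :=
  hg'.contDiff_convolution_right (lsmul ℝ ℂ) hu.locallyIntegrable hg

/-- All derivatives fall on `g`, by induction through the currying equivalence, which commutes with
the integral. The induction differentiates `iteratedFDeriv`, hence the vector-valued setting. -/
theorem iteratedFDeriv_smear {u : Rn n → ℂ} {g : Rn n → E} (hu : Continuous u)
    (hg : ContDiff ℝ ((⊤ : ℕ∞) : WithTop ℕ∞) g) (hg' : HasCompactSupport g) (i : ℕ) :
    iteratedFDeriv ℝ i (smear u g) = smear u (iteratedFDeriv ℝ i g) := by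
  induction i with
  | zero =>
    rw [iteratedFDeriv_zero_eq_comp, iteratedFDeriv_zero_eq_comp]
    funext x
    simp only [Function.comp_apply, smear]
    refine ((continuousMultilinearCurryFin0 ℝ (Rn n) E).symm.toContinuousLinearEquiv.integral_comp_comm
      _).symm.trans (integral_congr_ae (.of_forall fun y => ?_))
    ext m
    simp
  | succ i ih =>
    rw [iteratedFDeriv_succ_eq_comp_left, iteratedFDeriv_succ_eq_comp_left, ih]
    funext x
    have hc : ContDiff ℝ 1 (iteratedFDeriv ℝ i g) :=
      hg.iteratedFDeriv_right (m := 1) (by exact_mod_cast le_top)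
    simp only [Function.comp_apply]
    rw [(hasFDerivAt_smear hu hc (hg'.iteratedFDeriv i) x).fderiv]
    simp only [smear, Function.comp_apply]
    refine (ContinuousLinearEquiv.integral_comp_comm (𝕜 := ℝ) (X := Rn n) (μ := volume)
      (E := Rn n →L[ℝ] Rn n [×i]→L[ℝ] E) (F := Rn n [×(i + 1)]→L[ℝ] E)
      (continuousMultilinearCurryLeftEquiv ℝ (fun _ : Fin (i + 1) => Rn n)
      E).symm.toContinuousLinearEquiv _).symm.trans (integral_congr_ae (.of_forall fun y => ?_))
    rfl

end Convolution

end LocalHardy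

namespace LocalHardy

variable {n : ℕ}

/-! ### Averaging operators on test functions and their errors. -/

section Operators

/-- Convolution with a test function, as a linear endomorphism of `𝒟(ℝⁿ)`. -/
noncomputable def smearTest (u : TestFn n) : Module.End ℂ (TestFn n) where
  toFun g :=
    { toFun := smear u g
      contDiff' := contDiff_smear u.continuous g.contDiff g.hasCompactSupport
      hasCompactSupport' := u.hasCompactSupport.convolution
        (ContinuousLinearMap.lsmul ℝ ℂ) g.hasCompactSupport
      tsupport_subset' := by simp }
  map_add' g h := by
    ext x
    change smear u (⇑(g + h)) x = smear u g x + smear u h x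
    simp only [smear, FunLike.coe_add, Pi.add_apply, smul_add]
    exact integral_add (integrable_smear u.continuous u.hasCompactSupport g.continuous x)
      (integrable_smear u.continuous u.hasCompactSupport h.continuous x)
  map_smul' c g := by
    ext x
    change smear u (⇑(c • g)) x = c • smear u g x
    simp only [smear, FunLike.coe_smul, Pi.smul_apply]
    rw [← integral_smul]
    exact integral_congr_ae (.of_forall fun y => smul_comm _ _ _)

theorem smearTest_commute (u v : TestFn n) : Commute (smearTest u) (smearTest v) := by
  refine LinearMap.ext fun g => TestFunction.ext fun x => ?_
  exact congrFun (smear_comm u.continuous u.hasCompactSupport v.continuous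
    v.hasCompactSupport g.continuous) x

theorem dilateReflect_apply (ψ : TestFn n) (k : ℤ) (x y : Rn n) :
    dilateReflect ψ k x y = ((2 : ℝ) ^ (k * (n : ℤ))) • ψ ((2 : ℝ) ^ k • (x - y)) := rfl

theorem integral_comp_dilate {E : Type*} [NormedAddCommGroup E] [NormedSpace ℝ E]
    (g : Rn n → E) (k : ℤ) (x : Rn n) :
    ∫ y, ((2 : ℝ) ^ (k * (n : ℤ))) • g ((2 : ℝ) ^ k • (x - y)) = ∫ y, g y := by
  rw [integral_smul, integral_sub_left_eq_self (fun y => g ((2 : ℝ) ^ k • y)),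
    Measure.integral_comp_smul, smul_smul, finrank_euclideanSpace_fin, zpow_mul, zpow_natCast,
    abs_of_nonneg (by positivity), mul_inv_cancel₀ (by positivity), one_smul]

/-- The normalized, reflected dilate of `ψ` at scale `2^{-k}`; its integral is `1`. -/
noncomputable def approxId (ψ : TestFn n) (k : ℤ) : TestFn n :=
  (∫ x, ψ x)⁻¹ • dilateReflect ψ k 0

theorem approxId_apply (ψ : TestFn n) (k : ℤ) (y : Rn n) :
    approxId ψ k y = (∫ x, ψ x)⁻¹ • ((2 : ℝ) ^ (k * (n : ℤ))) • ψ ((2 : ℝ) ^ k • (0 - y)) := rfl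

theorem integral_approxId {ψ : TestFn n} (hψ : (∫ x, ψ x) ≠ 0) (k : ℤ) :
    ∫ y, approxId ψ k y = 1 := by
  simp only [approxId_apply]
  rw [integral_smul, integral_comp_dilate (fun y => ψ y) k 0, smul_eq_mul, inv_mul_cancel₀ hψ]

theorem integral_norm_approxId (ψ : TestFn n) (k : ℤ) :
    ∫ y, ‖approxId ψ k y‖ = ‖∫ x, ψ x‖⁻¹ * ∫ x, ‖ψ x‖ := by
  simp only [approxId_apply, norm_smul, norm_inv]
  rw [integral_const_mul, ← integral_comp_dilate (fun y => ‖ψ y‖) k 0]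
  simp only [smul_eq_mul, Real.norm_eq_abs]
  congr 2
  funext y
  rw [abs_of_nonneg (by positivity)]

theorem approxId_eq_zero {ψ : TestFn n} {δ : ℝ} (hδ : ∀ y, δ < ‖y‖ → ψ y = 0) (k : ℤ)
    (y : Rn n) (hy : δ * (2 : ℝ) ^ (-k) < ‖y‖) : approxId ψ k y = 0 := by
  rw [approxId_apply, hδ, smul_zero, smul_zero]
  rw [norm_smul, zero_sub, norm_neg, norm_zpow, Real.norm_ofNat]
  rw [zpow_neg, ← div_eq_mul_inv, div_lt_iff₀ (by positivity)] at hy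
  linarith

/-- The `L¹` norm of the normalized kernels. -/
noncomputable def kernelNorm (ψ : TestFn n) : ℝ := ‖∫ x, ψ x‖⁻¹ * ∫ x, ‖ψ x‖

theorem kernelNorm_nonneg (ψ : TestFn n) : 0 ≤ kernelNorm ψ :=
  mul_nonneg (by positivity) (integral_nonneg fun _ => norm_nonneg _)

/-- Averaging at scale `2^{-k}`. -/
noncomputable def opU (ψ : TestFn n) (k : ℤ) : Module.End ℂ (TestFn n) :=
  smearTest (approxId ψ k)

/-- The error of averaging at scale `2^{-k}`. -/
noncomputable def opT (ψ : TestFn n) (k : ℤ) : Module.End ℂ (TestFn n) := 1 - opU ψ k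

theorem opT_apply (ψ g : TestFn n) (k : ℤ) : opT ψ k g = g - opU ψ k g := rfl

theorem opU_commute (ψ : TestFn n) (k l : ℤ) : Commute (opU ψ k) (opU ψ l) :=
  smearTest_commute _ _

theorem opT_commute (ψ : TestFn n) (k l : ℤ) : Commute (opT ψ k) (opT ψ l) :=
  ((Commute.one_left _).sub_left ((Commute.one_right _).sub_right (opU_commute ψ k l)))

theorem TestFn.integrable (u : TestFn n) : Integrable u :=
  u.continuous.integrable_of_hasCompactSupport u.hasCompactSupport

theorem iteratedFDeriv_smearTest (u g : TestFn n) (i : ℕ) :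
    iteratedFDeriv ℝ i (smearTest u g) = smear u (iteratedFDeriv ℝ i g) :=
  iteratedFDeriv_smear u.continuous g.contDiff g.hasCompactSupport i

theorem TestFn.contDiff_nat (g : TestFn n) (i : ℕ) : ContDiff ℝ i g :=
  g.contDiff.of_le (by exact_mod_cast le_top)

theorem TestFn.differentiable_iteratedFDeriv (g : TestFn n) (i : ℕ) :
    Differentiable ℝ (iteratedFDeriv ℝ i g) :=
  (g.contDiff_nat (i + 1)).differentiable_iteratedFDeriv (by exact_mod_cast Nat.lt_succ_self i)

theorem opU_bound (ψ g : TestFn n) (k : ℤ) {i : ℕ} {a : ℝ}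
    (h : ∀ x, ‖iteratedFDeriv ℝ i g x‖ ≤ a) (x : Rn n) :
    ‖iteratedFDeriv ℝ i (opU ψ k g) x‖ ≤ kernelNorm ψ * a := by
  rw [opU, iteratedFDeriv_smearTest, kernelNorm, ← integral_norm_approxId ψ k]
  exact norm_smear_le (TestFn.integrable _) h x

theorem iteratedFDeriv_opT (ψ g : TestFn n) (k : ℤ) (i : ℕ) (x : Rn n) :
    iteratedFDeriv ℝ i (opT ψ k g) x =
      iteratedFDeriv ℝ i g x - iteratedFDeriv ℝ i (opU ψ k g) x := by
  rw [opT_apply, FunLike.coe_sub, iteratedFDeriv_sub_apply (g.contDiff_nat i).contDiffAt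
    ((opU ψ k g).contDiff_nat i).contDiffAt]

theorem opT_bound (ψ g : TestFn n) (k : ℤ) {i : ℕ} {a : ℝ}
    (h : ∀ x, ‖iteratedFDeriv ℝ i g x‖ ≤ a) (x : Rn n) :
    ‖iteratedFDeriv ℝ i (opT ψ k g) x‖ ≤ (1 + kernelNorm ψ) * a := by
  rw [iteratedFDeriv_opT, one_add_mul]
  exact (norm_sub_le _ _).trans (add_le_add (h x) (opU_bound ψ g k h x))

/-- One derivative buys a factor `2^{-k}`: the kernel has unit mass and is supported within radius
`δ * 2^{-k}`. -/
theorem opT_gain {ψ : TestFn n} (hψ : (∫ x, ψ x) ≠ 0) {δ : ℝ}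
    (hδ : ∀ y, δ < ‖y‖ → ψ y = 0) (g : TestFn n) (k : ℤ) {i : ℕ} {a : ℝ}
    (h : ∀ x, ‖iteratedFDeriv ℝ (i + 1) g x‖ ≤ a) (x : Rn n) :
    ‖iteratedFDeriv ℝ i (opT ψ k g) x‖ ≤ kernelNorm ψ * δ * (2 : ℝ) ^ (-k) * a := by
  rw [iteratedFDeriv_opT, opU, iteratedFDeriv_smearTest]
  refine (norm_sub_smear_le (approxId ψ k).continuous (approxId ψ k).hasCompactSupport
    (integral_approxId hψ k) (approxId_eq_zero hδ k) (g.differentiable_iteratedFDeriv i)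
    (a := a) (fun y => ?_) x).trans (le_of_eq ?_)
  · rw [norm_fderiv_iteratedFDeriv]
    exact h y
  · rw [integral_norm_approxId, kernelNorm]
    ring

theorem opU_eq_zero {ψ : TestFn n} {δ : ℝ} (hδ : ∀ y, δ < ‖y‖ → ψ y = 0) (k : ℤ)
    {g : TestFn n} {z : Rn n} {s : ℝ} (hg : ∀ y, s < dist y z → g y = 0) (x : Rn n)
    (hx : s + δ * (2 : ℝ) ^ (-k) < dist x z) : opU ψ k g x = 0 :=
  smear_eq_zero (approxId_eq_zero hδ k) hg hx

theorem opT_eq_zero {ψ : TestFn n} {δ : ℝ} (hδ0 : 0 ≤ δ) (hδ : ∀ y, δ < ‖y‖ → ψ y = 0) (k : ℤ)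
    {g : TestFn n} {z : Rn n} {s : ℝ} (hg : ∀ y, s < dist y z → g y = 0) (x : Rn n)
    (hx : s + δ * (2 : ℝ) ^ (-k) < dist x z) : opT ψ k g x = 0 := by
  have h0 : 0 ≤ δ * (2 : ℝ) ^ (-k) := by positivity
  rw [opT_apply, FunLike.coe_sub, Pi.sub_apply, opU_eq_zero hδ k hg x hx, hg x (by linarith),
    sub_zero]

theorem TestFn.exists_radius (ψ : TestFn n) : ∃ δ : ℝ, 0 < δ ∧ ∀ y, δ < ‖y‖ → ψ y = 0 := by
  obtain ⟨δ, hδ0, hδ⟩ := ψ.hasCompactSupport.isCompact.isBounded.subset_closedBall_lt 0 0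
  refine ⟨δ, hδ0, fun y hy => image_eq_zero_of_notMem_tsupport fun h => ?_⟩
  have := hδ h
  rw [mem_closedBall_zero_iff] at this
  exact absurd this (not_le.2 hy)

end Operators

end LocalHardy

namespace LocalHardy

variable {n : ℕ}

/-! ### Distributions as functionals of finite jets; pairing with convolutions. -/

section Distributions

open scoped BoundedContinuousFunction

theorem TestFn.continuous_iteratedFDeriv (g : TestFn n) (i : ℕ) :
    Continuous (iteratedFDeriv ℝ i g) :=
  (g.contDiff_nat i).continuous_iteratedFDeriv le_rfl

theorem TestFn.exists_bound (g : TestFn n) (i : ℕ) :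
    ∃ C : ℝ, 0 < C ∧ ∀ x, ‖iteratedFDeriv ℝ i g x‖ ≤ C := by
  obtain ⟨C, hC⟩ := (g.continuous_iteratedFDeriv i).bounded_above_of_compact_support
    (g.hasCompactSupport.iteratedFDeriv (𝕜 := ℝ) i)
  exact ⟨max C 1, by positivity, fun x => (hC x).trans (le_max_left _ _)⟩

/-- Bounded continuous functions with values in the `i`-multilinear forms, for `i ≤ m`. -/
abbrev JetSpace (n m : ℕ) : Type := (i : Fin (m + 1)) → (Rn n →ᵇ (Rn n [×(i : ℕ)]→L[ℝ] ℂ))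

noncomputable instance (n m : ℕ) : NormedAddCommGroup (JetSpace n m) := Pi.normedAddCommGroup

noncomputable instance (n m : ℕ) : NormedSpace ℂ (JetSpace n m) := Pi.normedSpace

/-- The derivatives of order at most `m` of a test function. -/
noncomputable def jet (m : ℕ) (g : TestFn n) : JetSpace n m := fun i =>
  BoundedContinuousFunction.ofNormedAddCommGroup (iteratedFDeriv ℝ i g)
    (g.continuous_iteratedFDeriv i) _ (g.exists_bound i).choose_spec.2

theorem jet_apply (m : ℕ) (g : TestFn n) (i : Fin (m + 1)) (x : Rn n) :
    jet m g i x = iteratedFDeriv ℝ i g x := rfl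

theorem norm_jet_le (m : ℕ) (g : TestFn n) {a : ℝ} (ha : 0 ≤ a)
    (h : ∀ i ≤ m, ∀ x, ‖iteratedFDeriv ℝ i g x‖ ≤ a) : ‖jet m g‖ ≤ a :=
  (pi_norm_le_iff_of_nonneg ha).2 fun i =>
    (BoundedContinuousFunction.norm_le ha).2 fun x => h i (Nat.lt_succ_iff.1 i.2) x

/-- On test functions supported in a fixed ball, a distribution is a continuous functional of
finitely many derivatives. -/
theorem exists_jet_functional (f : Distr n) (s : ℝ) :
    ∃ (m : ℕ) (Λ : JetSpace n m →L[ℂ] ℂ), ∀ g : TestFn n, (∀ y, s < ‖y‖ → g y = 0) →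
      f g = Λ (jet m g) := by
  let K : Compacts (Rn n) := ⟨closedBall 0 s, isCompact_closedBall 0 s⟩
  have hK : (K : Set (Rn n)) ⊆ (⊤ : Opens (Rn n)) := fun _ _ => trivial
  let fK : 𝓓_{K}(Rn n, ℂ) →L[ℂ] ℂ := f ∘L TestFunction.ofSupportedInCLM ℂ hK
  obtain ⟨t, C, -, hC⟩ := Seminorm.bound_of_continuous
    (ContDiffMapSupportedIn.withSeminorms ℂ (Rn n) ℂ ⊤ K)
    ((normSeminorm ℂ ℂ).comp fK.toLinearMap) (by exact fK.continuous.norm)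
  let m := t.sup id
  let J : 𝓓_{K}(Rn n, ℂ) →ₗ[ℂ] JetSpace n m :=
    LinearMap.pi fun i => ContDiffMapSupportedIn.structureMapLM ℂ ⊤ (i : ℕ)
  have hJ : ∀ φ i x, J φ i x = iteratedFDeriv ℝ (i : ℕ) φ x := fun φ i x => by
    change ContDiffMapSupportedIn.structureMapLM ℂ ⊤ (i : ℕ) φ x = _
    rw [ContDiffMapSupportedIn.structureMapLM_top_apply]
  have hJinj : Function.Injective J := by
    intro φ χ h
    ext x
    have h0 : J φ 0 x = J χ 0 x := by rw [h]
    rw [hJ, hJ] at h0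
    have h1 : iteratedFDeriv ℝ 0 φ x = iteratedFDeriv ℝ 0 χ x := h0
    have h2 := congrArg (fun L => L 0) h1
    rwa [iteratedFDeriv_zero_apply, iteratedFDeriv_zero_apply] at h2
  have hfK : ∀ φ, ‖fK φ‖ ≤ C * ‖J φ‖ := by
    intro φ
    have h1 : ‖fK φ‖ ≤ C * (t.sup (ContDiffMapSupportedIn.seminorm ℂ (Rn n) ℂ ⊤ K)) φ := hC φ
    refine h1.trans ?_
    gcongr
    refine Seminorm.finset_sup_apply_le (norm_nonneg _) fun i hi => ?_
    exact norm_le_pi_norm (J φ) ⟨i, Nat.lt_succ_of_le (Finset.le_sup (f := id) hi)⟩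
  -- By `hfK`, `fK` descends to a bounded functional on the range of `J`; Hahn–Banach extends it to
  -- the whole jet space.
  let e := LinearEquiv.ofInjective J hJinj
  let Λ₀ : StrongDual ℂ (LinearMap.range J) :=
    (fK.toLinearMap ∘ₗ e.symm.toLinearMap).mkContinuous C fun v => by
      have h2 := hfK (e.symm v)
      have h3 : J (e.symm v) = v := by
        have := e.apply_symm_apply v
        exact congrArg Subtype.val this
      rw [h3] at h2
      exact h2
  obtain ⟨Λ, hΛ, -⟩ := exists_extension_norm_eq (LinearMap.range J) Λ₀
  refine ⟨m, Λ, fun g hg => ?_⟩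
  let φ : 𝓓_{K}(Rn n, ℂ) := ContDiffMapSupportedIn.of_support_subset g.contDiff (by
    intro y hy
    change y ∈ closedBall 0 s
    rw [mem_closedBall_zero_iff]
    exact not_lt.1 fun h => hy (hg y h))
  have h4 : fK φ = f g := congrArg f (TestFunction.ext fun _ => rfl)
  have h5 : J φ = jet m g := by
    funext i
    ext1 x
    rw [hJ, jet_apply]
    rfl
  rw [← h4, ← h5]
  have h6 := hΛ (e φ)
  have h7 : Λ₀ (e φ) = fK φ := by
    change fK (e.symm (e φ)) = _
    rw [e.symm_apply_apply]
  exact (h6.trans h7).symm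

/-- A distribution has finite order on test functions supported in a fixed ball. -/
theorem exists_order (f : Distr n) (s : ℝ) :
    ∃ (m : ℕ) (C : ℝ), 0 ≤ C ∧ ∀ g : TestFn n, (∀ y, s < ‖y‖ → g y = 0) →
      ∀ a : ℝ, (∀ i ≤ m, ∀ x, ‖iteratedFDeriv ℝ i g x‖ ≤ a) → ‖f g‖ ≤ C * a := by
  obtain ⟨m, Λ, h⟩ := exists_jet_functional f s
  refine ⟨m, ‖Λ‖, norm_nonneg _, fun g hg a ha => ?_⟩
  rw [h g hg]
  have ha0 : 0 ≤ a := (norm_nonneg _).trans (ha 0 (Nat.zero_le _) 0)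
  exact (Λ.le_opNorm _).trans (by gcongr; exact norm_jet_le m g ha0 ha)

/-- The translate `y ↦ u (y - w)`. -/
noncomputable def translate (u : TestFn n) (w : Rn n) : TestFn n where
  toFun y := u (y - w)
  contDiff' := u.contDiff.comp (contDiff_id.sub contDiff_const)
  hasCompactSupport' := u.hasCompactSupport.comp_homeomorph (Homeomorph.subRight w)
  tsupport_subset' := by simp

theorem translate_apply (u : TestFn n) (w y : Rn n) : translate u w y = u (y - w) := rfl

theorem iteratedFDeriv_translate (u : TestFn n) (w x : Rn n) (i : ℕ) :
    iteratedFDeriv ℝ i (translate u w) x = iteratedFDeriv ℝ i u (x - w) :=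
  iteratedFDeriv_comp_sub i w x

theorem continuous_jet_translate (m : ℕ) (u : TestFn n) :
    Continuous fun w => jet m (translate u w) := by
  refine continuous_pi fun i => ?_
  have huc := (u.hasCompactSupport.iteratedFDeriv (𝕜 := ℝ) i).uniformContinuous_of_continuous
    (u.continuous_iteratedFDeriv i)
  rw [Metric.continuous_iff]
  intro w ε hε
  obtain ⟨η, hη, h⟩ := Metric.uniformContinuous_iff.1 huc (ε / 2) (half_pos hε)
  refine ⟨η, hη, fun v hv => lt_of_le_of_lt ?_ (half_lt_self hε)⟩
  refine (BoundedContinuousFunction.dist_le (half_pos hε).le).2 fun x => ?_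
  simp only [jet_apply, iteratedFDeriv_translate]
  refine (h ?_).le
  rwa [dist_sub_left]

/-- Near a given point all translates are supported in one ball, so a single jet functional
represents `f` on them. -/
theorem continuous_apply_translate (f : Distr n) (u : TestFn n) :
    Continuous fun w => f (translate u w) := by
  obtain ⟨δ, hδ0, hδ⟩ := u.exists_radius
  rw [continuous_iff_continuousAt]
  intro w₀
  obtain ⟨m, Λ, h⟩ := exists_jet_functional f (‖w₀‖ + 1 + δ)
  have hc : Continuous fun w => Λ (jet m (translate u w)) :=
    Λ.continuous.comp (continuous_jet_translate m u)
  refine hc.continuousAt.congr ?_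
  filter_upwards [ball_mem_nhds w₀ one_pos] with w hw
  refine (h (translate u w) fun y hy => hδ (y - w) ?_).symm
  have h1 : ‖w‖ ≤ ‖w₀‖ + 1 := by
    have := norm_le_norm_add_norm_sub' w w₀
    rw [mem_ball, dist_eq_norm] at hw
    linarith
  have := norm_sub_norm_le y w
  linarith

theorem smearTest_comm (u g : TestFn n) : smearTest u g = smearTest g u := by
  ext x
  change ∫ y, u y • g (x - y) = ∫ y, g y • u (x - y)
  rw [← integral_sub_left_eq_self (fun y => u y • g (x - y)) volume x]
  refine integral_congr_ae (.of_forall fun y => ?_)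
  simp [mul_comm]

/-- A convolution is a Bochner integral of translates in the Banach space of jets, and a continuous
functional may pass under such an integral. Evaluation of each component at each point verifies it.
-/
theorem jet_smearTest (m : ℕ) (u g : TestFn n) :
    jet m (smearTest u g) = ∫ w, g w • jet m (translate u w) := by
  have hint : Integrable fun w => g w • jet m (translate u w) :=
    (g.continuous.smul (continuous_jet_translate m u)).integrable_of_hasCompactSupport
      g.hasCompactSupport.smul_right
  funext i
  ext1 x
  let ev : JetSpace n m →L[ℂ] (Rn n [×(i : ℕ)]→L[ℝ] ℂ) :=
    (BoundedContinuousFunction.evalCLM ℂ x).comp (ContinuousLinearMap.proj i)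
  have h1 := ev.integral_comp_comm hint
  have h2 : (∫ w, g w • jet m (translate u w)) i x = ev (∫ w, g w • jet m (translate u w)) := rfl
  rw [h2, ← h1, jet_apply, smearTest_comm, iteratedFDeriv_smearTest]
  refine integral_congr_ae (.of_forall fun w => ?_)
  change g w • iteratedFDeriv ℝ i u (x - w) = ev (g w • jet m (translate u w))
  rw [map_smul, ← iteratedFDeriv_translate]
  rfl

/-- A distribution may be applied under the integral sign defining a convolution. -/
theorem apply_smearTest (f : Distr n) (u g : TestFn n) :
    f (smearTest u g) = ∫ w, g w * f (translate u w) := by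
  obtain ⟨δ, hδ0, hδ⟩ := u.exists_radius
  obtain ⟨s, hs0, hs⟩ := g.exists_radius
  obtain ⟨m, Λ, h⟩ := exists_jet_functional f (s + δ)
  have hint : Integrable fun w => g w • jet m (translate u w) :=
    (g.continuous.smul (continuous_jet_translate m u)).integrable_of_hasCompactSupport
      g.hasCompactSupport.smul_right
  rw [h _ fun y hy => smear_eq_zero (z := 0) (s := s) hδ (by simpa using hs) (by simpa using hy),
    jet_smearTest, ← Λ.integral_comp_comm hint]
  refine integral_congr_ae (.of_forall fun w => ?_)
  simp only [map_smul, smul_eq_mul]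
  by_cases hw : s < ‖w‖
  · simp [hs w hw]
  · rw [h (translate u w) fun y hy => hδ (y - w) ?_]
    have := norm_sub_norm_le y w
    linarith

theorem dilateReflect_eq_translate (ψ : TestFn n) (k : ℤ) (w : Rn n) :
    dilateReflect ψ k w = translate (dilateReflect ψ k 0) w := by
  ext y
  simp only [translate_apply, dilateReflect_apply, zero_sub, neg_sub]

theorem continuous_conv (ψ : TestFn n) (k : ℤ) (f : Distr n) : Continuous (conv ψ k f) := by
  have : conv ψ k f = fun w => f (translate (dilateReflect ψ k 0) w) := by
    funext w
    rw [conv, dilateReflect_eq_translate]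
  rw [this]
  exact continuous_apply_translate _ _

theorem apply_translate_approxId (ψ : TestFn n) (k : ℤ) (f : Distr n) (w : Rn n) :
    f (translate (approxId ψ k) w) = (∫ x, ψ x)⁻¹ * conv ψ k f w := by
  have : translate (approxId ψ k) w = (∫ x, ψ x)⁻¹ • dilateReflect ψ k w := by
    rw [dilateReflect_eq_translate]
    rfl
  rw [this, map_smul, conv, smul_eq_mul]

theorem apply_opU (ψ : TestFn n) (k : ℤ) (f : Distr n) (g : TestFn n) :
    f (opU ψ k g) = ∫ w, g w * ((∫ x, ψ x)⁻¹ * conv ψ k f w) := by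
  rw [opU, apply_smearTest]
  simp only [apply_translate_approxId]

/-- The bridge from operators to maximal functions: a factor `U_k` replaces `f` by the values of
`ψ_k * f` on a ball carrying `g`. -/
theorem enorm_apply_opU_le (ψ : TestFn n) (k : ℤ) (f : Distr n) (g : TestFn n) {b s : ℝ}
    {z : Rn n} (hb : ∀ x, ‖g x‖ ≤ b) (hg : ∀ y, s < dist y z → g y = 0) :
    ‖f (opU ψ k g)‖ₑ ≤ ENNReal.ofReal (b * ‖∫ x, ψ x‖⁻¹) *
      ∫⁻ w in closedBall z s, ‖conv ψ k f w‖ₑ := by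
  have hb0 : 0 ≤ b := (norm_nonneg _).trans (hb 0)
  rw [apply_opU]
  refine (enorm_integral_le_lintegral_enorm _).trans ?_
  rw [← lintegral_const_mul' _ _ ENNReal.ofReal_ne_top,
    ← lintegral_indicator measurableSet_closedBall]
  refine lintegral_mono fun w => ?_
  by_cases hw : w ∈ closedBall z s
  · rw [Set.indicator_of_mem hw, enorm_mul, enorm_mul, ← mul_assoc, ENNReal.ofReal_mul hb0,
      ← ofReal_norm (g w), ← ofReal_norm (∫ x, ψ x)⁻¹, norm_inv]
    gcongr
    exact hb w
  · rw [hg w (not_le.1 hw)]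
    simp

end Distributions

end LocalHardy

namespace LocalHardy

variable {n : ℕ}

/-! ### The reproducing formula and the resulting decomposition. -/

section Decomposition

/-- `P` maps functions with `|D^j g| ≤ a` to functions with `|D^i (P g)| ≤ b a`. -/
def OpBound (P : Module.End ℂ (TestFn n)) (i j : ℕ) (b : ℝ) : Prop :=
  ∀ (g : TestFn n) (a : ℝ), (∀ x, ‖iteratedFDeriv ℝ j g x‖ ≤ a) →
    ∀ x, ‖iteratedFDeriv ℝ i (P g) x‖ ≤ b * a

/-- `P` enlarges supports by at most `t`. -/
def OpSpread (P : Module.End ℂ (TestFn n)) (t : ℝ) : Prop :=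
  ∀ (g : TestFn n) (z : Rn n) (s : ℝ), (∀ y, s < dist y z → g y = 0) →
    ∀ y, s + t < dist y z → P g y = 0

namespace OpBound

variable {P P' : Module.End ℂ (TestFn n)} {i j l : ℕ} {b b' : ℝ}

theorem mul (h : OpBound P i j b) (h' : OpBound P' j l b') : OpBound (P * P') i l (b * b') := by
  intro g a ha x
  rw [mul_assoc]
  exact h _ _ (h' g a ha) x

theorem one (i : ℕ) : OpBound (1 : Module.End ℂ (TestFn n)) i i 1 := by
  intro g a ha x
  rw [one_mul]
  exact ha x

theorem add (h : OpBound P i j b) (h' : OpBound P' i j b') : OpBound (P + P') i j (b + b') := by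
  intro g a ha x
  rw [LinearMap.add_apply, FunLike.coe_add, iteratedFDeriv_add_apply
    ((P g).contDiff_nat i).contDiffAt ((P' g).contDiff_nat i).contDiffAt, add_mul]
  exact (norm_add_le _ _).trans (add_le_add (h g a ha x) (h' g a ha x))

theorem sub (h : OpBound P i j b) (h' : OpBound P' i j b') : OpBound (P - P') i j (b + b') := by
  intro g a ha x
  rw [LinearMap.sub_apply, FunLike.coe_sub, iteratedFDeriv_sub_apply
    ((P g).contDiff_nat i).contDiffAt ((P' g).contDiff_nat i).contDiffAt, add_mul]
  exact (norm_sub_le _ _).trans (add_le_add (h g a ha x) (h' g a ha x))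

theorem zero (i j : ℕ) : OpBound (0 : Module.End ℂ (TestFn n)) i j 0 := by
  intro g a ha x
  have : ⇑((0 : Module.End ℂ (TestFn n)) g) = fun _ => (0 : ℂ) := rfl
  rw [this, iteratedFDeriv_fun_zero]
  simp

theorem pow (h : OpBound P i i b) (m : ℕ) : OpBound (P ^ m) i i (b ^ m) := by
  induction m with
  | zero => exact one i
  | succ m ih => rw [pow_succ, pow_succ]; exact ih.mul h

theorem pow_gain (h : ∀ i, OpBound P i (i + 1) b) (i m : ℕ) : OpBound (P ^ m) i (i + m) (b ^ m) := by
  induction m with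
  | zero => exact one i
  | succ m ih => rw [pow_succ, pow_succ]; exact ih.mul (h _)

theorem sum_range {p : ℕ → Module.End ℂ (TestFn n)} {c : ℕ → ℝ} (h : ∀ m, OpBound (p m) i j (c m))
    (N : ℕ) : OpBound (∑ m ∈ Finset.range N, p m) i j (∑ m ∈ Finset.range N, c m) := by
  induction N with
  | zero => exact zero i j
  | succ N ih => rw [Finset.sum_range_succ, Finset.sum_range_succ]; exact ih.add (h N)

end OpBound

namespace OpSpread

variable {P P' : Module.End ℂ (TestFn n)} {t t' : ℝ}

theorem mul (h : OpSpread P t) (h' : OpSpread P' t') : OpSpread (P * P') (t + t') := by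
  intro g z s hg y hy
  exact h _ z (s + t') (h' g z s hg) y (by linarith)

theorem mono (h : OpSpread P t) (ht : t ≤ t') : OpSpread P t' :=
  fun g z s hg y hy => h g z s hg y (by linarith)

theorem one : OpSpread (1 : Module.End ℂ (TestFn n)) 0 :=
  fun _ _ _ hg y hy => hg y (by simpa using hy)

theorem add (h : OpSpread P t) (h' : OpSpread P' t) : OpSpread (P + P') t := by
  intro g z s hg y hy
  rw [LinearMap.add_apply, FunLike.coe_add, Pi.add_apply, h g z s hg y hy, h' g z s hg y hy,
    add_zero]

theorem sub (h : OpSpread P t) (h' : OpSpread P' t) : OpSpread (P - P') t := by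
  intro g z s hg y hy
  rw [LinearMap.sub_apply, FunLike.coe_sub, Pi.sub_apply, h g z s hg y hy, h' g z s hg y hy,
    sub_zero]

theorem pow (h : OpSpread P t) (m : ℕ) : OpSpread (P ^ m) (m * t) := by
  induction m with
  | zero => simpa using one
  | succ m ih =>
    rw [pow_succ]
    exact (ih.mul h).mono (by push_cast; linarith)

theorem sum_range {p : ℕ → Module.End ℂ (TestFn n)} {N : ℕ} (h : ∀ m < N, OpSpread (p m) t) :
    OpSpread (∑ m ∈ Finset.range N, p m) t := by
  induction N with
  | zero => intro g z s hg y hy; rfl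
  | succ N ih =>
    rw [Finset.sum_range_succ]
    exact (ih fun m hm => h m (hm.trans (Nat.lt_succ_self N))).add (h N (Nat.lt_succ_self N))

end OpSpread

/-- The remainder `(1 - U_k)^L`. -/
noncomputable def opR (ψ : TestFn n) (L : ℕ) (k : ℤ) : Module.End ℂ (TestFn n) := opT ψ k ^ L

/-- The sum `∑_{i < L} (1 - U_k)^i`, so that `1 - (1 - U_k)^L = U_k Q_k`. -/
noncomputable def opQ (ψ : TestFn n) (L : ℕ) (k : ℤ) : Module.End ℂ (TestFn n) :=
  ∑ i ∈ Finset.range L, opT ψ k ^ i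

theorem one_sub_opR (ψ : TestFn n) (L : ℕ) (k : ℤ) : 1 - opR ψ L k = opU ψ k * opQ ψ L k := by
  rw [opR, opQ, ← mul_neg_geom_sum, opT, sub_sub_cancel]

theorem opR_commute (ψ : TestFn n) (L : ℕ) (k l : ℤ) : Commute (opR ψ L k) (opR ψ L l) :=
  (opT_commute ψ k l).pow_pow L L

/-- The factorisation `((1 - R_l) + (1 - R_k)) (R_k - R_l)`, valid because the operators commute.
With first powers, splitting the small difference `R_k - R_l` into `U_l Q_l - U_k Q_k` would lose
the smallness; squares leave an averaging factor and a small factor in every term. -/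
theorem sq_sub_sq_opR (ψ : TestFn n) (L : ℕ) (k l : ℤ) :
    (1 - opR ψ L l) ^ 2 - (1 - opR ψ L k) ^ 2 =
      opU ψ l * (opQ ψ L l * (opR ψ L k - opR ψ L l)) +
      opU ψ k * (opQ ψ L k * (opR ψ L k - opR ψ L l)) := by
  rw [← mul_assoc, ← mul_assoc, ← one_sub_opR, ← one_sub_opR, ← add_mul]
  have h := (opR_commute ψ L k l).eq
  generalize opR ψ L k = x at *
  generalize opR ψ L l = y at *
  have h' : x * y - y * x = 0 := sub_eq_zero.2 h
  have : (1 - y) ^ 2 - (1 - x) ^ 2 - (1 - y + (1 - x)) * (x - y) = -(x * y - y * x) := by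
    noncomm_ring
  rw [h', neg_zero] at this
  exact sub_eq_zero.1 this

theorem sq_one_sub_opR_telescope (ψ : TestFn n) (L : ℕ) (K : ℤ) (m : ℕ) :
    (1 - opR ψ L (K + m)) ^ 2 = opU ψ K * (opQ ψ L K * (1 - opR ψ L K)) +
      ∑ i ∈ Finset.range m,
        (opU ψ (K + (i + 1 : ℕ)) * (opQ ψ L (K + (i + 1 : ℕ)) *
            (opR ψ L (K + i) - opR ψ L (K + (i + 1 : ℕ)))) +
          opU ψ (K + i) * (opQ ψ L (K + i) *
            (opR ψ L (K + i) - opR ψ L (K + (i + 1 : ℕ))))) := by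
  induction m with
  | zero => simp [sq, ← mul_assoc, one_sub_opR]
  | succ m ih =>
    rw [Finset.sum_range_succ, ← add_assoc, ← ih, ← sq_sub_sq_opR]
    abel

variable {ψ : TestFn n} {δ : ℝ}

theorem opT_opBound (ψ : TestFn n) (k : ℤ) (i : ℕ) :
    OpBound (opT ψ k) i i (1 + kernelNorm ψ) := fun g _ ha x => opT_bound ψ g k ha x

theorem opR_opBound (ψ : TestFn n) (L : ℕ) (k : ℤ) (i : ℕ) :
    OpBound (opR ψ L k) i i ((1 + kernelNorm ψ) ^ L) := (opT_opBound ψ k i).pow L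

theorem opR_gain (hψ : (∫ x, ψ x) ≠ 0) (hδ : ∀ y, δ < ‖y‖ → ψ y = 0) (L : ℕ) (k : ℤ) (i : ℕ) :
    OpBound (opR ψ L k) i (i + L) ((kernelNorm ψ * δ * (2 : ℝ) ^ (-k)) ^ L) :=
  OpBound.pow_gain (fun _ g _ ha x => opT_gain hψ hδ g k ha x) i L

theorem opQ_opBound (ψ : TestFn n) (L : ℕ) (k : ℤ) (i : ℕ) :
    OpBound (opQ ψ L k) i i (∑ m ∈ Finset.range L, (1 + kernelNorm ψ) ^ m) :=
  OpBound.sum_range (fun m => (opT_opBound ψ k i).pow m) L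

theorem opT_spread (hδ0 : 0 ≤ δ) (hδ : ∀ y, δ < ‖y‖ → ψ y = 0) (k : ℤ) :
    OpSpread (opT ψ k) (δ * (2 : ℝ) ^ (-k)) := fun _ _ _ hg y hy => opT_eq_zero hδ0 hδ k hg y hy

theorem opR_spread (hδ0 : 0 ≤ δ) (hδ : ∀ y, δ < ‖y‖ → ψ y = 0) (L : ℕ) {k l : ℤ} (hkl : l ≤ k) :
    OpSpread (opR ψ L k) (L * (δ * (2 : ℝ) ^ (-l))) :=
  ((opT_spread hδ0 hδ k).pow L).mono (by gcongr; norm_num)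

theorem opQ_spread (hδ0 : 0 ≤ δ) (hδ : ∀ y, δ < ‖y‖ → ψ y = 0) (L : ℕ) {k l : ℤ} (hkl : l ≤ k) :
    OpSpread (opQ ψ L k) (L * (δ * (2 : ℝ) ^ (-l))) :=
  OpSpread.sum_range fun m hm => ((opT_spread hδ0 hδ k).pow m).mono (by gcongr; norm_num)

theorem one_sub_opR_spread (hδ0 : 0 ≤ δ) (hδ : ∀ y, δ < ‖y‖ → ψ y = 0) (L : ℕ) {k l : ℤ}
    (hkl : l ≤ k) : OpSpread (1 - opR ψ L k) (L * (δ * (2 : ℝ) ^ (-l))) :=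
  (OpSpread.one.mono (by positivity)).sub (opR_spread hδ0 hδ L hkl)

open Filter Topology in
/-- The approximations `(1 - (1 - U_k)^L)² φ` converge to `φ` against every distribution. -/
theorem tendsto_apply_sq_one_sub_opR (hψ : (∫ x, ψ x) ≠ 0) {L : ℕ} (hL : 0 < L) (K : ℤ)
    (f : Distr n) (φ : TestFn n) :
    Tendsto (fun m : ℕ => f (((1 - opR ψ L (K + m)) ^ 2 : Module.End ℂ (TestFn n)) φ)) atTop (𝓝 (f φ)) := by
  obtain ⟨δ, hδ0, hδ⟩ := ψ.exists_radius
  obtain ⟨s, hs0, hs⟩ := φ.exists_radius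
  set t : ℝ := L * (δ * (2 : ℝ) ^ (-K)) with ht
  obtain ⟨M, C, hC, hf⟩ := exists_order f (s + (t + t))
  choose a ha0 ha using fun i => φ.exists_bound (i + L)
  set c := kernelNorm ψ
  have hc : 0 ≤ c := kernelNorm_nonneg ψ
  set A := ∑ i ∈ Finset.range (M + 1), a i
  have hAi : ∀ i ≤ M, a i ≤ A := fun i hi =>
    Finset.single_le_sum (f := a) (fun j _ => (ha0 j).le) (Finset.mem_range.2 (Nat.lt_succ_of_le hi))
  have hbound : ∀ m : ℕ, ‖f (((1 - opR ψ L (K + m)) ^ 2 : Module.End ℂ (TestFn n)) φ) - f φ‖ ≤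
      C * ((c * δ * (2 : ℝ) ^ (-K)) ^ L * (2 + (1 + c) ^ L) * A) * ((1 / 2) ^ m) := by
    intro m
    set k : ℤ := K + m
    have hKk : K ≤ k := by simp [k]
    -- The error `-R_k (2 - R_k)` keeps one factor `R_k`, whose gain drives the convergence. Writing
    -- `1 + 1` allows the bounds for the identity to be added.
    have h1 : f (((1 - opR ψ L k) ^ 2 : Module.End ℂ (TestFn n)) φ) - f φ =
        - f ((opR ψ L k * ((1 + 1) - opR ψ L k)) φ) := by
      rw [← map_sub, ← map_neg]
      congr 1
      have : (1 - opR ψ L k) ^ 2 - 1 = -(opR ψ L k * ((1 + 1) - opR ψ L k)) := by noncomm_ring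
      have h2 := congrArg (fun P : Module.End ℂ (TestFn n) => P φ) this
      simpa using h2
    have hsp : OpSpread (opR ψ L k * ((1 + 1) - opR ψ L k)) (t + t) := by
      have ht0 : 0 ≤ t := by positivity
      exact (opR_spread hδ0.le hδ L hKk).mul
        (((OpSpread.one.add OpSpread.one).mono ht0).sub (opR_spread hδ0.le hδ L hKk))
    rw [h1, norm_neg, mul_assoc]
    refine hf _ (fun y hy => hsp φ 0 s (by simpa using hs) y (by simpa using hy)) _
      fun i hi x => ?_
    have h3 := ((opR_gain hψ hδ L k i).mul (((OpBound.one (i + L)).add (OpBound.one (i + L))).sub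
      (opR_opBound ψ L k (i + L)))) φ (a i) (ha i) x
    refine h3.trans ?_
    have h4 : (2 : ℝ) ^ (-k) = (2 : ℝ) ^ (-K) * (1 / 2) ^ m := by
      simp only [k]
      rw [neg_add, zpow_add₀ two_ne_zero, zpow_neg _ (m : ℤ), zpow_natCast, one_div, inv_pow]
    have h5 : ((1 / 2 : ℝ) ^ m) ^ L ≤ (1 / 2) ^ m :=
      pow_le_of_le_one (by positivity) (pow_le_one₀ (by norm_num) (by norm_num)) hL.ne'
    rw [h4, ← mul_assoc, mul_pow, one_add_one_eq_two]
    calc (c * δ * (2 : ℝ) ^ (-K)) ^ L * ((1 / 2 : ℝ) ^ m) ^ L * (2 + (1 + c) ^ L) * a i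
        ≤ (c * δ * (2 : ℝ) ^ (-K)) ^ L * (1 / 2 : ℝ) ^ m * (2 + (1 + c) ^ L) * A := by
          gcongr
          · exact (ha0 i).le
          · exact hAi i hi
      _ = _ := by ring
  rw [tendsto_iff_norm_sub_tendsto_zero]
  refine squeeze_zero (fun _ => norm_nonneg _) hbound ?_
  simpa using (tendsto_pow_atTop_nhds_zero_of_lt_one (r := (1 / 2 : ℝ)) (by norm_num)
    (by norm_num)).const_mul (C * ((c * δ * (2 : ℝ) ^ (-K)) ^ L * (2 + (1 + c) ^ L) * A))

set_option maxHeartbeats 1000000 in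
/-- A distribution applied to a test function living at scale `2^{-j}` is controlled by the
averages of `f` at the finer scales `2^{-j-h-i}`. -/
theorem exists_decomposition_bound (hψ : (∫ x, ψ x) ≠ 0) {L : ℕ} (hL : 0 < L) :
    ∃ (C : ℝ) (h₀ : ℕ), 0 < C ∧ ∀ (j : ℤ) (h : ℕ), h₀ ≤ h → ∀ (φ : TestFn n) (z : Rn n) (s M : ℝ),
      (∀ y, s < dist y z → φ y = 0) → (∀ x, ‖φ x‖ ≤ M) →
      (∀ x, ‖iteratedFDeriv ℝ L φ x‖ ≤ M * ((2 : ℝ) ^ j) ^ L) → ∀ f : Distr n,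
      ‖f φ‖ₑ ≤ ENNReal.ofReal (C * M) * ∑' i : ℕ, ENNReal.ofReal ((1 / 2) ^ (i * L)) *
        ∫⁻ w in closedBall z (s + (2 : ℝ) ^ (-j)), ‖conv ψ (j + h + i) f w‖ₑ := by
  obtain ⟨δ, hδ0, hδ⟩ := ψ.exists_radius
  set c := kernelNorm ψ
  have hc : 0 ≤ c := kernelNorm_nonneg ψ
  set q := ∑ m ∈ Finset.range L, (1 + c) ^ m
  have hq : 0 ≤ q := Finset.sum_nonneg fun _ _ => by positivity
  set κ := ‖∫ x, ψ x‖⁻¹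
  have hκ : 0 ≤ κ := by positivity
  -- The two operators applied at scale `2^{-j-h}` enlarge supports by at most `2 L δ 2^{-j-h}`.
  -- This is below `2^{-j}` because `2 L δ < h₀ ≤ h < 2^h`.
  obtain ⟨h₀, hh₀⟩ := exists_nat_gt (2 * L * δ)
  set C₁ := q * (1 + (1 + c) ^ L) * κ
  set C₂ := q * (2 * (c * δ) ^ L) * κ
  have hC₁ : 0 ≤ C₁ := by positivity
  have hC₂ : 0 ≤ C₂ := by positivity
  refine ⟨C₁ + C₂ * 2 ^ L + C₂ + 1, h₀, by positivity, ?_⟩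
  intro j h hh φ z s M hφs hφM hφL f
  have hM : 0 ≤ M := (norm_nonneg _).trans (hφM 0)
  set K : ℤ := j + h with hK
  set B := closedBall z (s + (2 : ℝ) ^ (-j))
  set I : ℕ → ℝ≥0∞ := fun i => ∫⁻ w in B, ‖conv ψ (K + i) f w‖ₑ with hI
  set e : ℕ → ℝ≥0∞ := fun i => ENNReal.ofReal ((1 / 2) ^ (i * L)) with he
  set S := ∑' i, e i * I i with hS
  have hφ0 : ∀ x, ‖iteratedFDeriv ℝ 0 φ x‖ ≤ M := by simpa using hφM
  have hzero : ∀ {P : Module.End ℂ (TestFn n)} {l : ℕ} {b a : ℝ}, OpBound P 0 l b →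
      (∀ x, ‖iteratedFDeriv ℝ l φ x‖ ≤ a) → ∀ x, ‖P φ x‖ ≤ b * a := by
    intro P l b a hP ha x
    simpa using hP φ a ha x
  -- the supports
  have ht : L * (δ * (2 : ℝ) ^ (-K)) + L * (δ * (2 : ℝ) ^ (-K)) ≤ (2 : ℝ) ^ (-j) := by
    have h1 : (2 : ℝ) ^ (-K) = (2 : ℝ) ^ (-j) * ((2 : ℝ) ^ h)⁻¹ := by
      rw [hK, neg_add, zpow_add₀ two_ne_zero, zpow_neg _ (h : ℤ), zpow_natCast]
    have h2 : 2 * L * δ ≤ (2 : ℝ) ^ h := by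
      have h3 : (h₀ : ℝ) ≤ h := by exact_mod_cast hh
      have h4 : (h : ℝ) < 2 ^ h := by exact_mod_cast Nat.lt_two_pow_self
      linarith
    have h5 : (0 : ℝ) < 2 ^ h := by positivity
    have h6 : 2 * L * δ * ((2 : ℝ) ^ h)⁻¹ ≤ 1 := by
      rw [← div_eq_mul_inv]
      exact (div_le_one h5).2 h2
    calc L * (δ * (2 : ℝ) ^ (-K)) + L * (δ * (2 : ℝ) ^ (-K))
        = (2 : ℝ) ^ (-j) * (2 * L * δ * ((2 : ℝ) ^ h)⁻¹) := by rw [h1]; ring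
      _ ≤ (2 : ℝ) ^ (-j) * 1 := by gcongr
      _ = _ := mul_one _
  have hsupp : ∀ {P : Module.End ℂ (TestFn n)},
      OpSpread P (L * (δ * (2 : ℝ) ^ (-K)) + L * (δ * (2 : ℝ) ^ (-K))) →
      ∀ y, s + (2 : ℝ) ^ (-j) < dist y z → P φ y = 0 :=
    fun hP y hy => hP.mono ht φ z s hφs y hy
  -- the leading term
  have hlead : ‖f (opU ψ K ((opQ ψ L K * (1 - opR ψ L K)) φ))‖ₑ ≤
      ENNReal.ofReal (C₁ * M) * S := by
    refine (enorm_apply_opU_le ψ K f _ (hzero ((opQ_opBound ψ L K 0).mul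
      ((OpBound.one 0).sub (opR_opBound ψ L K 0))) hφ0)
      (hsupp ((opQ_spread hδ0.le hδ L le_rfl).mul (one_sub_opR_spread hδ0.le hδ L le_rfl)))).trans ?_
    have h1 : I 0 ≤ S := by
      refine le_trans (le_of_eq ?_) (ENNReal.le_tsum 0)
      simp [he]
    have h2 : I 0 = ∫⁻ w in B, ‖conv ψ K f w‖ₑ := by simp [hI]
    rw [← h2]
    refine mul_le_mul' (le_of_eq ?_) h1
    congr 1
    simp only [C₁, q, κ]
    ring
  -- the telescoping terms
  have hdiff : ∀ i : ℕ, OpBound (opR ψ L (K + i) - opR ψ L (K + (i + 1 : ℕ))) 0 L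
      (2 * (c * δ * (2 : ℝ) ^ (-(K + i))) ^ L) := by
    intro i g a ha x
    have hgain := fun k => opR_gain hψ hδ L k 0
    rw [zero_add] at hgain
    refine (((hgain (K + i)).sub (hgain (K + (i + 1 : ℕ)))) g a ha x).trans ?_
    have ha0 : 0 ≤ a := (norm_nonneg _).trans (ha x)
    rw [two_mul]
    gcongr
    · norm_num
    · simp
  have hterm : ∀ (i : ℕ) (l : ℕ), (i ≤ l) →
      ‖f (opU ψ (K + l) ((opQ ψ L (K + l) *
        (opR ψ L (K + i) - opR ψ L (K + (i + 1 : ℕ)))) φ))‖ₑ ≤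
      ENNReal.ofReal (C₂ * M) * (e i * I l) := by
    intro i l hil
    refine (enorm_apply_opU_le ψ (K + l) f _ (hzero ((opQ_opBound ψ L (K + l) 0).mul (hdiff i))
      (by simpa using hφL)) (hsupp ((opQ_spread hδ0.le hδ L (by simp)).mul
        ((opR_spread hδ0.le hδ L (by simp)).sub (opR_spread hδ0.le hδ L
          (by push_cast; linarith)))))).trans ?_
    have h0 : ENNReal.ofReal (C₂ * M) * (e i * I l) =
        ENNReal.ofReal (C₂ * M * (1 / 2) ^ (i * L)) * I l := by
      rw [← mul_assoc, ← ENNReal.ofReal_mul (by positivity)]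
    rw [h0]
    refine mul_le_mul' (ENNReal.ofReal_le_ofReal ?_) le_rfl
    have h1 : (2 : ℝ) ^ (-(K + i)) * (2 : ℝ) ^ j = (1 / 2) ^ h * (1 / 2) ^ i := by
      rw [← zpow_add₀ two_ne_zero, one_div, inv_pow, inv_pow, ← zpow_natCast, ← zpow_natCast,
        ← zpow_neg, ← zpow_neg, ← zpow_add₀ two_ne_zero]
      congr 1
      simp only [hK]
      ring
    calc q * (2 * (c * δ * (2 : ℝ) ^ (-(K + i))) ^ L) * (M * ((2 : ℝ) ^ j) ^ L) * κ
        = C₂ * M * ((2 : ℝ) ^ (-(K + i)) * (2 : ℝ) ^ j) ^ L := by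
          simp only [C₂, mul_pow]; ring
      _ = C₂ * M * ((1 / 2) ^ h * (1 / 2) ^ i) ^ L := by rw [h1]
      _ ≤ C₂ * M * (1 * (1 / 2) ^ i) ^ L := by
          gcongr
          exact pow_le_one₀ (by norm_num) (by norm_num)
      _ = C₂ * M * (1 / 2) ^ (i * L) := by rw [one_mul, ← pow_mul]
  -- Half of the telescoped terms pair the average at index `i + 1` with the decay of index `i`;
  -- realigning them costs `2^L`.
  have hshift : ∀ i, e i = ENNReal.ofReal (2 ^ L) * e (i + 1) := by
    intro i
    simp only [he]
    rw [← ENNReal.ofReal_mul (by positivity)]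
    congr 1
    rw [add_mul, one_mul, pow_add, one_div, inv_pow, inv_pow]
    field_simp
  clear_value C₁ C₂
  have hpart : ∀ m : ℕ, ‖f (((1 - opR ψ L (K + m)) ^ 2 : Module.End ℂ (TestFn n)) φ)‖ₑ ≤
      ENNReal.ofReal ((C₁ + C₂ * 2 ^ L + C₂ + 1) * M) * S := by
    intro m
    rw [sq_one_sub_opR_telescope]
    simp only [LinearMap.add_apply, LinearMap.sum_apply, Module.End.mul_apply, map_add, map_sum]
    have hsum : ‖∑ i ∈ Finset.range m, (f (opU ψ (K + (i + 1 : ℕ)) (opQ ψ L (K + (i + 1 : ℕ))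
          ((opR ψ L (K + i) - opR ψ L (K + (i + 1 : ℕ))) φ))) +
        f (opU ψ (K + i) (opQ ψ L (K + i)
          ((opR ψ L (K + i) - opR ψ L (K + (i + 1 : ℕ))) φ))))‖ₑ ≤
        ENNReal.ofReal (C₂ * 2 ^ L * M) * S + ENNReal.ofReal (C₂ * M) * S := by
      refine (enorm_sum_le _ _).trans ?_
      have h1 : ∀ i ∈ Finset.range m, ‖f (opU ψ (K + (i + 1 : ℕ)) (opQ ψ L (K + (i + 1 : ℕ))
          ((opR ψ L (K + i) - opR ψ L (K + (i + 1 : ℕ))) φ))) +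
        f (opU ψ (K + i) (opQ ψ L (K + i)
          ((opR ψ L (K + i) - opR ψ L (K + (i + 1 : ℕ))) φ)))‖ₑ ≤
          ENNReal.ofReal (C₂ * 2 ^ L * M) * (e (i + 1) * I (i + 1)) +
            ENNReal.ofReal (C₂ * M) * (e i * I i) := by
        intro i _
        refine (enorm_add_le _ _).trans (add_le_add ?_ (hterm i i le_rfl))
        refine (hterm i (i + 1) (Nat.le_succ i)).trans (le_of_eq ?_)
        rw [hshift i, ← mul_assoc, ← mul_assoc, ← ENNReal.ofReal_mul (by positivity), mul_assoc]
        congr 2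
        ring
      refine (Finset.sum_le_sum h1).trans ?_
      rw [Finset.sum_add_distrib, ← Finset.mul_sum, ← Finset.mul_sum]
      gcongr
      · refine le_trans ?_ (ENNReal.sum_le_tsum (Finset.range (m + 1)))
        rw [Finset.sum_range_succ']
        exact le_self_add
      · exact ENNReal.sum_le_tsum _
    refine (enorm_add_le _ _).trans ((add_le_add hlead hsum).trans ?_)
    rw [← add_mul, ← add_mul, ← ENNReal.ofReal_add (by positivity) (by positivity),
      ← ENNReal.ofReal_add (by positivity) (by positivity)]
    gcongr
    linarith
  exact le_of_tendsto' (tendsto_apply_sq_one_sub_opR hψ hL K f φ).enorm hpart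

end Decomposition

end LocalHardy

namespace LocalHardy

variable {n : ℕ}

/-! ### Real powers of two in `ℝ≥0∞`. -/

section PowersOfTwo

theorem two_rpow_add (x y : ℝ) : (2 : ℝ≥0∞) ^ (x + y) = 2 ^ x * 2 ^ y :=
  ENNReal.rpow_add x y two_ne_zero ENNReal.ofNat_ne_top

theorem two_rpow_ne_zero (x : ℝ) : (2 : ℝ≥0∞) ^ x ≠ 0 :=
  (ENNReal.rpow_pos two_pos ENNReal.ofNat_ne_top).ne'

theorem two_rpow_ne_top (x : ℝ) : (2 : ℝ≥0∞) ^ x ≠ ⊤ :=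
  ENNReal.rpow_ne_top_of_ne_zero two_ne_zero ENNReal.ofNat_ne_top

theorem two_rpow_mono {x y : ℝ} (h : x ≤ y) : (2 : ℝ≥0∞) ^ x ≤ 2 ^ y :=
  ENNReal.rpow_le_rpow_of_exponent_le one_le_two h

theorem ofReal_two_rpow (x : ℝ) : ENNReal.ofReal ((2 : ℝ) ^ x) = 2 ^ x := by
  rw [← ENNReal.ofReal_rpow_of_pos two_pos, ENNReal.ofReal_ofNat]

theorem ofReal_two_zpow (x : ℤ) : ENNReal.ofReal ((2 : ℝ) ^ x) = 2 ^ (x : ℝ) := by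
  rw [← Real.rpow_intCast, ofReal_two_rpow]

theorem tsum_two_rpow_neg_le {t : ℝ} (ht : 1 ≤ t) : ∑' i : ℕ, (2 : ℝ≥0∞) ^ (-(i * t)) ≤ 2 := by
  have h : ∀ i : ℕ, (2 : ℝ≥0∞) ^ (-(i * t)) ≤ 2⁻¹ ^ i := fun i => by
    rw [← ENNReal.rpow_natCast, ENNReal.inv_rpow, ← ENNReal.rpow_neg]
    refine two_rpow_mono (neg_le_neg ?_)
    exact le_mul_of_one_le_right (Nat.cast_nonneg i) ht
  refine (ENNReal.tsum_le_tsum h).trans ?_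
  rw [ENNReal.tsum_geometric, ENNReal.one_sub_inv_two, inv_inv]

end PowersOfTwo

/-! ### The absorption argument. -/

section AverageBounds

/-- The values of `F j` are controlled by averages of the functions `F (j + h + i)`, `i ≥ 0`, at
scale `2^{-j}`, with weights decaying like `2^{-iL}`. -/
def AvgBound (F : ℤ → Rn n → ℝ≥0∞) (c : ℝ) (L h₀ : ℕ) (C : ℝ≥0∞) : Prop :=
  ∀ (j : ℤ) (h : ℕ), h₀ ≤ h → ∀ z : Rn n,
    F j z ≤ C * 2 ^ (j * n : ℝ) * ∑' i : ℕ, 2 ^ (-(i * L : ℝ)) *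
      ∫⁻ w in closedBall z (c * (2 : ℝ) ^ (-j)), F (j + h + i) w

theorem eq_rpow_mul_rpow (x : ℝ≥0∞) {r : ℝ} (hr : 0 < r) (hr1 : r ≤ 1) :
    x = x ^ (1 - r) * x ^ r := by
  rw [← ENNReal.rpow_add_of_nonneg _ _ (by linarith) hr.le, sub_add_cancel, ENNReal.rpow_one]

/-- Absorption argument: if `F` has a priori growth `2^{(k-j)a}` near `z`, then `(F j z)^r` is
controlled by a local average of the `r`-th powers at finer scales. -/
theorem AvgBound.rpow_le_of_growth {F : ℤ → Rn n → ℝ≥0∞} {c : ℝ} (hc : 0 ≤ c) {L h₀ : ℕ}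
    {C : ℝ≥0∞} (hF : AvgBound F c L h₀ C) {r : ℝ} (hr : 0 < r) (hr1 : r ≤ 1) {a : ℝ}
    (ha : n ≤ a * r) (ha0 : 0 ≤ a) (hL : a + 1 ≤ L) (j : ℤ) (z : Rn n) {M : ℝ≥0∞} (hM : M ≠ ⊤)
    (hgrowth : ∀ l : ℕ, ∀ w ∈ closedBall z (2 * c * (2 : ℝ) ^ (-j)),
      F (j + l) w ≤ M * 2 ^ (l * a))
    {V : Rn n → ℝ≥0∞} (hV : ∀ l : ℕ, 0 < l → ∀ w ∈ closedBall z (2 * c * (2 : ℝ) ^ (-j)),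
      F (j + l) w ^ r ≤ V w) :
    F j z ^ r ≤ C * 2 ^ ((h₀ + 1) * a) * 2 * (2 ^ (j * n : ℝ) *
      ∫⁻ w in closedBall z (2 * c * (2 : ℝ) ^ (-j)), V w) := by
  -- The radii increase from `0` towards `2 c 2^{-j}`, and the gap after `ρ l` is exactly `c
  -- 2^{-j-l}`, the averaging radius at scale `j + l`. Averages around points of one ball thus stay
  -- in all later balls.
  set ρ : ℕ → ℝ := fun l => 2 * c * (2 : ℝ) ^ (-j) * (1 - (1 / 2) ^ l) with hρ
  have hρle : ∀ l, closedBall z (ρ l) ⊆ closedBall z (2 * c * (2 : ℝ) ^ (-j)) := fun l => by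
    refine closedBall_subset_closedBall (mul_le_of_le_one_right (by positivity) ?_)
    have : (0 : ℝ) ≤ (1 / 2) ^ l := by positivity
    linarith
  set I := ∫⁻ w in closedBall z (2 * c * (2 : ℝ) ^ (-j)), V w
  set S : ℝ≥0∞ := ⨆ (l : ℕ) (w : Rn n) (_ : w ∈ closedBall z (ρ l)), 2 ^ (-(l * a)) * F (j + l) w
    with hS
  have hcancel : ∀ x : ℝ, (2 : ℝ≥0∞) ^ (-x) * 2 ^ x = 1 := fun x => by
    rw [← two_rpow_add, neg_add_cancel, ENNReal.rpow_zero]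
  have hSM : S ≤ M := by
    refine iSup_le fun l => iSup_le fun w => iSup_le fun hw => ?_
    refine (mul_le_mul' le_rfl (hgrowth l w (hρle l hw))).trans (le_of_eq ?_)
    rw [mul_left_comm, hcancel, mul_one]
  -- The growth hypothesis serves only here: finiteness of `S` permits division by `S ^ (1 - r)`,
  -- and `M` leaves no trace in the final constant.
  have hStop : S ≠ ⊤ := ne_top_of_le_ne_top hM hSM
  have hFS : ∀ (l : ℕ) (w : Rn n), w ∈ closedBall z (ρ l) → F (j + l) w ≤ 2 ^ (l * a) * S := by
    intro l w hw
    have h1 : 2 ^ (-(l * a)) * F (j + l) w ≤ S :=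
      le_iSup_of_le l (le_iSup_of_le w (le_iSup_of_le hw le_rfl))
    calc F (j + l) w = 2 ^ (l * a) * (2 ^ (-(l * a)) * F (j + l) w) := by
          rw [← mul_assoc, mul_comm (2 ^ (l * a)), hcancel, one_mul]
      _ ≤ _ := by gcongr
  have hball : ∀ (l i : ℕ) (w : Rn n), w ∈ closedBall z (ρ l) →
      closedBall w (c * (2 : ℝ) ^ (-(j + l))) ⊆ closedBall z (ρ (l + (h₀ + 1) + i)) := by
    intro l i w hw
    refine closedBall_subset_closedBall' ?_
    rw [mem_closedBall] at hw
    have h1 : (2 : ℝ) ^ (-(j + (l : ℤ))) = (2 : ℝ) ^ (-j) * (1 / 2) ^ l := by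
      rw [neg_add, zpow_add₀ two_ne_zero, zpow_neg _ (l : ℤ), zpow_natCast, one_div, inv_pow]
    have h2 : (1 / 2 : ℝ) ^ (l + (h₀ + 1) + i) ≤ (1 / 2) ^ (l + 1) :=
      pow_le_pow_of_le_one (by norm_num) (by norm_num) (by omega)
    have h3 : ρ l + c * (2 : ℝ) ^ (-(j + l)) = 2 * c * (2 : ℝ) ^ (-j) * (1 - (1 / 2) ^ (l + 1)) := by
      rw [h1, hρ]; simp only [pow_succ]; ring
    have h4 : 2 * c * (2 : ℝ) ^ (-j) * (1 - (1 / 2) ^ (l + 1)) ≤ ρ (l + (h₀ + 1) + i) := by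
      simp only [hρ]; gcongr
    linarith
  have hmain : S ≤ S ^ (1 - r) * (C * 2 ^ ((h₀ + 1) * a) * 2 * (2 ^ (j * n : ℝ) * I)) := by
    refine iSup_le fun l => iSup_le fun w => iSup_le fun hw => ?_
    have hint : ∀ i : ℕ, ∫⁻ w in closedBall w (c * (2 : ℝ) ^ (-(j + l))),
        F (j + l + (h₀ + 1 : ℕ) + i) w ≤ (2 ^ ((l + (h₀ + 1) + i) * a) * S) ^ (1 - r) * I := by
      intro i
      have htop : (2 ^ ((l + (h₀ + 1) + i) * a) * S) ^ (1 - r) ≠ ⊤ :=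
        ENNReal.rpow_ne_top_of_nonneg (by linarith) (ENNReal.mul_ne_top (two_rpow_ne_top _) hStop)
      rw [← lintegral_const_mul' _ _ htop]
      refine (setLIntegral_mono' measurableSet_closedBall fun w' hw' => ?_).trans
        (lintegral_mono_set ((hball l i w hw).trans (hρle _)))
      have hw'' := hball l i w hw hw'
      have hidx : j + l + (h₀ + 1 : ℕ) + i = j + ((l + (h₀ + 1) + i : ℕ) : ℤ) := by
        push_cast; ring
      rw [hidx, eq_rpow_mul_rpow (F (j + ((l + (h₀ + 1) + i : ℕ) : ℤ)) w') hr hr1]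
      refine mul_le_mul' (ENNReal.rpow_le_rpow ?_ (by linarith)) (hV _ (by omega) _ (hρle _ hw''))
      have := hFS _ _ hw''
      push_cast at this ⊢
      exact this
    have hterm : ∀ i : ℕ, 2 ^ (-(i * L : ℝ)) * ∫⁻ w in closedBall w (c * (2 : ℝ) ^ (-(j + l))),
        F (j + l + (h₀ + 1 : ℕ) + i) w ≤
        2 ^ (-(i * (L - a))) * (2 ^ ((l + (h₀ + 1)) * a * (1 - r)) * S ^ (1 - r) * I) := by
      intro i
      refine (mul_le_mul' le_rfl (hint i)).trans ?_
      rw [ENNReal.mul_rpow_of_nonneg _ _ (by linarith : 0 ≤ 1 - r), ← ENNReal.rpow_mul,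
        mul_assoc, ← mul_assoc, mul_assoc (2 ^ ((l + (h₀ + 1)) * a * (1 - r))),
        ← mul_assoc (2 ^ (-(i * (L - a)))), ← two_rpow_add, ← two_rpow_add]
      refine mul_le_mul' (two_rpow_mono ?_) le_rfl
      have : 0 ≤ (i : ℝ) * a * r := by positivity
      linarith
    -- The offset `h₀ + 1` instead of `h₀` ensures that only strictly finer scales occur, as `hV`
    -- requires.
    have h1 := hF (j + l) (h₀ + 1) (Nat.le_succ _) w
    have h2 := h1.trans (mul_le_mul' le_rfl (ENNReal.tsum_le_tsum hterm))
    rw [ENNReal.tsum_mul_right] at h2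
    have h3 := tsum_two_rpow_neg_le (t := L - a) (by linarith)
    calc 2 ^ (-(l * a)) * F (j + l) w
        ≤ 2 ^ (-(l * a)) * (C * 2 ^ (((j + l : ℤ) : ℝ) * n) * (2 *
          (2 ^ ((l + (h₀ + 1)) * a * (1 - r)) * S ^ (1 - r) * I))) := by
          gcongr
          exact h2.trans (by gcongr)
      _ = (2 ^ (-(l * a)) * 2 ^ (((j + l : ℤ) : ℝ) * n) * 2 ^ ((l + (h₀ + 1)) * a * (1 - r))) *
          (C * 2 * S ^ (1 - r) * I) := by ring
      _ ≤ (2 ^ ((h₀ + 1) * a) * 2 ^ (j * n : ℝ)) * (C * 2 * S ^ (1 - r) * I) := by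
          refine mul_le_mul' ?_ le_rfl
          rw [← two_rpow_add, ← two_rpow_add, ← two_rpow_add]
          refine two_rpow_mono ?_
          push_cast
          -- The volume loss `2^{ln}` at scale `j + l` is compensated exactly when `n ≤ a r`; this
          -- makes the bound uniform in `l`.
          have h4 : (l : ℝ) * n ≤ l * (a * r) := by gcongr
          have h5 : 0 ≤ ((h₀ : ℝ) + 1) * a * r := by positivity
          linarith
      _ = _ := by ring
  have hSr : S ^ r ≤ C * 2 ^ ((h₀ + 1) * a) * 2 * (2 ^ (j * n : ℝ) * I) := by
    rcases eq_or_ne S 0 with h0 | h0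
    · rw [h0, ENNReal.zero_rpow_of_pos hr]
      exact zero_le
    · have h5 : S ^ (1 - r) * S ^ r ≤
          S ^ (1 - r) * (C * 2 ^ ((h₀ + 1) * a) * 2 * (2 ^ (j * n : ℝ) * I)) := by
        rwa [← eq_rpow_mul_rpow S hr hr1]
      exact (ENNReal.mul_le_mul_iff_right (ENNReal.rpow_pos (pos_iff_ne_zero.2 h0) hStop).ne'
        (ENNReal.rpow_ne_top_of_nonneg (by linarith) hStop)).1 h5
  refine (ENNReal.rpow_le_rpow ?_ hr.le).trans hSr
  have := hFS 0 z (by simp [hρ])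
  simpa using this

end AverageBounds

end LocalHardy

namespace LocalHardy

variable {n : ℕ}

/-! ### Sub-mean value inequalities for `r`-th powers. -/

section SubMeanValue

/-- Polynomial growth of `F k` in `2^k`, locally uniformly. -/
def LocallyPolynomial (F : ℤ → Rn n → ℝ≥0∞) : Prop :=
  ∀ (j : ℤ) (z : Rn n) (s : ℝ), ∃ (a : ℝ) (M : ℝ≥0∞), M ≠ ⊤ ∧
    ∀ l : ℕ, ∀ w ∈ closedBall z s, F (j + l) w ≤ M * 2 ^ (l * a)

theorem two_zpow_neg_add_le (j : ℤ) (l : ℕ) : (2 : ℝ) ^ (-(j + (l : ℤ))) ≤ (2 : ℝ) ^ (-j) :=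
  zpow_le_zpow_right₀ one_le_two (by omega)

/-- Sub-mean value inequality for `r`-th powers. The constant depends on `F` only through the
constants in the averaging bounds. -/
theorem exists_sub_mean_value (n : ℕ) {c : ℝ} (hc : 0 ≤ c) (H : ℕ → ℕ) (C : ℕ → ℝ≥0∞)
    (hC : ∀ L, C L ≠ ⊤) {r : ℝ} (hr : 0 < r) (hr1 : r ≤ 1) :
    ∃ C' : ℝ≥0∞, C' ≠ ⊤ ∧ C' ≠ 0 ∧ ∀ F : ℤ → Rn n → ℝ≥0∞,
      (∀ L, 0 < L → AvgBound F c L (H L) (C L)) → LocallyPolynomial F →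
      ∀ (j : ℤ) (z : Rn n) (V : Rn n → ℝ≥0∞),
        (∀ l : ℕ, 0 < l → ∀ w ∈ closedBall z (4 * c * (2 : ℝ) ^ (-j)), F (j + l) w ^ r ≤ V w) →
        F j z ^ r ≤ C' * (2 ^ (j * n : ℝ) * ∫⁻ w in closedBall z (4 * c * (2 : ℝ) ^ (-j)), V w) := by
  obtain ⟨L, hL⟩ := exists_nat_ge ((n : ℝ) / r + 1)
  have hnr : 0 ≤ (n : ℝ) / r := by positivity
  have hL0 : 0 < L := by
    rcases Nat.eq_zero_or_pos L with h | h
    · rw [h] at hL; norm_num at hL; linarith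
    · exact h
  set A : ℝ≥0∞ := C L * 2 ^ ((H L + 1) * ((n : ℝ) / r)) * 2
  have hA : A ≠ ⊤ := ENNReal.mul_ne_top (ENNReal.mul_ne_top (hC L) (two_rpow_ne_top _))
    ENNReal.ofNat_ne_top
  -- The summand `1` makes the constant nonzero, so the right side is infinite whenever the integral
  -- is.
  refine ⟨A + 1, ENNReal.add_ne_top.2 ⟨hA, ENNReal.one_ne_top⟩, by simp, ?_⟩
  intro F hF hpoly j z V hV
  set I := ∫⁻ w in closedBall z (4 * c * (2 : ℝ) ^ (-j)), V w with hI
  have h2j : (0 : ℝ) < (2 : ℝ) ^ (-j) := by positivity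
  by_cases htop : I = ⊤
  · rw [htop, ENNReal.mul_top (two_rpow_ne_zero _), ENNReal.mul_top (by simp)]
    exact le_top
  have hsub : closedBall z (2 * c * (2 : ℝ) ^ (-j)) ⊆ closedBall z (4 * c * (2 : ℝ) ^ (-j)) :=
    closedBall_subset_closedBall (by gcongr; norm_num)
  -- a first, qualitative bound
  obtain ⟨a, M, hM, hgr⟩ := hpoly j z (4 * c * (2 : ℝ) ^ (-j))
  set a₁ := max a ((n : ℝ) / r)
  obtain ⟨L₁, hL₁⟩ := exists_nat_ge (a₁ + 1)
  have ha₁ : 0 ≤ a₁ := hnr.trans (le_max_right _ _)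
  have hL₁0 : 0 < L₁ := by
    rcases Nat.eq_zero_or_pos L₁ with h | h
    · rw [h] at hL₁; norm_num at hL₁; linarith
    · exact h
  set A₁ : ℝ≥0∞ := C L₁ * 2 ^ ((H L₁ + 1) * a₁) * 2
  have hA₁ : A₁ ≠ ⊤ := ENNReal.mul_ne_top (ENNReal.mul_ne_top (hC L₁) (two_rpow_ne_top _))
    ENNReal.ofNat_ne_top
  -- Here `a₁` and `A₁` depend on the a priori growth of `F`. The conclusion, however, is growth
  -- with exponent `n / r`, which lets the absorption be run again with an exponent and constant
  -- independent of `F`.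
  have hfirst : ∀ l : ℕ, ∀ w ∈ closedBall z (2 * c * (2 : ℝ) ^ (-j)),
      F (j + l) w ^ r ≤ A₁ * (2 ^ ((j + l : ℤ) * n : ℝ) * I) := by
    intro l w hw
    have hball : closedBall w (2 * c * (2 : ℝ) ^ (-(j + (l : ℤ)))) ⊆
        closedBall z (4 * c * (2 : ℝ) ^ (-j)) := by
      refine closedBall_subset_closedBall' ?_
      rw [mem_closedBall] at hw
      have : 2 * c * (2 : ℝ) ^ (-(j + (l : ℤ))) ≤ 2 * c * (2 : ℝ) ^ (-j) := by
        exact mul_le_mul_of_nonneg_left (two_zpow_neg_add_le j l) (by positivity)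
      linarith
    refine ((hF L₁ hL₁0).rpow_le_of_growth hc hr hr1 (a := a₁) ?_ ha₁ hL₁ (j + l) w
      (M := M * 2 ^ (l * a₁)) (ENNReal.mul_ne_top hM (two_rpow_ne_top _)) ?_ (V := V) ?_).trans ?_
    · rw [← div_le_iff₀ hr]
      exact le_max_right _ _
    · intro i w' hw'
      have := hgr (l + i) w' (hball hw')
      rw [Nat.cast_add, ← add_assoc] at this
      refine this.trans ?_
      rw [mul_assoc, ← two_rpow_add]
      refine mul_le_mul' le_rfl (two_rpow_mono ?_)
      rw [← add_mul]
      push_cast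
      gcongr
      exact le_max_left _ _
    · intro i hi w' hw'
      have := hV (l + i) (by omega) w' (hball hw')
      rwa [Nat.cast_add, ← add_assoc] at this
    · exact mul_le_mul' le_rfl (mul_le_mul' le_rfl (lintegral_mono_set hball))
  -- the quantitative bound
  refine ((hF L hL0).rpow_le_of_growth hc hr hr1 (a := n / r) ?_ hnr hL j z
      (M := (A₁ * (2 ^ (j * n : ℝ) * I)) ^ (1 / r)) ?_ ?_ (V := V) ?_).trans ?_
  · rw [div_mul_cancel₀ _ hr.ne']
  · exact ENNReal.rpow_ne_top_of_nonneg (by positivity)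
      (ENNReal.mul_ne_top hA₁ (ENNReal.mul_ne_top (two_rpow_ne_top _) htop))
  · intro l w hw
    have h1 := ENNReal.rpow_le_rpow (hfirst l w hw) (by positivity : 0 ≤ 1 / r)
    rw [← ENNReal.rpow_mul, mul_one_div_cancel hr.ne', ENNReal.rpow_one] at h1
    refine h1.trans (le_of_eq ?_)
    have h2 : (2 : ℝ≥0∞) ^ (l * (n / r : ℝ)) = (2 ^ (l * n : ℝ)) ^ (1 / r) := by
      rw [← ENNReal.rpow_mul]; congr 1; ring
    rw [h2, ← ENNReal.mul_rpow_of_nonneg _ _ (by positivity)]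
    congr 1
    push_cast
    rw [add_mul, two_rpow_add]
    ring
  · exact fun l hl w hw => hV l hl w (hsub hw)
  · exact mul_le_mul' le_self_add (mul_le_mul' le_rfl (lintegral_mono_set hsub))

/-- Sub-mean value inequality using only scales finer than `2^{-j-h}`. -/
theorem exists_sub_mean_value_shift (n : ℕ) {c : ℝ} (hc : 0 ≤ c) (H : ℕ → ℕ) (C : ℕ → ℝ≥0∞)
    (hC : ∀ L, C L ≠ ⊤) {r : ℝ} (hr : 0 < r) (hr1 : r ≤ 1) :
    ∃ C' : ℝ≥0∞, C' ≠ ⊤ ∧ ∀ F : ℤ → Rn n → ℝ≥0∞,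
      (∀ L, 0 < L → AvgBound F c L (H L) (C L)) → LocallyPolynomial F →
      ∀ (j : ℤ) (h : ℕ) (z : Rn n) (V : Rn n → ℝ≥0∞),
        (∀ l : ℕ, h ≤ l → ∀ w ∈ closedBall z (5 * c * (2 : ℝ) ^ (-j)), F (j + l) w ^ r ≤ V w) →
        F j z ^ r ≤ C' * (2 ^ (h * n : ℝ) * 2 ^ (j * n : ℝ) *
          ∫⁻ w in closedBall z (5 * c * (2 : ℝ) ^ (-j)), V w) := by
  obtain ⟨C₁, hC₁, hC₁0, hsub⟩ := exists_sub_mean_value n hc H C hC hr hr1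
  -- `F ^ (1 - r)` is the `b`-th power of `F ^ r`: the sub-mean value inequality bounds it by a
  -- power of the integral, while the other factor `F ^ r` is integrated. Since `1 + b = 1 / r`, the
  -- final `r`-th power restores the first power of the integral.
  set b : ℝ := (1 - r) / r with hb
  have hb0 : 0 ≤ b := div_nonneg (by linarith) hr.le
  have hbr : b * r = 1 - r := div_mul_cancel₀ _ hr.ne'
  obtain ⟨L, hL⟩ := exists_nat_ge (n * b + 1)
  have hnb : 0 ≤ n * b := by positivity
  have hL0 : 0 < L := by
    rcases Nat.eq_zero_or_pos L with h | h
    · rw [h] at hL; norm_num at hL; linarith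
    · exact h
  refine ⟨(C L * 2 * C₁ ^ b * 2 ^ (H L * n * b : ℝ)) ^ r, ?_, ?_⟩
  · exact ENNReal.rpow_ne_top_of_nonneg hr.le (ENNReal.mul_ne_top (ENNReal.mul_ne_top
      (ENNReal.mul_ne_top (hC L) ENNReal.ofNat_ne_top) (ENNReal.rpow_ne_top_of_nonneg hb0 hC₁))
      (two_rpow_ne_top _))
  intro F hF hpoly j h z V hV
  set I := ∫⁻ w in closedBall z (5 * c * (2 : ℝ) ^ (-j)), V w with hI
  have hsmall : closedBall z (c * (2 : ℝ) ^ (-j)) ⊆ closedBall z (5 * c * (2 : ℝ) ^ (-j)) := by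
    refine closedBall_subset_closedBall ?_
    have : 0 ≤ c * (2 : ℝ) ^ (-j) := by positivity
    linarith
  have hpt : ∀ l : ℕ, h ≤ l → ∀ w ∈ closedBall z (c * (2 : ℝ) ^ (-j)),
      F (j + l) w ^ r ≤ C₁ * (2 ^ ((j + l : ℤ) * n : ℝ) * I) := by
    intro l hl w hw
    have hball : closedBall w (4 * c * (2 : ℝ) ^ (-(j + (l : ℤ)))) ⊆
        closedBall z (5 * c * (2 : ℝ) ^ (-j)) := by
      refine closedBall_subset_closedBall' ?_
      rw [mem_closedBall] at hw
      have : 4 * c * (2 : ℝ) ^ (-(j + (l : ℤ))) ≤ 4 * c * (2 : ℝ) ^ (-j) := by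
        exact mul_le_mul_of_nonneg_left (two_zpow_neg_add_le j l) (by positivity)
      linarith
    refine (hsub F hF hpoly (j + l) w V fun i hi w' hw' => ?_).trans
      (mul_le_mul' le_rfl (mul_le_mul' le_rfl (lintegral_mono_set hball)))
    have := hV (l + i) (by omega) w' (hball hw')
    rwa [Nat.cast_add, ← add_assoc] at this
  have hone : 1 + b = 1 / r := by rw [hb]; field_simp; ring
  have hmain : F j z ≤ C L * 2 * C₁ ^ b * 2 ^ (H L * n * b : ℝ) *
      (2 ^ (h * n * b : ℝ) * 2 ^ (j * n * (1 + b) : ℝ) * I ^ (1 + b)) := by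
    -- Starting at offset `h + H L` keeps every scale in the range `l ≥ h` covered by `hV`.
    refine (hF L hL0 j (h + H L) (Nat.le_add_left _ _) z).trans ?_
    set G : ℝ≥0∞ := C₁ ^ b * 2 ^ (H L * n * b : ℝ) * 2 ^ (h * n * b : ℝ) * 2 ^ (j * n * b : ℝ) *
      I ^ (1 + b) with hG
    have hterm : ∀ i : ℕ, 2 ^ (-(i * L : ℝ)) * ∫⁻ w in closedBall z (c * (2 : ℝ) ^ (-j)),
        F (j + (h + H L : ℕ) + i) w ≤ 2 ^ (-(i * (L - n * b))) * G := by
      intro i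
      have hidx : j + (h + H L : ℕ) + i = j + ((h + H L + i : ℕ) : ℤ) := by push_cast; ring
      rw [hidx]
      set B : ℝ≥0∞ := (C₁ * (2 ^ (((j + ((h + H L + i : ℕ) : ℤ) : ℤ) : ℝ) * n : ℝ) * I)) ^ b
        with hB
      have hintg : ∫⁻ w in closedBall z (c * (2 : ℝ) ^ (-j)), F (j + ((h + H L + i : ℕ) : ℤ)) w ≤
          B * I := by
        by_cases hI0 : I = 0
        · have hz : ∀ w ∈ closedBall z (c * (2 : ℝ) ^ (-j)),
              F (j + ((h + H L + i : ℕ) : ℤ)) w ≤ 0 := by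
            intro w hw
            have := hpt (h + H L + i) (by omega) w hw
            rw [hI0, mul_zero, mul_zero, nonpos_iff_eq_zero, ENNReal.rpow_eq_zero_iff_of_pos hr]
              at this
            exact this.le
          refine (setLIntegral_mono' measurableSet_closedBall hz).trans ?_
          simp
        -- A constant leaves the integral only if finite. When `I = ⊤` the claim is trivial provided
        -- `B ≠ 0`, for which `C₁ ≠ 0` was recorded.
        by_cases hItop : I = ⊤
        · have hBpos : B ≠ 0 := by
            rw [hB, hItop, ENNReal.mul_top (two_rpow_ne_zero _), ENNReal.mul_top hC₁0]
            rcases hb0.eq_or_lt with h0 | h0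
            · simp [← h0]
            · simp [ENNReal.top_rpow_of_pos h0]
          rw [hItop, ENNReal.mul_top hBpos]
          exact le_top
        have hBtop : B ≠ ⊤ := ENNReal.rpow_ne_top_of_nonneg hb0
          (ENNReal.mul_ne_top hC₁ (ENNReal.mul_ne_top (two_rpow_ne_top _) hItop))
        rw [hI, ← lintegral_const_mul' _ _ hBtop]
        refine (setLIntegral_mono' measurableSet_closedBall fun w hw => ?_).trans
          (lintegral_mono_set hsmall)
        have h1 := hpt (h + H L + i) (by omega) w hw
        rw [eq_rpow_mul_rpow (F (j + ((h + H L + i : ℕ) : ℤ)) w) hr hr1]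
        refine mul_le_mul' ?_ (hV _ (by omega) w (hsmall hw))
        have h2 := ENNReal.rpow_le_rpow h1 hb0
        rw [← ENNReal.rpow_mul, mul_comm r b, hbr] at h2
        exact h2
      refine (mul_le_mul' le_rfl hintg).trans (le_of_eq ?_)
      rw [hB, hG, ENNReal.mul_rpow_of_nonneg _ _ hb0, ENNReal.mul_rpow_of_nonneg _ _ hb0,
        ← ENNReal.rpow_mul, ENNReal.rpow_add_of_nonneg _ _ zero_le_one hb0, ENNReal.rpow_one]
      have h3 : (2 : ℝ≥0∞) ^ (-(i * L : ℝ)) *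
          2 ^ (((j + ((h + H L + i : ℕ) : ℤ) : ℤ) : ℝ) * n * b : ℝ) = 2 ^ (-(i * (L - n * b))) *
          2 ^ (H L * n * b : ℝ) * 2 ^ (h * n * b : ℝ) * 2 ^ (j * n * b : ℝ) := by
        simp only [← two_rpow_add]
        congr 1
        push_cast
        ring
      calc _ = (2 : ℝ≥0∞) ^ (-(i * L : ℝ)) *
          2 ^ (((j + ((h + H L + i : ℕ) : ℤ) : ℤ) : ℝ) * n * b : ℝ) * (C₁ ^ b * I ^ b * I) := by ring
        _ = _ := by rw [h3]; ring
    have h2 := ENNReal.tsum_le_tsum hterm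
    rw [ENNReal.tsum_mul_right] at h2
    have h3 := tsum_two_rpow_neg_le (t := L - n * b) (by linarith)
    refine (mul_le_mul' le_rfl (h2.trans (mul_le_mul' h3 le_rfl))).trans (le_of_eq ?_)
    rw [hG, mul_add (j * n : ℝ), mul_one, two_rpow_add]
    ring
  have h4 := ENNReal.rpow_le_rpow hmain hr.le
  refine h4.trans ?_
  rw [ENNReal.mul_rpow_of_nonneg _ _ hr.le]
  refine mul_le_mul' le_rfl ?_
  rw [ENNReal.mul_rpow_of_nonneg _ _ hr.le, ENNReal.mul_rpow_of_nonneg _ _ hr.le,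
    ← ENNReal.rpow_mul, ← ENNReal.rpow_mul, ← ENNReal.rpow_mul, hone, one_div,
    inv_mul_cancel₀ hr.ne', ENNReal.rpow_one, mul_assoc (j * n : ℝ), inv_mul_cancel₀ hr.ne', mul_one]
  refine mul_le_mul' (mul_le_mul' (two_rpow_mono ?_) le_rfl) le_rfl
  rw [mul_assoc, hbr]
  have : 0 ≤ (h : ℝ) * n * r := by positivity
  linarith

end SubMeanValue

end LocalHardy

namespace LocalHardy

variable {n : ℕ}

/-! ### Averaging bounds and a priori growth for `ψ_j * f`. -/

section DilatedTestFunctions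

theorem norm_iteratedFDeriv_dilateReflect_le (φ : TestFn n) (j : ℤ) (z : Rn n) (i : ℕ) {M : ℝ}
    (hM : ∀ x, ‖iteratedFDeriv ℝ i φ x‖ ≤ M) (y : Rn n) :
    ‖iteratedFDeriv ℝ i (dilateReflect φ j z) y‖ ≤
      (2 : ℝ) ^ (j * (n : ℤ)) * M * ((2 : ℝ) ^ j) ^ i := by
  have hM0 : 0 ≤ M := (norm_nonneg _).trans (hM 0)
  let ℓ : Rn n →L[ℝ] Rn n := (-(2 : ℝ) ^ j) • ContinuousLinearMap.id ℝ (Rn n)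
  let g : Rn n → ℂ := fun v => φ ((2 : ℝ) ^ j • z + v)
  have hg : ContDiff ℝ i g := (φ.contDiff_nat i).comp (contDiff_const.add contDiff_id)
  have hfun : ⇑(dilateReflect φ j z) = ((2 : ℝ) ^ (j * (n : ℤ))) • (g ∘ ℓ) := by
    funext v
    change ((2 : ℝ) ^ (j * (n : ℤ))) • φ ((2 : ℝ) ^ j • (z - v)) =
      ((2 : ℝ) ^ (j * (n : ℤ))) • φ ((2 : ℝ) ^ j • z + (-(2 : ℝ) ^ j) • v)
    rw [smul_sub, neg_smul, sub_eq_add_neg]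
  have hℓ : ‖ℓ‖ ≤ (2 : ℝ) ^ j := by
    refine (ℓ.opNorm_le_bound (by positivity) fun v => ?_)
    simp [ℓ, norm_smul]
  rw [hfun, iteratedFDeriv_const_smul_apply (hg.comp ℓ.contDiff).contDiffAt, norm_smul,
    Real.norm_of_nonneg (by positivity), mul_assoc, ℓ.iteratedFDeriv_comp_right hg y le_rfl]
  gcongr
  refine (ContinuousMultilinearMap.norm_compContinuousLinearMap_le _ _).trans ?_
  rw [Finset.prod_const, Finset.card_univ, Fintype.card_fin]
  gcongr
  rw [iteratedFDeriv_comp_add_left]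
  exact hM _

theorem dilateReflect_eq_zero {φ : TestFn n} {δ : ℝ} (hδ : ∀ y, δ < ‖y‖ → φ y = 0) (j : ℤ)
    (z y : Rn n) (hy : δ * (2 : ℝ) ^ (-j) < dist y z) : dilateReflect φ j z y = 0 := by
  rw [dilateReflect_apply, hδ, smul_zero]
  rw [norm_smul, norm_zpow, Real.norm_ofNat, ← dist_eq_norm, dist_comm]
  rw [zpow_neg, ← div_eq_mul_inv, div_lt_iff₀ (by positivity)] at hy
  linarith

theorem ofReal_one_half_pow (i L : ℕ) :
    ENNReal.ofReal ((1 / 2) ^ (i * L)) = 2 ^ (-(i * L : ℝ)) := by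
  rw [← ofReal_two_rpow, Real.rpow_neg zero_le_two, one_div, inv_pow]
  congr 2
  rw [← Real.rpow_natCast]
  push_cast
  rfl

/-- Bound for `φ_l * f` in terms of finer scales, uniformly over test functions `φ` supported in a
fixed ball and with bounded derivatives of order `L`. -/
theorem exists_conv_bound {ψ : TestFn n} (hψ : (∫ x, ψ x) ≠ 0) {L : ℕ} (hL : 0 < L) :
    ∃ (C : ℝ) (h₀ : ℕ), 0 < C ∧ ∀ (j : ℤ) (h : ℕ), h₀ ≤ h → ∀ (φ : TestFn n) (δ M : ℝ),
      (∀ y, δ < ‖y‖ → φ y = 0) → (∀ x, ‖φ x‖ ≤ M) → (∀ x, ‖iteratedFDeriv ℝ L φ x‖ ≤ M) →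
      ∀ (f : Distr n) (z : Rn n),
      ‖conv φ j f z‖ₑ ≤ ENNReal.ofReal (C * M) * 2 ^ (j * n : ℝ) *
        ∑' i : ℕ, 2 ^ (-(i * L : ℝ)) *
        ∫⁻ w in closedBall z ((δ + 1) * (2 : ℝ) ^ (-j)), ‖conv ψ (j + h + i) f w‖ₑ := by
  obtain ⟨C, h₀, hC, hmain⟩ := exists_decomposition_bound hψ hL
  refine ⟨C, h₀, hC, fun j h hh φ δ M hδ hM hML f z => ?_⟩
  have hM0 : 0 ≤ M := (norm_nonneg _).trans (hM 0)
  have h1 := hmain j h hh (dilateReflect φ j z) z (δ * (2 : ℝ) ^ (-j))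
    ((2 : ℝ) ^ (j * (n : ℤ)) * M) (dilateReflect_eq_zero hδ j z)
    (fun y => by
      have := norm_iteratedFDeriv_dilateReflect_le φ j z 0 (M := M) (by simpa using hM) y
      simpa using this)
    (norm_iteratedFDeriv_dilateReflect_le φ j z L hML) f
  refine h1.trans (le_of_eq ?_)
  rw [mul_left_comm, mul_comm ((2 : ℝ) ^ (j * (n : ℤ))), ENNReal.ofReal_mul (by positivity),
    ofReal_two_zpow, add_mul, one_mul]
  simp only [ofReal_one_half_pow]
  push_cast
  rfl

/-- Using `ψ` itself as the test function makes the estimate self-referential, which absorption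
requires. The constants depend on `ψ` and `L` but not on `f`. -/
theorem exists_avgBound {ψ : TestFn n} (hψ : (∫ x, ψ x) ≠ 0) :
    ∃ (c : ℝ) (H : ℕ → ℕ) (C : ℕ → ℝ≥0∞), 0 ≤ c ∧ (∀ L, C L ≠ ⊤) ∧
      ∀ (f : Distr n) (L : ℕ), 0 < L →
        AvgBound (fun j w => ‖conv ψ j f w‖ₑ) c L (H L) (C L) := by
  obtain ⟨δ, hδ0, hδ⟩ := ψ.exists_radius
  have key : ∀ L : ℕ, ∃ (h₀ : ℕ) (C : ℝ≥0∞), C ≠ ⊤ ∧ ∀ f : Distr n, 0 < L →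
      AvgBound (fun j w => ‖conv ψ j f w‖ₑ) (δ + 1) L h₀ C := by
    intro L
    rcases Nat.eq_zero_or_pos L with h0 | hL
    · exact ⟨0, 0, ENNReal.zero_ne_top, fun f h => absurd h (by omega)⟩
    obtain ⟨C, h₀, hC, h⟩ := exists_conv_bound hψ hL
    obtain ⟨M₀, hM₀, h1⟩ := ψ.exists_bound 0
    obtain ⟨M₁, hM₁, h2⟩ := ψ.exists_bound L
    refine ⟨h₀, ENNReal.ofReal (C * max M₀ M₁), ENNReal.ofReal_ne_top, fun f _ j h' hh z => ?_⟩
    exact h j h' hh ψ δ (max M₀ M₁) hδ (fun x => by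
      have := h1 x
      rw [norm_iteratedFDeriv_zero] at this
      exact this.trans (le_max_left _ _)) (fun x => (h2 x).trans (le_max_right _ _)) f z
  choose H C hC h using key
  exact ⟨δ + 1, H, C, by positivity, hC, fun f L hL => h L f hL⟩

/-- On a fixed ball `f` has some finite order `m`, so its values on dilates grow at most like
`2^{l(n+m)}`. The order depends on `f`, which is harmless because this growth is used only
qualitatively. -/
theorem locallyPolynomial_conv (ψ : TestFn n) (f : Distr n) :
    LocallyPolynomial (fun j w => ‖conv ψ j f w‖ₑ) := by
  intro j z s
  obtain ⟨δ, hδ0, hδ⟩ := ψ.exists_radius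
  obtain ⟨m, C, hC, hf⟩ := exists_order f (‖z‖ + s + δ * (2 : ℝ) ^ (-j))
  choose a ha0 ha using ψ.exists_bound
  set A := ∑ i ∈ Finset.range (m + 1), a i
  have hAi : ∀ i ≤ m, a i ≤ A := fun i hi =>
    Finset.single_le_sum (f := a) (fun j _ => (ha0 j).le) (Finset.mem_range.2 (Nat.lt_succ_of_le hi))
  set J : ℝ := max 1 ((2 : ℝ) ^ j)
  have hJ1 : 1 ≤ J := le_max_left _ _
  have hA0 : 0 ≤ A := (ha0 0).le.trans (hAi 0 (Nat.zero_le _))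
  refine ⟨(n : ℝ) + m, ENNReal.ofReal (C * (J ^ n * A * J ^ m)), ENNReal.ofReal_ne_top,
    fun l w hw => ?_⟩
  have hw' : ‖w‖ ≤ ‖z‖ + s := by
    have := norm_le_norm_add_norm_sub' w z
    rw [mem_closedBall, dist_eq_norm] at hw
    linarith
  have h2l : (2 : ℝ) ^ (j + (l : ℤ)) ≤ J * 2 ^ l := by
    rw [zpow_add₀ two_ne_zero, zpow_natCast]
    gcongr
    exact le_max_right _ _
  have hsupp : ∀ y, ‖z‖ + s + δ * (2 : ℝ) ^ (-j) < ‖y‖ → dilateReflect ψ (j + l) w y = 0 := by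
    intro y hy
    refine dilateReflect_eq_zero hδ _ w y ?_
    have h1 := norm_sub_norm_le y w
    rw [← dist_eq_norm] at h1
    have h2 := mul_le_mul_of_nonneg_left (two_zpow_neg_add_le j l) hδ0.le
    linarith
  have hb := hf _ hsupp (J ^ n * A * J ^ m * (2 ^ l) ^ (n + m)) (fun i hi x => by
    refine (norm_iteratedFDeriv_dilateReflect_le ψ (j + l) w i (ha i) x).trans ?_
    have hJl : 1 ≤ J * 2 ^ l := one_le_mul_of_one_le_of_one_le hJ1 (one_le_pow₀ one_le_two)
    rw [zpow_mul, zpow_natCast]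
    calc ((2 : ℝ) ^ (j + (l : ℤ))) ^ n * a i * ((2 : ℝ) ^ (j + (l : ℤ))) ^ i
        ≤ (J * 2 ^ l) ^ n * A * (J * 2 ^ l) ^ i := by
          gcongr
          · exact (ha0 i).le
          · exact hAi i hi
      _ ≤ (J * 2 ^ l) ^ n * A * (J * 2 ^ l) ^ m := by gcongr
      _ = _ := by rw [mul_pow, mul_pow, pow_add]; ring)
  have h3 : (2 : ℝ≥0∞) ^ (l * ((n : ℝ) + m)) = ENNReal.ofReal ((2 ^ l) ^ (n + m)) := by
    rw [← ofReal_two_rpow]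
    congr 1
    rw [← pow_mul, ← Real.rpow_natCast]
    push_cast
    rfl
  rw [h3, ← ENNReal.ofReal_mul (by positivity)]
  change ‖conv ψ (j + l) f w‖ₑ ≤ _
  rw [← ofReal_norm]
  refine ENNReal.ofReal_le_ofReal (hb.trans (le_of_eq ?_))
  ring

end DilatedTestFunctions

/-! ### The centred maximal function and elementary bounds. -/

section PointwisePeetre

/-- The centred variant of the maximal function `M_{V,θ}`. -/
noncomputable def centMax (ρ : Rn n → ℝ) (θ : ℝ) (g : Rn n → ℝ≥0∞) (x : Rn n) : ℝ≥0∞ :=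
  ⨆ (t : ℝ) (_ : 0 < t), psiMean ρ θ g x t

theorem two_zpow_neg_lt_iff {ρ : Rn n → ℝ} {x : Rn n} (hx : 0 < ρ x) (l : ℤ) :
    (2 : ℝ) ^ (-l) < ρ x ↔ critScale ρ x ≤ l := by
  have h1 := Int.zpow_lt_iff_lt_clog (b := 2) one_lt_two (x := -l) hx
  push_cast at h1
  rw [h1, critScale]
  omega

theorem setLIntegral_le_centMax {ρ : Rn n → ℝ} (hρ : ∀ x, 0 < ρ x) (θ : ℝ)
    (g : Rn n → ℝ≥0∞) (x : Rn n) {t : ℝ} (ht : 0 < t) :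
    ∫⁻ w in ball x t, g w ≤
      centMax ρ θ g x * (ENNReal.ofReal (Psi ρ θ x t) * volume (ball x t)) := by
  have hpos : 0 < Psi ρ θ x t := Real.rpow_pos_of_pos (by have := hρ x; positivity) _
  have h1 : psiMean ρ θ g x t ≤ centMax ρ θ g x := le_iSup₂_of_le t ht le_rfl
  rw [psiMean] at h1
  refine (ENNReal.div_le_iff_le_mul (Or.inl ?_) (Or.inl ?_)).1 h1
  · exact mul_ne_zero (ENNReal.ofReal_pos.2 hpos).ne' (measure_ball_pos _ _ ht).ne'
  · exact ENNReal.mul_ne_top ENNReal.ofReal_ne_top measure_ball_lt_top.ne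

/-- Powers are dominated by exponentials. -/
theorem exists_one_add_rpow_le {q β : ℝ} (hq : 0 < q) (hβ : 0 < β) :
    ∃ C : ℝ, 0 < C ∧ ∀ s : ℝ, 0 ≤ s → (1 + s) ^ q ≤ C * (2 : ℝ) ^ (β * s) := by
  set γ : ℝ := β * Real.log 2 / q
  have hγ : 0 < γ := by have := Real.log_pos one_lt_two; positivity
  set μ : ℝ := min 1 γ
  have hμ : 0 < μ := lt_min one_pos hγ
  refine ⟨(μ⁻¹) ^ q, by positivity, fun s hs => ?_⟩
  have h1 : 1 + s ≤ μ⁻¹ * Real.exp (γ * s) := by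
    rw [inv_mul_eq_div, le_div_iff₀ hμ]
    have h2 := Real.add_one_le_exp (γ * s)
    have h3 : (1 + s) * μ ≤ 1 + γ * s := by
      have h4 : μ ≤ 1 := min_le_left _ _
      have h5 : s * μ ≤ s * γ := by gcongr; exact min_le_right _ _
      linarith
    linarith
  refine (Real.rpow_le_rpow (by positivity) h1 hq.le).trans (le_of_eq ?_)
  rw [Real.mul_rpow (by positivity) (by positivity), ← Real.exp_mul,
    Real.rpow_def_of_pos two_pos]
  congr 2
  simp only [γ]
  field_simp

end PointwisePeetre

end LocalHardy

namespace LocalHardy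

variable {n : ℕ}

/-! ### Pointwise control of the Peetre maximal function. -/

section PointwiseMaximal

theorem psi_le {ρ : Rn n → ℝ} (hρ : ∀ x, 0 < ρ x) {θ : ℝ} (hθ : 0 ≤ θ) (x : Rn n) {t b : ℝ}
    (ht : 0 ≤ t) (hb : 1 + t / ρ x ≤ b) : Psi ρ θ x t ≤ b ^ θ := by
  have := hρ x
  exact Real.rpow_le_rpow (by positivity) hb hθ

/-- Pointwise bound of `(ψ₀)_j * f` at distance `|y|` from `x` by the centred maximal function of
`ψ₀⁺(f)^r` at `x`. -/
theorem exists_conv_rpow_le {ρ : Rn n → ℝ} (hρ : IsCriticalRadius ρ) {ψ : TestFn n}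
    (hψ : (∫ x, ψ x) ≠ 0) {r : ℝ} (hr : 0 < r) (hr1 : r ≤ 1) {θ : ℝ} (hθ : 0 ≤ θ) :
    ∃ (C q : ℝ), 0 < C ∧ 0 < q ∧ ∀ (f : Distr n) (x y : Rn n) (j : ℤ), critScale ρ x ≤ j →
      ‖conv ψ j f (x - y)‖ₑ ^ r ≤
        ENNReal.ofReal (C * (1 + ‖y‖ / ρ x) ^ q * (1 + (2 : ℝ) ^ j * ‖y‖) ^ n) *
        centMax ρ θ (fun w => vertMax ρ ψ f w ^ r) x := by
  obtain ⟨c, H, C, hc, hC, havg⟩ := exists_avgBound hψ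
  obtain ⟨C', hC', hsub⟩ := exists_sub_mean_value_shift n hc H C hC hr hr1
  obtain ⟨C₀, k₀, hC₀, hk₀, hcomp⟩ := hρ.comparable
  have hρ0 := hρ.pos
  set v : ℝ := (volume (ball (0 : Rn n) 1)).toReal with hv
  have hk0 : 0 ≤ k₀ := zero_le_one.trans hk₀
  have hC0pos : 0 < C₀ := one_pos.trans_le hC₀
  -- With `u = 1 + ‖y‖ / ρ x`, the product `D * u` dominates both `1 + ‖x - w‖ / ρ x` on the
  -- averaging ball and `1 + t / ρ x` for the enclosing ball centred at `x`.
  set D : ℝ := 2 + 5 * c with hD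
  have hDpos : 1 ≤ D := by rw [hD]; linarith
  refine ⟨(C'.toReal * (2 * C₀ * D ^ k₀) ^ n * D ^ θ * D ^ n * v) + 1, k₀ * n + θ + 1,
    by positivity, by positivity, ?_⟩
  intro f x y j hj
  have hρx := hρ0 x
  have h2j : (2 : ℝ) ^ (-j) < ρ x := (two_zpow_neg_lt_iff hρx j).2 hj
  have h2jp : (0 : ℝ) < (2 : ℝ) ^ (-j) := by positivity
  set u : ℝ := 1 + ‖y‖ / ρ x with hu
  have hu1 : 1 ≤ u := by rw [hu]; have : 0 ≤ ‖y‖ / ρ x := by positivity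
                         linarith
  set X : ℝ := C₀ * (D * u) ^ k₀ with hX
  have hDu : 1 ≤ D * u := one_le_mul_of_one_le_of_one_le hDpos hu1
  have hX1 : 1 ≤ X := one_le_mul_of_one_le_of_one_le hC₀ (Real.one_le_rpow hDu hk0)
  -- With `h = h' + 1` one has `X < 2^h ≤ 2 X`. Slow variation gives `ρ w ≥ ρ x / X` on the
  -- averaging ball, so `h` extra dyadic steps go below `ρ w`, at a price polynomial in `u`.
  obtain ⟨h', hh1, hh2⟩ := exists_nat_pow_near hX1 one_lt_two
  set h := h' + 1 with hh
  have hhX : (2 : ℝ) ^ h ≤ 2 * X := by rw [hh, pow_succ]; linarith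
  set V : Rn n → ℝ≥0∞ := fun w => vertMax ρ ψ f w ^ r with hV
  -- the vertical maximal function sees all scales finer than `2^{-j-h}` near `x - y`
  have hscale : ∀ w ∈ closedBall (x - y) (5 * c * (2 : ℝ) ^ (-j)), critScale ρ w ≤ j + h := by
    intro w hw
    rw [← two_zpow_neg_lt_iff (hρ0 w)]
    rw [mem_closedBall, dist_eq_norm] at hw
    have hxw : ‖x - w‖ ≤ ‖y‖ + 5 * c * ρ x := by
      have h1 : x - w = y - (w - (x - y)) := by abel
      rw [h1]
      refine (norm_sub_le _ _).trans (add_le_add le_rfl (hw.trans ?_))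
      gcongr
    have h2 : 1 + ‖x - w‖ / ρ x ≤ D * u := by
      have h3 : ‖x - w‖ / ρ x ≤ ‖y‖ / ρ x + 5 * c := by
        rw [div_le_iff₀ hρx, add_mul, div_mul_cancel₀ _ hρx.ne']
        exact hxw
      have h4 : 0 ≤ 5 * c * (‖y‖ / ρ x) := by positivity
      have h5 : 0 ≤ ‖y‖ / ρ x := by positivity
      rw [hD, hu]
      linarith
    have h6 := (hcomp x w).1
    have h7 : C₀⁻¹ * ρ x * (D * u) ^ (-k₀) ≤ ρ w := by
      refine le_trans ?_ h6
      refine mul_le_mul_of_nonneg_left ?_ (by positivity)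
      exact Real.rpow_le_rpow_of_nonpos (by positivity) h2 (by linarith)
    have h8 : C₀⁻¹ * ρ x * (D * u) ^ (-k₀) = ρ x * X⁻¹ := by
      rw [Real.rpow_neg (by positivity), hX, mul_inv]; ring
    rw [h8] at h7
    have hXpos : 0 < X := by positivity
    calc (2 : ℝ) ^ (-(j + (h : ℤ))) = (2 : ℝ) ^ (-j) * ((2 : ℝ) ^ h)⁻¹ := by
          rw [neg_add, zpow_add₀ two_ne_zero, zpow_neg _ (h : ℤ), zpow_natCast]
      _ ≤ (2 : ℝ) ^ (-j) * X⁻¹ := by gcongr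
      _ < ρ x * X⁻¹ := by gcongr
      _ ≤ ρ w := h7
  have hmain := hsub (fun j w => ‖conv ψ j f w‖ₑ) (havg f) (locallyPolynomial_conv ψ f) j h (x - y)
    V (fun l hl w hw => by
      refine ENNReal.rpow_le_rpow ?_ hr.le
      rw [← ofReal_norm]
      exact le_iSup₂_of_le (j + l) ((hscale w hw).trans (by omega)) le_rfl)
  refine hmain.trans ?_
  set t : ℝ := ‖y‖ + (5 * c + 1) * (2 : ℝ) ^ (-j) with ht
  have ht0 : 0 < t := by positivity
  have hballsub : closedBall (x - y) (5 * c * (2 : ℝ) ^ (-j)) ⊆ ball x t := by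
    refine (closedBall_subset_ball (ε₂ := t - ‖y‖) (by rw [ht]; linarith)).trans
      (ball_subset_ball' ?_)
    rw [dist_eq_norm, sub_sub_cancel_left, norm_neg, sub_add_cancel]
  have hvol : volume (ball x t) = ENNReal.ofReal (t ^ n * v) := by
    rw [Measure.addHaar_ball_of_pos volume x ht0, finrank_euclideanSpace_fin,
      ENNReal.ofReal_mul (by positivity), hv, ENNReal.ofReal_toReal measure_ball_lt_top.ne]
  have hPsi : Psi ρ θ x t ≤ (D * u) ^ θ := by
    refine psi_le hρ0 hθ x ht0.le ?_
    have h3 : t / ρ x ≤ ‖y‖ / ρ x + (5 * c + 1) := by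
      rw [div_le_iff₀ hρx, add_mul, div_mul_cancel₀ _ hρx.ne', ht]
      gcongr
    have h4 : 0 ≤ (5 * c + 1) * (‖y‖ / ρ x) := by positivity
    rw [hD, hu]
    linarith
  have hint : ∫⁻ w in closedBall (x - y) (5 * c * (2 : ℝ) ^ (-j)), V w ≤
      centMax ρ θ V x * (ENNReal.ofReal ((D * u) ^ θ) * ENNReal.ofReal (t ^ n * v)) := by
    refine (lintegral_mono_set hballsub).trans ((setLIntegral_le_centMax hρ0 θ V x ht0).trans ?_)
    rw [hvol]
    gcongr
  have hpow : (2 : ℝ≥0∞) ^ (h * n : ℝ) * 2 ^ (j * n : ℝ) =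
      ENNReal.ofReal (((2 : ℝ) ^ h) ^ n * ((2 : ℝ) ^ j) ^ n) := by
    rw [← ofReal_two_rpow, ← ofReal_two_rpow, ← ENNReal.ofReal_mul (by positivity)]
    congr 1
    rw [← Real.rpow_natCast (2 ^ h), ← Real.rpow_natCast 2 h, ← Real.rpow_mul zero_le_two,
      ← Real.rpow_natCast ((2 : ℝ) ^ j), ← Real.rpow_intCast 2 j, ← Real.rpow_mul zero_le_two]
  rw [hpow, ← ENNReal.ofReal_toReal hC']
  refine (mul_le_mul' le_rfl (mul_le_mul' le_rfl hint)).trans ?_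
  rw [mul_comm (centMax ρ θ V x), ← mul_assoc, ← mul_assoc]
  refine mul_le_mul' ?_ le_rfl
  have hv0 : 0 ≤ v := ENNReal.toReal_nonneg
  rw [← ENNReal.ofReal_mul (by positivity), ← ENNReal.ofReal_mul (by positivity),
    ← ENNReal.ofReal_mul (by positivity)]
  refine ENNReal.ofReal_le_ofReal ?_
  have htj : ((2 : ℝ) ^ j) ^ n * t ^ n ≤ D ^ n * (1 + (2 : ℝ) ^ j * ‖y‖) ^ n := by
    rw [← mul_pow, ← mul_pow]
    refine pow_le_pow_left₀ (by positivity) ?_ n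
    have h1 : (2 : ℝ) ^ j * (2 : ℝ) ^ (-j) = 1 := by
      rw [← zpow_add₀ two_ne_zero, add_neg_cancel, zpow_zero]
    have h2 : (2 : ℝ) ^ j * t = (2 : ℝ) ^ j * ‖y‖ + (5 * c + 1) := by
      rw [ht, mul_add, mul_left_comm, h1, mul_one]
    have h3 : 0 ≤ (5 * c + 1) * ((2 : ℝ) ^ j * ‖y‖) := by positivity
    rw [h2, hD]
    linarith
  have hXn : ((2 : ℝ) ^ h) ^ n ≤ (2 * C₀ * D ^ k₀) ^ n * u ^ (k₀ * n) := by
    rw [Real.rpow_mul (by positivity), Real.rpow_natCast, ← mul_pow]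
    gcongr
    refine hhX.trans (le_of_eq ?_)
    rw [hX, Real.mul_rpow (by positivity) (by positivity)]
    ring
  have hDuθ : (D * u) ^ θ = D ^ θ * u ^ θ := Real.mul_rpow (by positivity) (by positivity)
  set P := (1 + (2 : ℝ) ^ j * ‖y‖) ^ n
  have hP : 0 ≤ P := by positivity
  have huq : u ^ (k₀ * n) * u ^ θ ≤ u ^ (k₀ * n + θ + 1) := by
    rw [← Real.rpow_add (by positivity)]
    exact Real.rpow_le_rpow_of_exponent_le hu1 (by linarith)
  calc C'.toReal * (((2 : ℝ) ^ h) ^ n * ((2 : ℝ) ^ j) ^ n) * ((D * u) ^ θ * (t ^ n * v))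
      = C'.toReal * ((2 : ℝ) ^ h) ^ n * (((2 : ℝ) ^ j) ^ n * t ^ n) * ((D * u) ^ θ * v) := by ring
    _ ≤ C'.toReal * ((2 * C₀ * D ^ k₀) ^ n * u ^ (k₀ * n)) * (D ^ n * P) *
        ((D ^ θ * u ^ θ) * v) := by
        rw [hDuθ]
        gcongr
    _ = (C'.toReal * (2 * C₀ * D ^ k₀) ^ n * D ^ θ * D ^ n * v) * (u ^ (k₀ * n) * u ^ θ) * P := by
        ring
    _ ≤ ((C'.toReal * (2 * C₀ * D ^ k₀) ^ n * D ^ θ * D ^ n * v) + 1) *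
        u ^ (k₀ * n + θ + 1) * P := by
        gcongr
        linarith
    _ = _ := by rw [ENNReal.toReal_ofReal ENNReal.toReal_nonneg]

/-- The Peetre maximal function is pointwise dominated by the centred maximal function of the
vertical one. -/
theorem exists_peetreMax_le {ρ : Rn n → ℝ} (hρ : IsCriticalRadius ρ) {ψ : TestFn n}
    (hψ : (∫ x, ψ x) ≠ 0) {r : ℝ} (hr : 0 < r) (hr1 : r ≤ 1) {θ : ℝ} (hθ : 0 ≤ θ) {A B : ℝ}
    (hA : n ≤ A * r) (hB : 0 < B) :
    ∃ C : ℝ≥0∞, C ≠ ⊤ ∧ ∀ (f : Distr n) (x : Rn n),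
      peetreMax ρ ψ A B f x ^ r ≤ C * centMax ρ θ (fun w => vertMax ρ ψ f w ^ r) x := by
  obtain ⟨C, q, hC, hq, hmain⟩ := exists_conv_rpow_le hρ hψ hr hr1 hθ
  -- The polynomial loss in `1 + ‖y‖ / ρ x` disappears into the `r`-th power of the exponential
  -- weight; hence any `B > 0` suffices, whatever `q` is.
  obtain ⟨C₁, hC₁, hexp⟩ := exists_one_add_rpow_le hq (mul_pos hB hr)
  refine ⟨ENNReal.ofReal (C * C₁), ENNReal.ofReal_ne_top, fun f x => ?_⟩
  have hρx := hρ.pos x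
  set m := centMax ρ θ (fun w => vertMax ρ ψ f w ^ r) x
  have hle : peetreMax ρ ψ A B f x ≤ (ENNReal.ofReal (C * C₁) * m) ^ (1 / r) := by
    refine iSup_le fun j => iSup_le fun hj => iSup_le fun y => ?_
    rw [← ENNReal.rpow_le_rpow_iff hr, ← ENNReal.rpow_mul, one_div_mul_cancel hr.ne',
      ENNReal.rpow_one]
    set W := peetreWeight ρ j A B x y with hW
    have hb : 1 ≤ 1 + (2 : ℝ) ^ j * ‖y‖ := by
      have : 0 ≤ (2 : ℝ) ^ j * ‖y‖ := by positivity
      linarith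
    have hWpos : 0 < W := by rw [hW, peetreWeight]; positivity
    have hWr : (1 + ‖y‖ / ρ x) ^ q * (1 + (2 : ℝ) ^ j * ‖y‖) ^ n ≤ C₁ * W ^ r := by
      have h1 := hexp (‖y‖ / ρ x) (by positivity)
      have h2 : (1 + (2 : ℝ) ^ j * ‖y‖) ^ n ≤ (1 + (2 : ℝ) ^ j * ‖y‖) ^ (A * r) := by
        rw [← Real.rpow_natCast]
        exact Real.rpow_le_rpow_of_exponent_le hb hA
      have h3 : W ^ r = (1 + (2 : ℝ) ^ j * ‖y‖) ^ (A * r) * (2 : ℝ) ^ (B * r * (‖y‖ / ρ x)) := by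
        rw [hW, peetreWeight, Real.mul_rpow (by positivity) (by positivity),
          ← Real.rpow_mul (by positivity), ← Real.rpow_mul zero_le_two]
        congr 2
        ring
      rw [h3]
      calc _ ≤ (C₁ * (2 : ℝ) ^ (B * r * (‖y‖ / ρ x))) * (1 + (2 : ℝ) ^ j * ‖y‖) ^ (A * r) := by
            gcongr
        _ = _ := by ring
    rw [ENNReal.ofReal_div_of_pos hWpos, ENNReal.div_rpow_of_nonneg _ _ hr.le, ofReal_norm,
      ENNReal.ofReal_rpow_of_pos hWpos]
    have hWrpos : 0 < W ^ r := by positivity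
    refine (ENNReal.div_le_iff_le_mul (Or.inl (ENNReal.ofReal_pos.2 hWrpos).ne')
      (Or.inl ENNReal.ofReal_ne_top)).2 ?_
    refine (hmain f x y j hj).trans ?_
    rw [mul_right_comm (ENNReal.ofReal (C * C₁)), ← ENNReal.ofReal_mul (by positivity)]
    refine mul_le_mul' (ENNReal.ofReal_le_ofReal ?_) le_rfl
    rw [mul_assoc, mul_assoc]
    gcongr
  refine (ENNReal.rpow_le_rpow hle hr.le).trans (le_of_eq ?_)
  rw [← ENNReal.rpow_mul, one_div_mul_cancel hr.ne', ENNReal.rpow_one]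

end PointwiseMaximal

end LocalHardy

namespace LocalHardy

variable {n : ℕ}

/-! ### Pointwise control of the grand maximal function; measurability. -/

section GrandMaximal

/-- Expansion in the coordinate basis gives `n ^ m` terms, each bounded by the product of the norms.
-/
theorem norm_multilinear_le_of_single {m : ℕ} (T : ContinuousMultilinearMap ℝ (fun _ : Fin m => Rn n) ℂ)
    (hT : ∀ I : Fin m → Fin n, ‖T (fun k => EuclideanSpace.single (I k) (1 : ℝ))‖ ≤ 1) :
    ‖T‖ ≤ (n : ℝ) ^ m := by
  refine T.opNorm_le_bound (by positivity) fun v => ?_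
  have hv : v = fun k => ∑ i, v k i • EuclideanSpace.single i (1 : ℝ) := by
    funext k
    have := (EuclideanSpace.basisFun (Fin n) ℝ).sum_repr (v k)
    simpa using this.symm
  have h1 : T v = ∑ I : Fin m → Fin n,
      (∏ k, v k (I k)) • T (fun k => EuclideanSpace.single (I k) (1 : ℝ)) := by
    conv_lhs => rw [hv]
    rw [ContinuousMultilinearMap.map_sum]
    exact Finset.sum_congr rfl fun I _ => T.map_smul_univ _ _
  rw [h1]
  refine (norm_sum_le _ _).trans ?_
  have h2 : ∀ I ∈ (Finset.univ : Finset (Fin m → Fin n)),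
      ‖(∏ k, v k (I k)) • T (fun k => EuclideanSpace.single (I k) (1 : ℝ))‖ ≤ ∏ k, ‖v k‖ := by
    intro I _
    rw [norm_smul, norm_prod]
    refine (mul_le_of_le_one_right (Finset.prod_nonneg fun _ _ => norm_nonneg _) (hT I)).trans ?_
    exact Finset.prod_le_prod (fun _ _ => norm_nonneg _)
      fun k _ => PiLp.norm_apply_le (v k) (I k)
  refine (Finset.sum_le_sum h2).trans (le_of_eq ?_)
  simp

theorem enorm_conv_le_peetreMax {ρ : Rn n → ℝ} (ψ : TestFn n) (A B : ℝ) (f : Distr n)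
    {x : Rn n} {k : ℤ} (hk : critScale ρ x ≤ k) (w : Rn n) :
    ‖conv ψ k f w‖ₑ ≤
      ENNReal.ofReal (peetreWeight ρ k A B x (x - w)) * peetreMax ρ ψ A B f x := by
  set W := peetreWeight ρ k A B x (x - w) with hW
  have hWpos : 0 < W := by rw [hW, peetreWeight]; positivity
  have h : ENNReal.ofReal (‖conv ψ k f w‖ / W) ≤ peetreMax ρ ψ A B f x := by
    have h1 : ENNReal.ofReal (‖conv ψ k f (x - (x - w))‖ / W) ≤ peetreMax ρ ψ A B f x :=
      le_iSup₂_of_le k hk (le_iSup_of_le (x - w) le_rfl)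
    rwa [sub_sub_cancel] at h1
  rw [ENNReal.ofReal_div_of_pos hWpos, ofReal_norm] at h
  rw [mul_comm]
  exact (ENNReal.div_le_iff (ENNReal.ofReal_pos.2 hWpos).ne' ENNReal.ofReal_ne_top).1 h

theorem tsum_two_rpow_neg_ne_top {t : ℝ} (ht : 0 < t) :
    ∑' i : ℕ, (2 : ℝ≥0∞) ^ (-(i * t)) ≠ ⊤ := by
  have h : ∀ i : ℕ, (2 : ℝ≥0∞) ^ (-(i * t)) = ((2 : ℝ≥0∞) ^ (-t)) ^ i := by
    intro i
    rw [← ENNReal.rpow_natCast, ← ENNReal.rpow_mul]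
    congr 1
    ring
  simp_rw [h]
  rw [ENNReal.tsum_geometric]
  refine ENNReal.inv_ne_top.2 (tsub_pos_of_lt ?_).ne'
  exact ENNReal.rpow_lt_one_of_one_lt_of_neg ENNReal.one_lt_two (by linarith)

/-- The exponential factor stays bounded because `‖y‖ ≤ S * ρ x`; only the polynomial factor grows
with `i`, like `2^{iA}`. -/
theorem peetreWeight_le {ρ : Rn n → ℝ} {x y : Rn n} (hx : 0 < ρ x) {A B S : ℝ} (hA : 0 ≤ A)
    (hB : 0 ≤ B) (hS : 0 ≤ S) {l : ℤ} (hl : (2 : ℝ) ^ (-l) < ρ x)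
    (hy : ‖y‖ ≤ S * (2 : ℝ) ^ (-l)) (h i : ℕ) :
    peetreWeight ρ (l + h + i) A B x y ≤
      ((1 + 2 ^ h * S) ^ A * (2 : ℝ) ^ (B * S)) * (2 : ℝ) ^ (i * A) := by
  have h2 : (2 : ℝ) ^ (l + h + i) * ‖y‖ ≤ 2 ^ i * (2 ^ h * S) := by
    calc (2 : ℝ) ^ (l + h + i) * ‖y‖ ≤ (2 : ℝ) ^ (l + h + i) * (S * (2 : ℝ) ^ (-l)) := by gcongr
      _ = 2 ^ i * (2 ^ h * S) * ((2 : ℝ) ^ l * (2 : ℝ) ^ (-l)) := by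
        rw [zpow_add₀ two_ne_zero, zpow_add₀ two_ne_zero, zpow_natCast, zpow_natCast]; ring
      _ = _ := by rw [← zpow_add₀ two_ne_zero, add_neg_cancel, zpow_zero, mul_one]
  have h3 : 1 + (2 : ℝ) ^ (l + h + i) * ‖y‖ ≤ 2 ^ i * (1 + 2 ^ h * S) := by
    have : (1 : ℝ) ≤ 2 ^ i := one_le_pow₀ one_le_two
    linarith
  have h4 : B * ‖y‖ / ρ x ≤ B * S := by
    rw [div_le_iff₀ hx, mul_assoc]
    refine mul_le_mul_of_nonneg_left (hy.trans ?_) hB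
    gcongr
  rw [peetreWeight]
  calc _ ≤ (2 ^ i * (1 + 2 ^ h * S)) ^ A * (2 : ℝ) ^ (B * S) := by
        refine mul_le_mul (Real.rpow_le_rpow (by positivity) h3 hA)
          (Real.rpow_le_rpow_of_exponent_le one_le_two h4) (by positivity) (by positivity)
    _ = _ := by
        rw [Real.mul_rpow (by positivity) (by positivity), ← Real.rpow_natCast 2 i,
          ← Real.rpow_mul zero_le_two]
        ring

/-- The grand maximal function is pointwise dominated by the Peetre maximal function. -/
theorem exists_grandMax_le {ρ : Rn n → ℝ} (hρ : ∀ x, 0 < ρ x) {ψ : TestFn n}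
    (hψ : (∫ x, ψ x) ≠ 0) {N : ℕ} {R : ℝ} (hR : 0 < R) {A B : ℝ} (hA : 0 ≤ A) (hAN : A < N)
    (hB : 0 ≤ B) :
    ∃ C : ℝ≥0∞, C ≠ ⊤ ∧ ∀ (f : Distr n) (x : Rn n),
      grandMax ρ N R f x ≤ C * peetreMax ρ ψ A B f x := by
  have hN : 0 < N := by exact_mod_cast hA.trans_lt hAN
  -- `φ` has `N` controlled derivatives, so the decomposition is taken with `L = N`; its decay
  -- `2^{-iN}` beats the growth `2^{iA}` of the Peetre weight.
  obtain ⟨C₀, h₀, hC₀, hconv⟩ := exists_conv_bound hψ hN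
  -- `R + 2` comes from `‖x - w‖ ≤ ‖x - z‖ + ‖z - w‖ ≤ (1 + (R + 1)) 2^{-l}`.
  set K : ℝ := (1 + 2 ^ h₀ * (R + 2)) ^ A * (2 : ℝ) ^ (B * (R + 2)) with hK
  set M : ℝ := (n : ℝ) ^ N + 1 with hM
  set v := volume (ball (0 : Rn n) 1) with hv
  set T : ℝ≥0∞ := ∑' i : ℕ, (2 : ℝ≥0∞) ^ (-(i * (N - A))) with hT
  have hTtop : T ≠ ⊤ := tsum_two_rpow_neg_ne_top (by linarith)
  have hvtop : v ≠ ⊤ := measure_ball_lt_top.ne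
  refine ⟨ENNReal.ofReal (C₀ * M) * ENNReal.ofReal K * ENNReal.ofReal ((R + 2) ^ n) * v * T,
    by finiteness, fun f x => ?_⟩
  set S := peetreMax ρ ψ A B f x
  refine iSup₂_le fun φ hφ => iSup₂_le fun l z => iSup₂_le fun hxz hl => ?_
  have hlc : critScale ρ x ≤ l := (two_zpow_neg_lt_iff (hρ x) l).1 hl
  have h2l : (0 : ℝ) < (2 : ℝ) ^ (-l) := by positivity
  have hsupp : ∀ y, R < ‖y‖ → φ y = 0 := by
    intro y hy
    by_contra h
    have := hφ.1 (subset_tsupport _ (Function.mem_support.2 h))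
    rw [mem_ball_zero_iff] at this
    linarith
  have hb0 : ∀ y, ‖φ y‖ ≤ M := by
    intro y
    have := hφ.2 0 (Nat.zero_le _) Fin.elim0 y
    rw [iteratedFDeriv_zero_apply] at this
    have hn : (0 : ℝ) ≤ (n : ℝ) ^ N := by positivity
    linarith
  have hbN : ∀ y, ‖iteratedFDeriv ℝ N φ y‖ ≤ M := by
    intro y
    refine (norm_multilinear_le_of_single _ fun I => hφ.2 N le_rfl I y).trans ?_
    rw [hM]; linarith
  have hvol : volume (ball z ((R + 2) * (2 : ℝ) ^ (-l))) =
      ENNReal.ofReal ((R + 2) ^ n) * 2 ^ (-(l * n : ℝ)) * v := by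
    rw [Measure.addHaar_ball_of_pos volume z (by positivity), finrank_euclideanSpace_fin, mul_pow,
      ENNReal.ofReal_mul (by positivity), ← ofReal_two_rpow]
    congr 3
    rw [← Real.rpow_natCast, ← Real.rpow_intCast, ← Real.rpow_mul zero_le_two]
    congr 1
    push_cast
    ring
  have hint : ∀ i : ℕ, ∫⁻ w in closedBall z ((R + 1) * (2 : ℝ) ^ (-l)),
      ‖conv ψ (l + h₀ + i) f w‖ₑ ≤ ENNReal.ofReal K * 2 ^ (i * A) * S *
        (ENNReal.ofReal ((R + 2) ^ n) * 2 ^ (-(l * n : ℝ)) * v) := by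
    intro i
    rw [← hvol, ← setLIntegral_const]
    refine (setLIntegral_mono' measurableSet_closedBall (g := fun _ =>
      ENNReal.ofReal K * 2 ^ (i * A) * S) fun w hw => ?_).trans (lintegral_mono_set ?_)
    · refine (enorm_conv_le_peetreMax ψ A B f (x := x) (by omega) w).trans (mul_le_mul' ?_ le_rfl)
      rw [← ofReal_two_rpow, ← ENNReal.ofReal_mul (by positivity)]
      refine ENNReal.ofReal_le_ofReal (peetreWeight_le (hρ x) hA hB (by linarith) hl ?_ h₀ i)
      rw [mem_closedBall, dist_eq_norm, norm_sub_rev] at hw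
      have h1 : x - w = (x - z) + (z - w) := by abel
      rw [h1]
      refine (norm_add_le _ _).trans ?_
      linarith
    · exact closedBall_subset_ball (by gcongr; linarith)
  rw [ofReal_norm]
  refine (hconv l h₀ le_rfl φ R M hsupp hb0 hbN f z).trans ?_
  refine (mul_le_mul' le_rfl (ENNReal.tsum_le_tsum fun i => mul_le_mul' le_rfl (hint i))).trans
    (le_of_eq ?_)
  have hterm : ∀ i : ℕ, (2 : ℝ≥0∞) ^ (-(i * N : ℝ)) * (ENNReal.ofReal K * 2 ^ (i * A) * S *
        (ENNReal.ofReal ((R + 2) ^ n) * 2 ^ (-(l * n : ℝ)) * v)) =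
      2 ^ (-(i * (N - A))) * (ENNReal.ofReal K * S *
        (ENNReal.ofReal ((R + 2) ^ n) * 2 ^ (-(l * n : ℝ)) * v)) := by
    intro i
    have : (2 : ℝ≥0∞) ^ (-(i * (N - A))) = 2 ^ (-(i * N : ℝ)) * 2 ^ (i * A) := by
      rw [← two_rpow_add]; congr 1; ring
    rw [this]; ring
  simp_rw [hterm]
  rw [ENNReal.tsum_mul_right, ← hT]
  have hcancel : (2 : ℝ≥0∞) ^ (l * n : ℝ) * 2 ^ (-(l * n : ℝ)) = 1 := by
    rw [← two_rpow_add, add_neg_cancel, ENNReal.rpow_zero]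
  calc _ = (ENNReal.ofReal (C₀ * M) * ENNReal.ofReal K * ENNReal.ofReal ((R + 2) ^ n) * v * T) * S *
        ((2 : ℝ≥0∞) ^ (l * n : ℝ) * 2 ^ (-(l * n : ℝ))) := by ring
    _ = _ := by rw [hcancel, mul_one]

/-- The vertical maximal function is Borel measurable. -/
theorem measurable_vertMax {ρ : Rn n → ℝ} (hρ : IsCriticalRadius ρ) (ψ : TestFn n)
    (f : Distr n) : Measurable (vertMax ρ ψ f) := by
  refine Measurable.iSup fun j => ?_
  have hset : MeasurableSet {x | critScale ρ x ≤ j} := by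
    have : {x | critScale ρ x ≤ j} = {x | (2 : ℝ) ^ (-j) < ρ x} := by
      ext x; exact (two_zpow_neg_lt_iff (hρ.pos x) j).symm
    rw [this]
    exact (isOpen_lt continuous_const hρ.continuous).measurableSet
  have hm : Measurable fun x => ENNReal.ofReal ‖conv ψ j f x‖ :=
    (continuous_conv ψ j f).norm.measurable.ennreal_ofReal
  have : (fun x => ⨆ _ : critScale ρ x ≤ j, ENNReal.ofReal ‖conv ψ j f x‖) =
      {x | critScale ρ x ≤ j}.indicator fun x => ENNReal.ofReal ‖conv ψ j f x‖ := by
    funext x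
    by_cases h : critScale ρ x ≤ j <;> simp [h]
  rw [this]
  exact hm.indicator hset

end GrandMaximal

end LocalHardy

namespace LocalHardy

variable {n : ℕ}

/-! ### Averages and doubling for the weight classes. -/

section WeightedMaximal

theorem Psi_pos {ρ : Rn n → ℝ} (hρ : ∀ x, 0 < ρ x) (θ : ℝ) (c : Rn n) {t : ℝ} (ht : 0 < t) :
    0 < Psi ρ θ c t := by
  have := hρ c
  unfold Psi
  positivity

theorem one_le_Psi {ρ : Rn n → ℝ} (hρ : ∀ x, 0 < ρ x) {θ : ℝ} (hθ : 0 ≤ θ) (c : Rn n) {t : ℝ}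
    (ht : 0 < t) : 1 ≤ Psi ρ θ c t := by
  have := div_pos ht (hρ c)
  exact Real.one_le_rpow (by linarith) hθ

/-- Hölder for the product of `g w^{1/q}` and `w^{-1/q}`; the conjugate exponent produces the dual
weight `w^{-1/(q-1)}`. -/
theorem setLIntegral_holder {w : Rn n → ℝ} (hw : AEMeasurable w) (hpos : ∀ᵐ x, 0 < w x) {q : ℝ}
    (hq : 1 < q) (s : Set (Rn n)) {g : Rn n → ℝ≥0∞} (hg : AEMeasurable g) :
    (∫⁻ y in s, g y) ^ q ≤ (∫⁻ y in s, g y ^ q * ENNReal.ofReal (w y)) *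
      (∫⁻ y in s, ENNReal.ofReal (w y ^ (-1 / (q - 1)))) ^ (q - 1) := by
  have hq0 : 0 < q := by linarith
  have hq1 : 0 < q - 1 := by linarith
  have hpos' := ae_restrict_of_ae (s := s) hpos
  have hconj : q.HolderConjugate (q / (q - 1)) := Real.HolderConjugate.conjExponent hq
  have hW : AEMeasurable (fun y => ENNReal.ofReal (w y)) (volume.restrict s) :=
    hw.restrict.ennreal_ofReal
  have h := ENNReal.lintegral_mul_le_Lp_mul_Lq (volume.restrict s) hconj
    (f := fun y => g y * ENNReal.ofReal (w y) ^ (1 / q))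
    (g := fun y => ENNReal.ofReal (w y) ^ (-(1 / q)))
    (hg.restrict.mul (hW.pow_const _)) (hW.pow_const _)
  have h1 : ∫⁻ y in s, g y = ∫⁻ y in s, ((fun y => g y * ENNReal.ofReal (w y) ^ (1 / q)) *
      fun y => ENNReal.ofReal (w y) ^ (-(1 / q))) y := by
    refine lintegral_congr_ae ?_
    filter_upwards [hpos'] with y hy
    have h0 := (ENNReal.ofReal_pos.2 hy).ne'
    rw [Pi.mul_apply, mul_assoc, ← ENNReal.rpow_add _ _ h0 ENNReal.ofReal_ne_top, add_neg_cancel,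
      ENNReal.rpow_zero, mul_one]
  have h2 : ∫⁻ y in s, (g y * ENNReal.ofReal (w y) ^ (1 / q)) ^ q =
      ∫⁻ y in s, g y ^ q * ENNReal.ofReal (w y) := by
    refine lintegral_congr fun y => ?_
    rw [ENNReal.mul_rpow_of_nonneg _ _ hq0.le, ← ENNReal.rpow_mul, one_div_mul_cancel hq0.ne',
      ENNReal.rpow_one]
  have h3 : ∫⁻ y in s, (ENNReal.ofReal (w y) ^ (-(1 / q))) ^ (q / (q - 1)) =
      ∫⁻ y in s, ENNReal.ofReal (w y ^ (-1 / (q - 1))) := by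
    refine lintegral_congr_ae ?_
    filter_upwards [hpos'] with y hy
    rw [← ENNReal.rpow_mul, ENNReal.ofReal_rpow_of_pos hy]
    congr 2
    field_simp
  rw [h2, h3, ← h1] at h
  refine (ENNReal.rpow_le_rpow h hq0.le).trans (le_of_eq ?_)
  rw [ENNReal.mul_rpow_of_nonneg _ _ hq0.le, ← ENNReal.rpow_mul, ← ENNReal.rpow_mul,
    one_div_mul_cancel hq0.ne', ENNReal.rpow_one]
  congr 2
  field_simp

/-- Averages of `g` over balls are controlled by weighted averages of `g ^ q`, for `ω` in the
class `A_q^{ρ,θ}`. -/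
theorem MemAp.exists_average_bound {ρ : Rn n → ℝ} (hρ : ∀ x, 0 < ρ x) {q θ : ℝ}
    {ω : Rn n → ℝ} (h : MemAp ρ q θ ω) :
    ∃ C : ℝ≥0∞, C ≠ ⊤ ∧ ∀ (c : Rn n) (t : ℝ), 0 < t → ∀ g : Rn n → ℝ≥0∞, AEMeasurable g →
      (∫⁻ y in ball c t, g y) ^ q * ∫⁻ y in ball c t, ENNReal.ofReal (ω y) ≤
        C * (ENNReal.ofReal (Psi ρ θ c t) * volume (ball c t)) ^ q *
          ∫⁻ y in ball c t, g y ^ q * ENNReal.ofReal (ω y) := by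
  obtain ⟨hω, ⟨rfl, C, hC⟩ | ⟨hq, C, hC⟩⟩ := h
  · refine ⟨C, ENNReal.coe_ne_top, fun c t ht g hg => ?_⟩
    set d := ENNReal.ofReal (Psi ρ θ c t) * volume (ball c t) with hd
    have hd0 : d ≠ 0 := mul_ne_zero (ENNReal.ofReal_pos.2 (Psi_pos hρ θ c ht)).ne'
      (measure_ball_pos volume c ht).ne'
    have hdtop : d ≠ ⊤ := ENNReal.mul_ne_top ENNReal.ofReal_ne_top measure_ball_lt_top.ne
    simp only [ENNReal.rpow_one]
    rw [← lintegral_mul_const'' _ hg.restrict,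
      ← lintegral_const_mul' _ _ (ENNReal.mul_ne_top ENNReal.coe_ne_top hdtop)]
    -- For `q = 1` the mean of `ω` over the ball is at most `C ω(y)` for almost every `y` in it;
    -- this is multiplied by `g y` and integrated.
    refine lintegral_mono_ae ?_
    filter_upwards [ae_restrict_of_ae hC, ae_restrict_mem measurableSet_ball] with y hy hyB
    have h1 : psiMean ρ θ (fun y => ENNReal.ofReal |ω y|) c t ≤ C * ENNReal.ofReal (ω y) :=
      by
      refine le_trans ?_ hy
      refine le_iSup₂_of_le c t ?_
      rw [iSup_pos ht, iSup_pos hyB]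
    rw [psiMean, ← hd, ENNReal.div_le_iff hd0 hdtop] at h1
    have h2 : ∫⁻ y in ball c t, ENNReal.ofReal (ω y) ≤ ∫⁻ y in ball c t, ENNReal.ofReal |ω y| :=
      lintegral_mono fun y => ENNReal.ofReal_le_ofReal (le_abs_self _)
    calc _ ≤ g y * (C * ENNReal.ofReal (ω y) * d) := mul_le_mul' le_rfl (h2.trans h1)
      _ = _ := by ring
  · refine ⟨C, ENNReal.coe_ne_top, fun c t ht g hg => ?_⟩
    set d := ENNReal.ofReal (Psi ρ θ c t) * volume (ball c t) with hd
    have hd0 : d ≠ 0 := mul_ne_zero (ENNReal.ofReal_pos.2 (Psi_pos hρ θ c ht)).ne'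
      (measure_ball_pos volume c ht).ne'
    have hdtop : d ≠ ⊤ := ENNReal.mul_ne_top ENNReal.ofReal_ne_top measure_ball_lt_top.ne
    have h1 := hC c t ht
    have hq1 : 0 < q - 1 := by linarith
    set w := ∫⁻ y in ball c t, ENNReal.ofReal (ω y)
    set σ := ∫⁻ y in ball c t, ENNReal.ofReal (ω y ^ (-1 / (q - 1)))
    have hdq0 : d ^ q ≠ 0 := (ENNReal.rpow_pos (pos_iff_ne_zero.2 hd0) hdtop).ne'
    have hdqtop : d ^ q ≠ ⊤ := ENNReal.rpow_ne_top_of_nonneg (by linarith) hdtop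
    have h2 : psiMean ρ θ (fun y => ENNReal.ofReal (ω y)) c t *
      psiMean ρ θ (fun y => ENNReal.ofReal (ω y ^ (-1 / (q - 1)))) c t ^ (q - 1) =
        w * σ ^ (q - 1) / d ^ q := by
      change w / d * (σ / d) ^ (q - 1) = _
      have : d ^ q = d * d ^ (q - 1) := by
        conv_lhs => rw [show q = 1 + (q - 1) by ring]
        rw [ENNReal.rpow_add _ _ hd0 hdtop, ENNReal.rpow_one]
      rw [ENNReal.div_rpow_of_nonneg _ _ hq1.le, this, div_eq_mul_inv, div_eq_mul_inv,
        div_eq_mul_inv, ENNReal.mul_inv (Or.inl hd0) (Or.inl hdtop)]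
      ring
    rw [h2, ENNReal.div_le_iff hdq0 hdqtop] at h1
    have h3 := setLIntegral_holder hω.locallyIntegrable.aestronglyMeasurable.aemeasurable hω.pos hq
      (ball c t) hg
    calc _ ≤ _ := mul_le_mul' h3 le_rfl
      _ = (∫⁻ y in ball c t, g y ^ q * ENNReal.ofReal (ω y)) * (w * σ ^ (q - 1)) := by ring
      _ ≤ (∫⁻ y in ball c t, g y ^ q * ENNReal.ofReal (ω y)) * (C * d ^ q) := by gcongr
      _ = _ := by ring

theorem Psi_mul_le {ρ : Rn n → ℝ} (hρ : ∀ x, 0 < ρ x) {θ : ℝ} (hθ : 0 ≤ θ) (c : Rn n) {t k : ℝ}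
    (ht : 0 < t) (hk : 1 ≤ k) : Psi ρ θ c (k * t) ≤ k ^ θ * Psi ρ θ c t := by
  have := hρ c
  unfold Psi
  rw [← Real.mul_rpow (by linarith) (by positivity)]
  refine Real.rpow_le_rpow (by positivity) ?_ hθ
  rw [mul_add, mul_div_assoc, mul_one]
  linarith

/-- The doubling property of weights in `A_q^{ρ,θ}`. -/
theorem MemAp.exists_doubling {ρ : Rn n → ℝ} (hρ : ∀ x, 0 < ρ x) {q θ : ℝ} (hq : 0 < q)
    (hθ : 0 ≤ θ) {ω : Rn n → ℝ} (h : MemAp ρ q θ ω) {k : ℝ} (hk : 1 ≤ k) :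
    ∃ C : ℝ≥0∞, C ≠ ⊤ ∧ ∀ (c : Rn n) (t : ℝ), 0 < t →
      ∫⁻ y in ball c (k * t), ENNReal.ofReal (ω y) ≤
        C * ENNReal.ofReal (Psi ρ θ c t) ^ q * ∫⁻ y in ball c t, ENNReal.ofReal (ω y) := by
  obtain ⟨C, hC, hav⟩ := h.exists_average_bound hρ
  refine ⟨C * ENNReal.ofReal (k ^ θ * k ^ n) ^ q,
    ENNReal.mul_ne_top hC (ENNReal.rpow_ne_top_of_nonneg hq.le ENNReal.ofReal_ne_top),
    fun c t ht => ?_⟩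
  have hk0 : 0 < k := by linarith
  have hsub : ball c t ⊆ ball c (k * t) := ball_subset_ball (by nlinarith)
  -- Testing the average bound on the indicator of the smaller ball compares the two weighted
  -- masses.
  have h1 := hav c (k * t) (by positivity) ((ball c t).indicator 1)
    ((measurable_const.indicator measurableSet_ball).aemeasurable)
  have h2 : ∫⁻ y in ball c (k * t), (ball c t).indicator 1 y = volume (ball c t) := by
    rw [lintegral_indicator_one measurableSet_ball, Measure.restrict_apply measurableSet_ball,
      Set.inter_eq_left.2 hsub]
  have h3 : ∫⁻ y in ball c (k * t), (ball c t).indicator 1 y ^ q * ENNReal.ofReal (ω y) =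
      ∫⁻ y in ball c t, ENNReal.ofReal (ω y) := by
    rw [← Set.inter_eq_left.2 hsub, ← setLIntegral_indicator measurableSet_ball,
      Set.inter_eq_left.2 hsub]
    refine lintegral_congr fun y => ?_
    by_cases hy : y ∈ ball c t
    · simp [hy]
    · simp [hy, hq]
  have hvol : volume (ball c (k * t)) = ENNReal.ofReal (k ^ n) * volume (ball c t) := by
    rw [Measure.addHaar_ball_of_pos volume c (by positivity : 0 < k * t),
      Measure.addHaar_ball_of_pos volume c ht, finrank_euclideanSpace_fin, mul_pow,
      ENNReal.ofReal_mul (by positivity), mul_assoc]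
  set v := volume (ball c t) with hv
  have hv0 : v ^ q ≠ 0 :=
    (ENNReal.rpow_pos (measure_ball_pos volume c ht) measure_ball_lt_top.ne).ne'
  have hvtop : v ^ q ≠ ⊤ := ENNReal.rpow_ne_top_of_nonneg hq.le measure_ball_lt_top.ne
  rw [h2, h3, hvol] at h1
  rw [← ENNReal.mul_le_mul_iff_right hv0 hvtop]
  refine h1.trans ?_
  have h4 : ENNReal.ofReal (Psi ρ θ c (k * t)) * (ENNReal.ofReal (k ^ n) * v) ≤
      ENNReal.ofReal (k ^ θ * k ^ n) * ENNReal.ofReal (Psi ρ θ c t) * v := by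
    rw [← mul_assoc, ← ENNReal.ofReal_mul (Psi_pos hρ θ c (by positivity)).le,
      ← ENNReal.ofReal_mul (by positivity)]
    refine mul_le_mul' (ENNReal.ofReal_le_ofReal ?_) le_rfl
    have := Psi_mul_le hρ hθ c ht hk
    have hkn : 0 ≤ k ^ n := by positivity
    nlinarith
  calc _ ≤ C * (ENNReal.ofReal (k ^ θ * k ^ n) * ENNReal.ofReal (Psi ρ θ c t) * v) ^ q *
        ∫⁻ y in ball c t, ENNReal.ofReal (ω y) := by gcongr
    _ = _ := by
      rw [ENNReal.mul_rpow_of_nonneg _ _ hq.le, ENNReal.mul_rpow_of_nonneg _ _ hq.le]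
      ring

end WeightedMaximal

end LocalHardy

namespace LocalHardy

variable {n : ℕ}

/-! ### Weak and strong type bounds for the centred maximal function. -/

section StrongType

/-- The measure `ω dx`. -/
noncomputable def weightMeasure (ω : Rn n → ℝ) : Measure (Rn n) :=
  volume.withDensity fun x => ENNReal.ofReal (ω x)

theorem IsWeight.aemeasurable_ofReal {ω : Rn n → ℝ} (hω : IsWeight ω) :
    AEMeasurable fun x => ENNReal.ofReal (ω x) :=
  hω.locallyIntegrable.aestronglyMeasurable.aemeasurable.ennreal_ofReal

theorem IsWeight.lintegral_weightMeasure {ω : Rn n → ℝ} (hω : IsWeight ω) (g : Rn n → ℝ≥0∞) :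
    ∫⁻ x, g x ∂weightMeasure ω = ∫⁻ x, g x * ENNReal.ofReal (ω x) := by
  rw [weightMeasure, lintegral_withDensity_eq_lintegral_mul_non_measurable₀ _
    hω.aemeasurable_ofReal (Filter.Eventually.of_forall fun _ => ENNReal.ofReal_lt_top)]
  exact lintegral_congr fun x => mul_comm _ _

theorem IsWeight.setLIntegral_weightMeasure {ω : Rn n → ℝ} (hω : IsWeight ω)
    (g : Rn n → ℝ≥0∞) {s : Set (Rn n)} (hs : MeasurableSet s) :
    ∫⁻ x in s, g x ∂weightMeasure ω = ∫⁻ x in s, g x * ENNReal.ofReal (ω x) := by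
  rw [weightMeasure, restrict_withDensity hs,
    lintegral_withDensity_eq_lintegral_mul_non_measurable₀ _
    hω.aemeasurable_ofReal.restrict (Filter.Eventually.of_forall fun _ => ENNReal.ofReal_lt_top)]
  exact lintegral_congr fun x => mul_comm _ _

/-- Both doubling and the average bound cost a factor `Ψ_θ^q`. Averaging with `2 * θ` supplies
`Ψ_θ²` and pays for both. The dilation `6` leaves room for the constant `5` of the covering lemma.
-/
theorem MemAp.exists_ball_bound {ρ : Rn n → ℝ} (hρ : ∀ x, 0 < ρ x) {q θ : ℝ} (hq : 0 < q)
    (hθ : 0 ≤ θ) {ω : Rn n → ℝ} (h : MemAp ρ q θ ω) :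
    ∃ C : ℝ≥0∞, C ≠ ⊤ ∧ ∀ g : Rn n → ℝ≥0∞, AEMeasurable g → ∀ (s : ℝ≥0∞) (c : Rn n) (t : ℝ),
      0 < t → s < psiMean ρ (2 * θ) g c t →
      s ^ q * weightMeasure ω (ball c (6 * t)) ≤ C * ∫⁻ x in ball c t, g x ^ q ∂weightMeasure ω := by
  obtain ⟨C, hC, hav⟩ := h.exists_average_bound hρ
  obtain ⟨D, hD, hdb⟩ := h.exists_doubling hρ hq hθ (k := 6) (by norm_num)
  refine ⟨D * C, ENNReal.mul_ne_top hD hC, fun g hg s c t ht hs => ?_⟩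
  have hav := hav c t ht g hg
  have hdb := hdb c t ht
  rw [h.1.setLIntegral_weightMeasure _ measurableSet_ball, weightMeasure,
    withDensity_apply _ measurableSet_ball]
  set P := ENNReal.ofReal (Psi ρ θ c t) with hP
  have hP0 : P ≠ 0 := (ENNReal.ofReal_pos.2 (Psi_pos hρ θ c ht)).ne'
  have hPtop : P ≠ ⊤ := ENNReal.ofReal_ne_top
  have hP2 : ENNReal.ofReal (Psi ρ (2 * θ) c t) = P * P := by
    have := hρ c
    rw [hP, ← ENNReal.ofReal_mul (Psi_pos hρ θ c ht).le, Psi, Psi, ← Real.rpow_add (by positivity),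
      two_mul]
  set v := volume (ball c t) with hv
  have hv0 : v ≠ 0 := (measure_ball_pos volume c ht).ne'
  have hvtop : v ≠ ⊤ := measure_ball_lt_top.ne
  rw [psiMean, hP2, ← hv] at hs
  have hs' : s * (P * P * v) ≤ ∫⁻ y in ball c t, g y :=
    (ENNReal.mul_lt_of_lt_div hs).le
  have h0 : (P * P * v) ^ q ≠ 0 :=
    (ENNReal.rpow_pos (pos_iff_ne_zero.2 (by simp [hP0, hv0])) (by finiteness)).ne'
  have htop : (P * P * v) ^ q ≠ ⊤ := ENNReal.rpow_ne_top_of_nonneg hq.le (by finiteness)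
  rw [← ENNReal.mul_le_mul_iff_right h0 htop]
  calc _ = (s * (P * P * v)) ^ q * ∫⁻ y in ball c (6 * t), ENNReal.ofReal (ω y) := by
        rw [ENNReal.mul_rpow_of_nonneg s _ hq.le]; ring
    _ ≤ (∫⁻ y in ball c t, g y) ^ q * (D * P ^ q * ∫⁻ y in ball c t, ENNReal.ofReal (ω y)) := by
        gcongr
    _ = D * P ^ q * ((∫⁻ y in ball c t, g y) ^ q * ∫⁻ y in ball c t, ENNReal.ofReal (ω y)) := by
        ring
    _ ≤ D * P ^ q * (C * (P * v) ^ q * ∫⁻ y in ball c t, g y ^ q * ENNReal.ofReal (ω y)) := by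
        gcongr
    _ = _ := by
        rw [mul_assoc P P v, ENNReal.mul_rpow_of_nonneg P (P * v) hq.le]
        ring

/-- Weighted weak type bound for the centred maximal function. -/
theorem MemAp.exists_weak_type {ρ : Rn n → ℝ} (hρ : ∀ x, 0 < ρ x) {q θ : ℝ} (hq : 0 < q)
    (hθ : 0 ≤ θ) {ω : Rn n → ℝ} (h : MemAp ρ q θ ω) :
    ∃ C : ℝ≥0∞, C ≠ ⊤ ∧ ∀ g : Rn n → ℝ≥0∞, AEMeasurable g → ∀ s : ℝ≥0∞,
      s ^ q * weightMeasure ω {x | s < centMax ρ (2 * θ) g x} ≤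
        C * ∫⁻ x, g x ^ q ∂weightMeasure ω := by
  obtain ⟨C, hC, hball⟩ := h.exists_ball_bound hρ hq hθ
  refine ⟨C, hC, fun g hg s => ?_⟩
  set μ := weightMeasure ω
  -- Vitali's lemma needs bounded radii, so these are truncated at `m`; the sets increase, and outer
  -- measure is continuous along them.
  set E : ℕ → Set (Rn n) := fun m => {x | ∃ t : ℝ, 0 < t ∧ t ≤ m ∧ s < psiMean ρ (2 * θ) g x t}
    with hE
  have hEunion : {x | s < centMax ρ (2 * θ) g x} = ⋃ m, E m := by
    ext x
    simp only [Set.mem_ofPred_eq, centMax, lt_iSup_iff, Set.mem_iUnion, hE]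
    constructor
    · rintro ⟨t, ht, hs⟩
      obtain ⟨m, hm⟩ := exists_nat_ge t
      exact ⟨m, t, ht, hm, hs⟩
    · rintro ⟨m, t, ht, -, hs⟩
      exact ⟨t, ht, hs⟩
  have hEmono : Monotone E := fun a b hab x ⟨t, ht, htm, hs⟩ =>
    ⟨t, ht, htm.trans (by exact_mod_cast hab), hs⟩
  rw [hEunion, hEmono.measure_iUnion, ENNReal.mul_iSup]
  refine iSup_le fun m => ?_
  have hex : ∀ x ∈ E m, ∃ t : ℝ, 0 < t ∧ t ≤ m ∧ s < psiMean ρ (2 * θ) g x t := fun x hx => hx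
  choose! τ hτ0 hτm hτ using hex
  obtain ⟨u, huE, hdisj, hcov⟩ := Vitali.exists_disjoint_subfamily_covering_enlargement_closedBall
    (E m) (id : Rn n → Rn n) τ m hτm 5 (by norm_num)
  have hdisj' : u.PairwiseDisjoint fun a => ball a (τ a) :=
    hdisj.mono fun a => ball_subset_closedBall
  have hcount : u.Countable := hdisj'.countable_of_isOpen (fun _ _ => isOpen_ball)
    fun a ha => ⟨a, mem_ball_self (hτ0 a (huE ha))⟩
  have hsub : E m ⊆ ⋃ b ∈ u, ball b (6 * τ b) := by
    intro x hx
    obtain ⟨b, hb, hxb⟩ := hcov x hx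
    have hτb := hτ0 b (huE hb)
    refine Set.mem_biUnion hb ?_
    exact closedBall_subset_ball (by linarith) (hxb (mem_closedBall_self (hτ0 x hx).le))
  calc s ^ q * μ (E m) ≤ s ^ q * ∑' b : u, μ (ball (b : Rn n) (6 * τ b)) := by
        gcongr
        exact (measure_mono hsub).trans (measure_biUnion_le μ hcount _)
    _ = ∑' b : u, s ^ q * μ (ball (b : Rn n) (6 * τ b)) := ENNReal.tsum_mul_left.symm
    _ ≤ ∑' b : u, C * ∫⁻ x in ball (b : Rn n) (τ b), g x ^ q ∂μ :=
        ENNReal.tsum_le_tsum fun b => hball g hg s b _ (hτ0 b (huE b.2)) (hτ b (huE b.2))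
    _ = C * ∑' b : u, ∫⁻ x in ball (b : Rn n) (τ b), g x ^ q ∂μ := ENNReal.tsum_mul_left
    _ = C * ∫⁻ x in ⋃ b ∈ u, ball (b : Rn n) (τ b), g x ^ q ∂μ := by
        rw [lintegral_biUnion hcount (fun _ _ => measurableSet_ball) hdisj']
    _ ≤ C * ∫⁻ x, g x ^ q ∂μ := by
        gcongr
        exact Measure.restrict_le_self

/-- The part of `g` below height `s` has all its averages at most `s`, since `Ψ ≥ 1`. This is the
bounded endpoint of the interpolation. -/
theorem centMax_le_add {ρ : Rn n → ℝ} (hρ : ∀ x, 0 < ρ x) {θ : ℝ} (hθ : 0 ≤ θ)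
    (g : Rn n → ℝ≥0∞) (s : ℝ≥0∞) (x : Rn n) :
    centMax ρ θ g x ≤ centMax ρ θ ({y | s < g y}.indicator g) x + s := by
  refine iSup₂_le fun t ht => ?_
  refine le_trans ?_ (add_le_add (le_iSup₂_of_le t ht le_rfl) le_rfl)
  set d := ENNReal.ofReal (Psi ρ θ x t) * volume (ball x t) with hd
  have hd0 : d ≠ 0 := mul_ne_zero (ENNReal.ofReal_pos.2 (Psi_pos hρ θ x ht)).ne'
    (measure_ball_pos volume x ht).ne'
  have hdtop : d ≠ ⊤ := ENNReal.mul_ne_top ENNReal.ofReal_ne_top measure_ball_lt_top.ne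
  rw [psiMean, psiMean, ← hd, ENNReal.div_le_iff hd0 hdtop, add_mul,
    ENNReal.div_mul_cancel hd0 hdtop]
  have h1 : ∀ y, g y ≤ {y | s < g y}.indicator g y + s := by
    intro y
    by_cases hy : s < g y
    · rw [Set.indicator_of_mem (show y ∈ {y | s < g y} from hy)]
      exact le_self_add
    · exact (not_lt.1 hy).trans le_add_self
  refine (lintegral_mono h1).trans ?_
  rw [lintegral_add_right _ measurable_const, setLIntegral_const]
  gcongr
  rw [hd]
  exact le_mul_of_one_le_left bot_le
    (by rw [ENNReal.one_le_ofReal]; exact one_le_Psi hρ hθ x ht)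

/-- A single term suffices for finite nonzero `m`, the one with `2 * 2 ^ k < m ≤ 4 * 2 ^ k`; for `m
= ⊤` the terms with `k ≥ 0` already diverge. -/
theorem rpow_le_tsum_dyadic {Q : ℝ} (hQ : 0 < Q) (m : ℝ≥0∞) :
    m ^ Q ≤ ∑' k : ℤ, (4 * (2 : ℝ≥0∞) ^ k) ^ Q * if 2 * (2 : ℝ≥0∞) ^ k < m then 1 else 0 := by
  rcases eq_or_ne m 0 with rfl | h0
  · simp [hQ]
  rcases eq_or_ne m ⊤ with rfl | htop
  · have htop : ∑' _ : ℕ, (1 : ℝ≥0∞) = ⊤ := ENNReal.tsum_const_eq_top_of_ne_zero one_ne_zero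
    refine (le_top.trans htop.ge).trans ?_
    refine le_trans ?_ (ENNReal.tsum_comp_le_tsum_of_injective (Nat.cast_injective (R := ℤ)) _)
    refine ENNReal.tsum_le_tsum fun k => ?_
    have h1 : 2 * (2 : ℝ≥0∞) ^ (k : ℤ) < ⊤ := by
      rw [zpow_natCast]; finiteness
    rw [if_pos h1, mul_one, zpow_natCast]
    refine ENNReal.one_le_rpow ?_ hQ
    exact one_le_mul_of_one_le_of_one_le (by norm_num) (one_le_pow₀ one_le_two)
  · obtain ⟨k, hk1, hk2⟩ := ENNReal.exists_mem_Ioc_zpow h0 htop ENNReal.one_lt_two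
      ENNReal.ofNat_ne_top
    have h2 : 2 * (2 : ℝ≥0∞) ^ (k - 1) = 2 ^ k := by
      have := ENNReal.zpow_add (x := 2) two_ne_zero ENNReal.ofNat_ne_top 1 (k - 1)
      rw [zpow_one, add_sub_cancel] at this
      exact this.symm
    refine le_trans ?_ (ENNReal.le_tsum (k - 1))
    rw [h2, if_pos hk1, mul_one]
    refine ENNReal.rpow_le_rpow (hk2.trans (le_of_eq ?_)) hQ.le
    rw [ENNReal.zpow_add two_ne_zero ENNReal.ofNat_ne_top, zpow_one, ← h2]
    ring

/-- A geometric series running downwards from the index with `2 ^ k < m ≤ 2 ^ (k + 1)`. -/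
theorem exists_tsum_dyadic_le {δ : ℝ} (hδ : 0 < δ) :
    ∃ T : ℝ≥0∞, T ≠ ⊤ ∧ ∀ m : ℝ≥0∞,
      ∑' k : ℤ, ((2 : ℝ≥0∞) ^ k) ^ δ * (if (2 : ℝ≥0∞) ^ k < m then 1 else 0) ≤ T * m ^ δ := by
  refine ⟨∑' i : ℕ, (2 : ℝ≥0∞) ^ (-(i * δ)), tsum_two_rpow_neg_ne_top hδ, fun m => ?_⟩
  rcases eq_or_ne m 0 with rfl | h0
  · simp
  rcases eq_or_ne m ⊤ with rfl | htop
  · rw [ENNReal.top_rpow_of_pos hδ, ENNReal.mul_top]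
    · exact le_top
    · refine (lt_of_lt_of_le ?_ (ENNReal.le_tsum 0)).ne'
      simp
  obtain ⟨k₀, hk1, hk2⟩ := ENNReal.exists_mem_Ioc_zpow h0 htop ENNReal.one_lt_two
      ENNReal.ofNat_ne_top
  have hinj : Function.Injective fun i : ℕ => k₀ - (i : ℤ) := fun a b hab => by
    simpa using hab
  rw [← hinj.tsum_eq, ← ENNReal.tsum_mul_right]
  · refine ENNReal.tsum_le_tsum fun i => ?_
    have h1 : ((2 : ℝ≥0∞) ^ (k₀ - (i : ℤ))) ^ δ = 2 ^ (-(i * δ)) * ((2 : ℝ≥0∞) ^ k₀) ^ δ := by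
      rw [← ENNReal.rpow_intCast, ← ENNReal.rpow_intCast, ← ENNReal.rpow_mul, ← ENNReal.rpow_mul,
        ← two_rpow_add]
      congr 1
      push_cast
      ring
    calc _ ≤ ((2 : ℝ≥0∞) ^ (k₀ - (i : ℤ))) ^ δ := by
          refine mul_le_of_le_one_right bot_le ?_
          split_ifs <;> simp
      _ ≤ _ := by rw [h1]; gcongr
  · intro k hk
    by_contra hrange
    refine hk ?_
    have hk' : k₀ + 1 ≤ k := by
      by_contra hlt
      exact hrange ⟨(k₀ - k).toNat, by simp only; omega⟩
    dsimp only
    rw [if_neg, mul_zero]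
    exact not_lt.2 (hk2.trans (ENNReal.zpow_le_of_le one_le_two hk'))

/-- Weighted strong type bound for the centred maximal function. -/
theorem MemAp.exists_strong_type {ρ : Rn n → ℝ} (hρ : ∀ x, 0 < ρ x) {q θ : ℝ} (hq : 0 < q)
    (hθ : 0 ≤ θ) {ω : Rn n → ℝ} (h : MemAp ρ q θ ω) {Q : ℝ} (hQ : q < Q) :
    ∃ C : ℝ≥0∞, C ≠ ⊤ ∧ ∀ g : Rn n → ℝ≥0∞, Measurable g →
      ∫⁻ x, centMax ρ (2 * θ) g x ^ Q ∂weightMeasure ω ≤ C * ∫⁻ x, g x ^ Q ∂weightMeasure ω := by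
  obtain ⟨C, hC, hweak⟩ := h.exists_weak_type hρ hq hθ
  obtain ⟨T, hT, hdy⟩ := exists_tsum_dyadic_le (sub_pos.2 hQ)
  have hQ0 : 0 < Q := hq.trans hQ
  have h4 : (4 : ℝ≥0∞) ^ Q ≠ ⊤ := ENNReal.rpow_ne_top_of_nonneg hQ0.le (by simp)
  refine ⟨4 ^ Q * C * T, by finiteness, fun g hg => ?_⟩
  set μ := weightMeasure ω
  set M := centMax ρ (2 * θ) g
  set b : ℤ → ℝ≥0∞ := fun k => 2 ^ k with hb
  have hb0 : ∀ k, b k ≠ 0 := fun k => (ENNReal.zpow_pos two_ne_zero ENNReal.ofNat_ne_top k).ne'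
  have hbtop : ∀ k, b k ≠ ⊤ := fun k => ENNReal.zpow_ne_top two_ne_zero ENNReal.ofNat_ne_top k
  -- Only the part of `g` above `b k` can push the maximal function above `2 * b k`.
  have hlevel : ∀ k, (b k) ^ q * μ {x | 2 * b k < M x} ≤
      C * ∫⁻ x, g x ^ q * (if b k < g x then 1 else 0) ∂μ := by
    intro k
    have hm : MeasurableSet {y | b k < g y} := measurableSet_lt measurable_const hg
    have h1 := hweak ({y | b k < g y}.indicator g) (hg.indicator hm).aemeasurable (b k)
    have h2 : {x | 2 * b k < M x} ⊆
        {x | b k < centMax ρ (2 * θ) ({y | b k < g y}.indicator g) x} := by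
      intro x hx
      have h3 := lt_of_lt_of_le hx (centMax_le_add hρ (by linarith) g (b k) x)
      rw [two_mul] at h3
      exact lt_of_add_lt_add_right h3
    refine (mul_le_mul' le_rfl (measure_mono h2)).trans (h1.trans (le_of_eq ?_))
    congr 1
    refine lintegral_congr fun x => ?_
    by_cases hx : b k < g x
    · rw [Set.indicator_of_mem (show x ∈ {y | b k < g y} from hx), if_pos hx, mul_one]
    · rw [Set.indicator_of_notMem (show x ∉ {y | b k < g y} from hx), if_neg hx, mul_zero,
        ENNReal.zero_rpow_of_pos hq]
  -- Measurable hulls have the same measure as the level sets and allow sum and integral to be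
  -- exchanged without measurability of `M`.
  set F : ℤ → Set (Rn n) := fun k => toMeasurable μ {x | 2 * b k < M x} with hF
  have hFm : ∀ k, MeasurableSet (F k) := fun k => measurableSet_toMeasurable _ _
  calc ∫⁻ x, M x ^ Q ∂μ ≤ ∫⁻ x, ∑' k : ℤ, (F k).indicator (fun _ => (4 * b k) ^ Q) x ∂μ := by
        refine lintegral_mono fun x => (rpow_le_tsum_dyadic hQ0 (M x)).trans
          (ENNReal.tsum_le_tsum fun k => ?_)
        split_ifs with hx
        · rw [Set.indicator_of_mem (subset_toMeasurable μ _ hx), mul_one]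
        · simp
    _ = ∑' k : ℤ, (4 * b k) ^ Q * μ {x | 2 * b k < M x} := by
        rw [lintegral_tsum fun k => (measurable_const.indicator (hFm k)).aemeasurable]
        refine tsum_congr fun k => ?_
        rw [lintegral_indicator_const (hFm k), measure_toMeasurable]
    _ = ∑' k : ℤ, (4 : ℝ≥0∞) ^ Q * (b k ^ (Q - q) * (b k ^ q * μ {x | 2 * b k < M x})) := by
        refine tsum_congr fun k => ?_
        rw [← mul_assoc (b k ^ (Q - q)), ← ENNReal.rpow_add _ _ (hb0 k) (hbtop k), sub_add_cancel,
          ENNReal.mul_rpow_of_nonneg _ _ hQ0.le, mul_assoc]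
    _ ≤ ∑' k : ℤ, (4 : ℝ≥0∞) ^ Q * (b k ^ (Q - q) *
          (C * ∫⁻ x, g x ^ q * (if b k < g x then 1 else 0) ∂μ)) := by
        refine ENNReal.tsum_le_tsum fun k => ?_
        exact mul_le_mul' le_rfl (mul_le_mul' le_rfl (hlevel k))
    _ = 4 ^ Q * C * ∑' k : ℤ, ∫⁻ x, g x ^ q * (b k ^ (Q - q) * (if b k < g x then 1 else 0)) ∂μ := by
        rw [← ENNReal.tsum_mul_left]
        refine tsum_congr fun k => ?_
        have : ∀ x, g x ^ q * (b k ^ (Q - q) * (if b k < g x then 1 else 0)) =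
            b k ^ (Q - q) * (g x ^ q * (if b k < g x then 1 else 0)) := fun x => by ring
        simp_rw [this]
        rw [lintegral_const_mul' _ _ (ENNReal.rpow_ne_top_of_nonneg (by linarith) (hbtop k))]
        ring
    _ = 4 ^ Q * C * ∫⁻ x, g x ^ q *
          ∑' k : ℤ, b k ^ (Q - q) * (if b k < g x then 1 else 0) ∂μ := by
        rw [← lintegral_tsum]
        · simp_rw [ENNReal.tsum_mul_left]
        · intro k
          refine ((hg.pow_const _).mul (measurable_const.mul ?_)).aemeasurable
          exact Measurable.ite (measurableSet_lt measurable_const hg) measurable_const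
            measurable_const
    _ ≤ 4 ^ Q * C * ∫⁻ x, T * g x ^ Q ∂μ := by
        refine mul_le_mul' le_rfl (lintegral_mono fun x => ?_)
        calc _ ≤ g x ^ q * (T * g x ^ (Q - q)) := mul_le_mul' le_rfl (hdy (g x))
          _ = T * (g x ^ q * g x ^ (Q - q)) := by ring
          _ = _ := by
            rw [← ENNReal.rpow_add_of_nonneg _ _ hq.le (by linarith), add_sub_cancel]
    _ = _ := by rw [lintegral_const_mul' _ _ hT]; ring

end StrongType

end LocalHardy

namespace LocalHardy

variable {n : ℕ}

/-! ### Weighted `L^p` bounds. -/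

section LpBounds

theorem MemAInfInf.one_le_critIndex {ρ ω : Rn n → ℝ} (hω : MemAInfInf ρ ω) :
    1 ≤ critIndex ρ ω := by
  obtain ⟨q, hq, h⟩ := hω
  exact le_csInf ⟨q, hq, h⟩ fun _ h => h.1

/-- Lying strictly above the infimum leaves the gap `q < s` that interpolation needs, so no
self-improvement of weights is required. -/
theorem MemAInfInf.exists_memAp {ρ ω : Rn n → ℝ} (hω : MemAInfInf ρ ω) {s : ℝ}
    (hs : critIndex ρ ω < s) : ∃ q θ : ℝ, 1 ≤ q ∧ q < s ∧ 0 ≤ θ ∧ MemAp ρ q θ ω := by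
  obtain ⟨q₀, hq₀, h₀⟩ := hω
  obtain ⟨q, ⟨hq1, θ, hθ, hq⟩, hqs⟩ := exists_lt_of_csInf_lt
    (s := {q : ℝ | 1 ≤ q ∧ MemApInf ρ q ω}) ⟨q₀, hq₀, h₀⟩ hs
  exact ⟨q, θ, hq1, hqs, hθ, hq⟩

theorem lpNorm_le_of_le_mul {p : ℝ} (hp : 0 < p) (ω : Rn n → ℝ) {g h : Rn n → ℝ≥0∞} {C : ℝ≥0∞}
    (hC : C ≠ ⊤) (hgh : ∀ x, g x ≤ C * h x) : lpNorm p ω g ≤ C * lpNorm p ω h := by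
  have h1 : ∫⁻ x, g x ^ p * ENNReal.ofReal (ω x) ≤
      C ^ p * ∫⁻ x, h x ^ p * ENNReal.ofReal (ω x) := by
    rw [← lintegral_const_mul' _ _ (ENNReal.rpow_ne_top_of_nonneg hp.le hC)]
    refine lintegral_mono fun x => ?_
    rw [← mul_assoc, ← ENNReal.mul_rpow_of_nonneg _ _ hp.le]
    exact mul_le_mul' (ENNReal.rpow_le_rpow (hgh x) hp.le) le_rfl
  unfold lpNorm
  refine (ENNReal.rpow_le_rpow h1 (by positivity)).trans (le_of_eq ?_)
  rw [ENNReal.mul_rpow_of_nonneg _ _ (by positivity), ← ENNReal.rpow_mul,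
    mul_one_div_cancel hp.ne', ENNReal.rpow_one]

/-- The weighted `L^p` bound of the Peetre maximal function by the vertical one. -/
theorem exists_lpNorm_peetreMax_le (hn : 0 < n) {ρ : Rn n → ℝ} (hρ : IsCriticalRadius ρ)
    {ω : Rn n → ℝ} (hω : MemAInfInf ρ ω) {p : ℝ} (hp : 0 < p) (hp1 : p ≤ 1) {ψ : TestFn n}
    (hψ : (∫ x, ψ x) ≠ 0) {A B : ℝ} (hA : n * critIndex ρ ω / p < A) (hB : 0 < B) :
    ∃ C : ℝ≥0∞, C ≠ ⊤ ∧ ∀ f : Distr n,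
      lpNorm p ω (peetreMax ρ ψ A B f) ≤ C * lpNorm p ω (vertMax ρ ψ f) := by
  have hn' : (0 : ℝ) < n := by exact_mod_cast hn
  have hcrit := hω.one_le_critIndex
  have hA0 : 0 < A := lt_of_le_of_lt (by positivity) hA
  -- This choice gives `A r = n`, and `A > n q_ω / p` becomes `p / r > q_ω`. Since `q_ω ≥ 1` and `p
  -- ≤ 1`, also `r ≤ 1`.
  set r : ℝ := n / A with hr
  have hr0 : 0 < r := by positivity
  rw [div_lt_iff₀ hp] at hA
  have hrp : critIndex ρ ω < p / r := by
    rw [hr, div_div_eq_mul_div, lt_div_iff₀ hn']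
    linarith
  have hr1 : r ≤ 1 := by
    have := hcrit.trans_lt hrp
    rw [lt_div_iff₀ hr0] at this
    linarith
  obtain ⟨q, θ, hq1, hqs, hθ, hmem⟩ := hω.exists_memAp hrp
  obtain ⟨C₁, hC₁, hpoint⟩ := exists_peetreMax_le hρ hψ hr0 hr1 (θ := 2 * θ) (by positivity)
    (A := A) (B := B) (by rw [hr, mul_div_cancel₀ _ hA0.ne']) hB
  obtain ⟨C₂, hC₂, hstrong⟩ := hmem.exists_strong_type hρ.pos (by linarith) hθ hqs
  have hQ : 0 < p / r := by positivity
  have hC₁' : C₁ ^ (p / r) ≠ ⊤ := ENNReal.rpow_ne_top_of_nonneg hQ.le hC₁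
  refine ⟨(C₁ ^ (p / r) * C₂) ^ (1 / p),
    ENNReal.rpow_ne_top_of_nonneg (by positivity) (ENNReal.mul_ne_top hC₁' hC₂), fun f => ?_⟩
  have hpow : ∀ g : ℝ≥0∞, (g ^ r) ^ (p / r) = g ^ p := fun g => by
    rw [← ENNReal.rpow_mul, mul_div_cancel₀ _ hr0.ne']
  have hmain : ∫⁻ x, peetreMax ρ ψ A B f x ^ p ∂weightMeasure ω ≤
      C₁ ^ (p / r) * C₂ * ∫⁻ x, vertMax ρ ψ f x ^ p ∂weightMeasure ω := by
    have h := hstrong (fun w => vertMax ρ ψ f w ^ r) ((measurable_vertMax hρ ψ f).pow_const r)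
    simp only [hpow] at h
    rw [mul_assoc]
    refine le_trans ?_ (mul_le_mul' le_rfl h)
    rw [← lintegral_const_mul' _ _ hC₁']
    refine lintegral_mono fun x => ?_
    rw [← hpow, ← ENNReal.mul_rpow_of_nonneg _ _ hQ.le]
    exact ENNReal.rpow_le_rpow (hpoint f x) hQ.le
  rw [hmem.1.lintegral_weightMeasure, hmem.1.lintegral_weightMeasure] at hmain
  unfold lpNorm
  rw [← ENNReal.mul_rpow_of_nonneg _ _ (by positivity)]
  exact ENNReal.rpow_le_rpow hmain (by positivity)

end LpBounds

end LocalHardy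

/-! ### The main theorem: choice of exponents and constants. -/

theorem theorem3p1 (n : ℕ) (hn : 0 < n)
    (ρ : LocalHardy.Rn n → ℝ) (hρ : LocalHardy.IsCriticalRadius ρ)
    (ω : LocalHardy.Rn n → ℝ) (hω : LocalHardy.MemAInfInf ρ ω)
    (R : ℝ) (hR : 0 < R) (p : ℝ) (hp : 0 < p) (hp1 : p ≤ 1)
    (ψ₀ : LocalHardy.TestFn n) (hψ₀ : (∫ x, ψ₀ x) ≠ 0)
    (A₀ B₀ : ℝ) (hA₀ : 0 < A₀) (hB₀ : 0 < B₀)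
    (A₁ B₁ : ℝ) (N₀ : ℤ)
    (hA₁ : A₁ = max A₀ (n * LocalHardy.critIndex ρ ω / p))
    (hB₁ : B₁ = B₀ / p)
    (hN₀ : N₀ = ⌊2 * A₁⌋ + 1)
    (A B : ℝ) (hA : A₁ < A) (hB : B₁ < B) (N : ℕ) (hN : N₀ ≤ (N : ℤ)) :
    ∃ C : ℝ, 0 < C ∧ ∀ f : LocalHardy.Distr n,
      LocalHardy.lpNorm p ω (LocalHardy.peetreMax ρ ψ₀ A B f) ≤
          ENNReal.ofReal C * LocalHardy.lpNorm p ω (LocalHardy.vertMax ρ ψ₀ f) ∧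
      LocalHardy.lpNorm p ω (LocalHardy.grandMax ρ N R f) ≤
          ENNReal.ofReal C * LocalHardy.lpNorm p ω (LocalHardy.vertMax ρ ψ₀ f) := by
  have hcrit := hω.one_le_critIndex
  have hA₁0 : 0 < A₁ := hA₁ ▸ lt_max_of_lt_left hA₀
  have hcritA : n * LocalHardy.critIndex ρ ω / p ≤ A₁ := hA₁ ▸ le_max_right _ _
  have hB0 : 0 < B := (hB₁ ▸ div_pos hB₀ hp : 0 < B₁).trans hB
  have hNA : A₁ < N := by
    have h1 := Int.lt_floor_add_one (2 * A₁)
    have h2 : ((⌊2 * A₁⌋ + 1 : ℤ) : ℝ) ≤ N := by rw [← hN₀]; exact_mod_cast hN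
    push_cast at h2
    linarith
  -- The given `A` may exceed `N`, so the grand maximal function is compared with a Peetre function
  -- having its own exponent `A'` between `A₁` and `N`.
  obtain ⟨A', hA'1, hA'2⟩ := exists_between hNA
  obtain ⟨C₁, hC₁, h1⟩ := LocalHardy.exists_lpNorm_peetreMax_le hn hρ hω hp hp1 hψ₀
    (hcritA.trans_lt hA) hB0
  obtain ⟨C₂, hC₂, h2⟩ := LocalHardy.exists_lpNorm_peetreMax_le hn hρ hω hp hp1 hψ₀
    (hcritA.trans_lt hA'1) hB0
  obtain ⟨C₃, hC₃, h3⟩ := LocalHardy.exists_grandMax_le hρ.pos hψ₀ hR (hA₁0.trans hA'1).le hA'2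
    hB0.le
  have hle : ∀ a b : ℝ≥0∞, a ≠ ⊤ → b ≠ ⊤ →
      a ≤ ENNReal.ofReal (a.toReal + b.toReal + 1) ∧
      b ≤ ENNReal.ofReal (a.toReal + b.toReal + 1) := by
    intro a b ha hb
    constructor
    · rw [ENNReal.le_ofReal_iff_toReal_le ha (by positivity)]
      linarith [ENNReal.toReal_nonneg (a := b)]
    · rw [ENNReal.le_ofReal_iff_toReal_le hb (by positivity)]
      linarith [ENNReal.toReal_nonneg (a := a)]
  obtain ⟨hl1, hl2⟩ := hle C₁ (C₃ * C₂) hC₁ (ENNReal.mul_ne_top hC₃ hC₂)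
  refine ⟨C₁.toReal + (C₃ * C₂).toReal + 1, by positivity, fun f => ⟨?_, ?_⟩⟩
  · exact (h1 f).trans (mul_le_mul' hl1 le_rfl)
  · refine (LocalHardy.lpNorm_le_of_le_mul hp ω hC₃ (h3 f)).trans ?_
    refine (mul_le_mul' le_rfl (h2 f)).trans ?_
    rw [← mul_assoc]
    exact mul_le_mul' hl2 le_rfl
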